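/- Let $d\in\{2,3\}$ and let $\Omega\subset\mathbb R^d$ be a bounded, convex, polygonal (resp. polyhedral) domain with boundary $\Gamma=\partial\Omega$. For $h>0$ let $\mathcal T_h$ be a finite conforming partition of $\Omega$ into open nonobtuse simplices, and let $\mathcal T_h^\Gamma$ be the induced partition of $\Gamma$ into $(d-1)$-dimensional nonobtuse simplices. Every $K^\Gamma\in\mathcal T_h^\Gamma$ satisfies $\overline{K^\Gamma}=\overline K\cap\Gamma$ for exactly one $K\in\mathcal T_h$. Quasiuniformity: with some $\rho>0$ independent of $h$, all simplices of both partitions have diameter at most $h$ and contain a ball of radius $\rho h$ (taken in their affine hull). Let $U_h^\Omega$, $U_h^\Gamma$ be the spaces of continuous, piecewise linear functions on $\mathcal T_h$, $\mathcal T_h^\Gamma$, and $\mathcal I_h$, $\mathcal I_h^\Gamma$ the corresponding nodal interpolation operators. Let $T>0$, $N\in\mathbb N$ with $N\ge 1$, $\tau=T/N$, and let $m,m_\Gamma,\sigma,\delta,\delta_\Gamma>0$ and $\kappa\ge 0$ be constants. Let $F,G\in C^1(\mathbb R)$ be bounded from below, $F=F_++F_-$, $G=G_++G_-$ with $F_\pm,G_\pm\in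 C^1(\mathbb R)$, $F_+,G_+$ convex and non-negative, $F_-,G_-$ concave. Suppose that each of $F_\pm,G_\pm$ is the sum of a polynomial of degree at most four and a function with globally Lipschitz continuous derivative. Let $\beta\ge0$ (with $\beta>0$ if $\kappa=0$) be such that $$G_-'(s_2)(s_1-s_2)\ \ge\ G_-(s_1)-G_-(s_2)+\beta|s_1-s_2|^2\qquad\text{for all } s_1,s_2\in\mathbb R.$$ Let $\phi_0\in L^2(\Omega)$, let $\phi_h^0$ be the $L^2(\Omega)$-orthogonal projection of $\phi_0$ onto $U_h^\Omega$, and assume that, with a constant $C_0$ independent of $h$ and $\tau$, $$\int_\Omega|\nabla\phi_h^0|^2+\int_\Omega\mathcal I_h\{F(\phi_h^0)\}+\kappa\int_\Gamma|\nabla_\Gamma\phi_h^0|^2+\int_\Gamma\mathcal I_h^\Gamma\{G(\phi_h^0)\}\le C_0 .$$ Then there are $h_0>0$ and $C>0$, independent of $h$ and $\tau$ (they depend on the partitions only through $\rho$), such that for all $0<h<h_0$, all partitions as above and all $N\ge1$, the following holds. If $\phi_h^n,\mu_h^n\in U_h^\Omega$, $\mu_{\Gamma,h}^n\in U_h^\Gamma$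 ($n=1,\dots,N$) satisfy, for all $n=1,\dots,N$ and all $\theta_h\in U_h^\Omega$, $$\int_\Omega\mathcal I_h\{\phi_h^n\theta_h\}+\tau m\int_\Omega\nabla\mu_h^n\cdot\nabla\theta_h=\int_\Omega\mathcal I_h\{\phi_h^{n-1}\theta_h\},$$ $$\int_\Gamma\mathcal I_h^\Gamma\{\phi_h^n\theta_h\}+\tau m_\Gamma\int_\Gamma\nabla_\Gamma\mu_{\Gamma,h}^n\cdot\nabla_\Gamma\theta_h=\int_\Gamma\mathcal I_h^\Gamma\{\phi_h^{n-1}\theta_h\},$$ $$\begin{aligned}\int_\Omega\mathcal I_h\{\mu_h^n\theta_h\}+\int_\Gamma\mathcal I_h^\Gamma\{\mu_{\Gamma,h}^n\theta_h\}={}&\delta\sigma\int_\Omega\nabla\phi_h^n\cdot\nabla\theta_h+\delta^{-1}\sigma\int_\Omega\mathcal I_h\{(F_+'(\phi_h^n)+F_-'(\phi_h^{n-1}))\theta_h\}\\&+\kappa\delta_\Gamma\int_\Gamma\nabla_\Gamma\phi_h^n\cdot\nabla_\Gamma\theta_h+\delta_\Gamma^{-1}\int_\Gamma\mathcal I_h^\Gamma\{(G_+'(\phi_h^n)+G_-'(\phi_h^{n-1}))\theta_h\},\end{aligned}$$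 then $$\begin{aligned}&\max_{0\le n\le N}\|\phi_h^n\|_{H^1(\Omega)}^2+\max_{0\le n\le N}\int_\Omega\mathcal I_h\{F(\phi_h^n)\}+\kappa\max_{0\le n\le N}\|\phi_h^n\|_{H^1(\Gamma)}^2+\max_{0\le n\le N}\int_\Gamma\mathcal I_h^\Gamma\{G(\phi_h^n)\}\\&+\sum_{n=1}^N\int_\Omega|\nabla\phi_h^n-\nabla\phi_h^{n-1}|^2+\kappa\sum_{n=1}^N\int_\Gamma|\nabla_\Gamma\phi_h^n-\nabla_\Gamma\phi_h^{n-1}|^2+\beta\sum_{n=1}^N\int_\Gamma|\phi_h^n-\phi_h^{n-1}|^2\\&+\tau m\sum_{n=1}^N\|\mu_h^n\|_{H^1(\Omega)}^2+\tau m_\Gamma\sum_{n=1}^N\|\mu_{\Gamma,h}^n\|_{H^1(\Gamma)}^2\le C.\end{aligned}$$ -/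

import Mathlib

open MeasureTheory Set

namespace CahnHilliardFEM

noncomputable section

/-- The ambient Euclidean space `ℝ^d`. -/
abbrev Space (d : ℕ) : Type := EuclideanSpace ℝ (Fin d)

/-! ### Domains and partitions -/

/-- A bounded convex polygonal (`d = 2`) or polyhedral (`d = 3`) domain: a nonempty open convex set
whose closure is the convex hull of finitely many points. -/
structure IsConvexPolytopeDomain {d : ℕ} (Ω : Set (Space d)) : Prop where
  isOpen : IsOpen Ω
  nonempty : Ω.Nonempty
  convex : Convex ℝ Ω
  polytope : ∃ V : Finset (Space d), closure Ω = convexHull ℝ (V : Set (Space d))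

/-- `w` is the vector of barycentric coordinates of `x` with respect to the simplex with vertex
set `s` (extended by zero to points that are not in `s`). -/
def IsBarycentric {d : ℕ} (s : Finset (Space d)) (x : Space d) (w : Space d → ℝ) : Prop :=
  (∀ v ∈ s, 0 ≤ w v) ∧ (∀ v, v ∉ s → w v = 0) ∧ ∑ v ∈ s, w v = 1 ∧ ∑ v ∈ s, w v • v = x

open Classical in
/-- The `d`-dimensional simplices (given by their vertex sets) of a finite simplicial complex. -/
def topCells {d : ℕ} (K : Geometry.SimplicialComplex ℝ (Space d)) (hK : K.faces.Finite) :
    Finset (Finset (Space d)) :=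
  hK.toFinset.filter fun s => s.card = d + 1

open Classical in
/-- The `(d-1)`-dimensional simplices (given by their vertex sets) of a finite simplicial complex
that lie on the boundary of `Ω`. -/
def boundaryFacets {d : ℕ} (Ω : Set (Space d)) (K : Geometry.SimplicialComplex ℝ (Space d))
    (hK : K.faces.Finite) : Finset (Finset (Space d)) :=
  hK.toFinset.filter fun s => s.card = d ∧ convexHull ℝ (s : Set (Space d)) ⊆ frontier Ω

/-- A partition `𝒯_h` of `Ω` into simplices, together with the induced partition `𝒯_h^Γ` of
`Γ = ∂Ω`. Simplices are represented by their vertex sets; the closed simplex is the convex hull. -/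
structure Mesh {d : ℕ} (Ω : Set (Space d)) where
  /-- The simplicial complex formed by the simplices of the partition and all their faces. -/
  complex : Geometry.SimplicialComplex ℝ (Space d)
  finite : complex.faces.Finite
  /-- The closed simplices of `𝒯_h` cover `closure Ω`. -/
  covers : ⋃ s ∈ topCells complex finite, convexHull ℝ (s : Set (Space d)) = closure Ω
  /-- `complex` contains nothing else than the simplices of `𝒯_h` and their faces. -/
  pure : ∀ s ∈ complex.faces, ∃ t ∈ topCells complex finite, s ⊆ t
  /-- The closed simplices of `𝒯_h^Γ` cover `Γ`. -/
  boundary_covers :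
    ⋃ s ∈ boundaryFacets Ω complex finite, convexHull ℝ (s : Set (Space d)) = frontier Ω
  /-- Every closed simplex of `𝒯_h^Γ` is the intersection with `Γ` of exactly one closed simplex
  of `𝒯_h`. -/
  boundary_compatible : ∀ s ∈ boundaryFacets Ω complex finite,
    ∃! t, t ∈ topCells complex finite ∧
      convexHull ℝ (s : Set (Space d)) = convexHull ℝ (t : Set (Space d)) ∩ frontier Ω

/-- The simplex with vertex set `s` contains a ball of radius `r`, the ball being taken in the
affine span of the simplex. -/
def ContainsBall {d : ℕ} (s : Finset (Space d)) (r : ℝ) : Prop :=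
  ∃ c ∈ affineSpan ℝ (s : Set (Space d)),
    Metric.ball c r ∩ (affineSpan ℝ (s : Set (Space d)) : Set (Space d)) ⊆
      convexHull ℝ (s : Set (Space d))

/-- The simplex with vertex set `s` is nonobtuse: for any two distinct vertices `p`, `q`, the
dihedral angle at the common face `s \ {p, q}` of the facets opposite to `q` and `p` is at most
`π / 2`. Here `a` and `b` are the feet of the perpendiculars from `p` and `q` to the affine span of
that face (for an edge the face is empty, and there is no condition). -/
def IsNonobtuse {d : ℕ} (s : Finset (Space d)) : Prop :=
  ∀ p ∈ s, ∀ q ∈ s, p ≠ q → ∀ a b : Space d,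
    a ∈ affineSpan ℝ ((s : Set (Space d)) \ {p, q}) →
    b ∈ affineSpan ℝ ((s : Set (Space d)) \ {p, q}) →
    (∀ v ∈ vectorSpan ℝ ((s : Set (Space d)) \ {p, q}), inner ℝ (p - a) v = 0) →
    (∀ v ∈ vectorSpan ℝ ((s : Set (Space d)) \ {p, q}), inner ℝ (q - b) v = 0) →
    InnerProductGeometry.angle (p - a) (q - b) ≤ Real.pi / 2

namespace Mesh

variable {d : ℕ} {Ω : Set (Space d)}

/-- The simplices of `𝒯_h`. -/
def cells (M : Mesh Ω) : Finset (Finset (Space d)) := topCells M.complex M.finite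

/-- The simplices of `𝒯_h^Γ`. -/
def bdryCells (M : Mesh Ω) : Finset (Finset (Space d)) := boundaryFacets Ω M.complex M.finite

open Classical in
/-- The vertices of `𝒯_h`. -/
def vertices (M : Mesh Ω) : Finset (Space d) := M.cells.biUnion id

open Classical in
/-- The vertices of `𝒯_h^Γ`. -/
def bdryVertices (M : Mesh Ω) : Finset (Space d) := M.bdryCells.biUnion id

/-- Admissibility with mesh size `h` and quasiuniformity constant `ρ`: all simplices of `𝒯_h` and
of `𝒯_h^Γ` are nonobtuse, have diameter at most `h`, and contain a ball of radius `ρ * h`. A family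
of meshes (indexed by `h`) is quasiuniform if it has these properties with some `ρ > 0` that does
not depend on `h`. -/
structure IsAdmissible (M : Mesh Ω) (h ρ : ℝ) : Prop where
  diam_le : ∀ s ∈ M.cells, Metric.diam (convexHull ℝ (s : Set (Space d))) ≤ h
  ball : ∀ s ∈ M.cells, ContainsBall s (ρ * h)
  nonobtuse : ∀ s ∈ M.cells, IsNonobtuse s
  bdry_diam_le : ∀ s ∈ M.bdryCells, Metric.diam (convexHull ℝ (s : Set (Space d))) ≤ h
  bdry_ball : ∀ s ∈ M.bdryCells, ContainsBall s (ρ * h)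
  bdry_nonobtuse : ∀ s ∈ M.bdryCells, IsNonobtuse s

/-! ### Finite element spaces and nodal interpolation -/

/-- The space `U_h^Ω` of continuous piecewise linear functions on `𝒯_h`. Its elements are
represented by functions on the whole space; only their values on `closure Ω` matter. -/
def feSpace (M : Mesh Ω) : Set (Space d → ℝ) :=
  {u | ContinuousOn u (closure Ω) ∧ ∀ s ∈ M.cells,
    ∃ A : Space d →ᵃ[ℝ] ℝ, EqOn u A (convexHull ℝ (s : Set (Space d)))}

/-- The space `U_h^Γ` of continuous piecewise linear functions on `𝒯_h^Γ`. Its elements are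
represented by functions on the whole space; only their values on `Γ` matter. -/
def bdryFeSpace (M : Mesh Ω) : Set (Space d → ℝ) :=
  {u | ContinuousOn u (frontier Ω) ∧ ∀ s ∈ M.bdryCells,
    ∃ A : Space d →ᵃ[ℝ] ℝ, EqOn u A (convexHull ℝ (s : Set (Space d)))}

open Classical in
/-- The nodal basis function `χ_{h,p}` of the vertex `p`: on every simplex of the complex it is the
barycentric coordinate of `p` (see `hat_eq`); it is set to zero outside `closure Ω`. The basis
function `χ^Γ_{h,p}` of a vertex on `Γ` is its restriction to `Γ`. -/
def hat (M : Mesh Ω) (p x : Space d) : ℝ :=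
  if hx : ∃ w : Space d → ℝ, ∃ s ∈ M.complex.faces, IsBarycentric s x w then hx.choose p else 0

/-- The nodal interpolation operator `I_h`. -/
def interp (M : Mesh Ω) (a : Space d → ℝ) (x : Space d) : ℝ :=
  ∑ p ∈ M.vertices, a p * M.hat p x

/-- The nodal interpolation operator `I_h^Γ`. -/
def bdryInterp (M : Mesh Ω) (a : Space d → ℝ) (x : Space d) : ℝ :=
  ∑ p ∈ M.bdryVertices, a p * M.hat p x

end Mesh

/-! ### Integrals and norms -/

/-- The integral over `Γ = ∂Ω` with respect to the `(d-1)`-dimensional surface measure. -/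
def bdryIntegral {d : ℕ} (Ω : Set (Space d)) (f : Space d → ℝ) : ℝ :=
  ∫ x in frontier Ω, f x ∂(Measure.euclideanHausdorffMeasure (d - 1) : Measure (Space d))

/-- `∫_Ω ∇u · ∇v`; functions in `U_h^Ω` are differentiable off a null set. -/
def dirichlet {d : ℕ} (Ω : Set (Space d)) (u v : Space d → ℝ) : ℝ :=
  ∫ x in Ω, inner ℝ (gradient u x) (gradient v x)

/-- The tangential gradient at `x` of `u` restricted to the plane through `x` that is parallel to
the simplex `s`. -/
def tangentialGradient {d : ℕ} (s : Finset (Space d)) (u : Space d → ℝ) (x : Space d) :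
    vectorSpan ℝ (s : Set (Space d)) :=
  gradient (fun v : vectorSpan ℝ (s : Set (Space d)) => u (x + v)) 0

namespace Mesh

variable {d : ℕ} {Ω : Set (Space d)}

/-- `∫_Γ ∇_Γ u · ∇_Γ v`, computed on the flat simplices that make up `Γ`. -/
def bdryDirichlet (M : Mesh Ω) (u v : Space d → ℝ) : ℝ :=
  ∑ s ∈ M.bdryCells, ∫ x in convexHull ℝ (s : Set (Space d)),
    inner ℝ (tangentialGradient s u x) (tangentialGradient s v x)
      ∂(Measure.euclideanHausdorffMeasure (d - 1) : Measure (Space d))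

/-- The squared norm of `u` in `H¹(Γ)`. -/
def bdryH1NormSq (M : Mesh Ω) (u : Space d → ℝ) : ℝ :=
  bdryIntegral Ω (fun x => u x ^ 2) + M.bdryDirichlet u u

end Mesh

/-- The squared norm of `u` in `H¹(Ω)`. -/
def h1NormSq {d : ℕ} (Ω : Set (Space d)) (u : Space d → ℝ) : ℝ :=
  (∫ x in Ω, u x ^ 2) + dirichlet Ω u u

/-! ### Potentials and coefficients -/

/-- `f` is the sum of a polynomial of degree at most four and a differentiable function whose
derivative is globally Lipschitz continuous. -/
def IsQuarticPlusLipschitz (f : ℝ → ℝ) : Prop :=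
  ∃ (p : Polynomial ℝ) (r : ℝ → ℝ), p.natDegree ≤ 4 ∧ Differentiable ℝ r ∧
    (∃ L : NNReal, LipschitzWith L (deriv r)) ∧ ∀ s, f s = p.eval s + r s

/-- A potential with a convex-concave splitting. -/
structure SplitPotential where
  /-- The potential. -/
  W : ℝ → ℝ
  /-- The convex part. -/
  cvx : ℝ → ℝ
  /-- The concave part. -/
  ccv : ℝ → ℝ
  contDiff : ContDiff ℝ 1 W
  bddBelow : ∃ C > 0, ∀ s, -C < W s
  cvx_contDiff : ContDiff ℝ 1 cvx
  cvx_convex : ConvexOn ℝ univ cvx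
  cvx_nonneg : ∀ s, 0 ≤ cvx s
  ccv_contDiff : ContDiff ℝ 1 ccv
  ccv_concave : ConcaveOn ℝ univ ccv
  split : ∀ s, W s = cvx s + ccv s
  cvx_growth : IsQuarticPlusLipschitz cvx
  ccv_growth : IsQuarticPlusLipschitz ccv

/-- The coefficients of the model. -/
structure Coefficients where
  /-- The mobility in `Ω`. -/
  m : ℝ
  /-- The mobility on `Γ`. -/
  mΓ : ℝ
  /-- The surface tension parameter. -/
  σ : ℝ
  /-- The interface width in `Ω`. -/
  δ : ℝ
  /-- The interface width on `Γ`. -/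
  δΓ : ℝ
  /-- The surface diffusion parameter. -/
  κ : ℝ
  m_pos : 0 < m
  mΓ_pos : 0 < mΓ
  σ_pos : 0 < σ
  δ_pos : 0 < δ
  δΓ_pos : 0 < δΓ
  κ_nonneg : 0 ≤ κ

/-! ### The discrete scheme -/

namespace Mesh

variable {d : ℕ} {Ω : Set (Space d)}

/-- `u` is the `L²(Ω)`-orthogonal projection of `φ₀` onto `U_h^Ω`. -/
def IsL2Projection (M : Mesh Ω) (φ₀ u : Space d → ℝ) : Prop :=
  u ∈ M.feSpace ∧ ∀ θ ∈ M.feSpace, ∫ x in Ω, u x * θ x = ∫ x in Ω, φ₀ x * θ x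

/-- The discrete initial energy. -/
def initialEnergy (M : Mesh Ω) (κ : ℝ) (F G : SplitPotential) (u : Space d → ℝ) : ℝ :=
  dirichlet Ω u u + (∫ x in Ω, M.interp (fun y => F.W (u y)) x) +
    κ * M.bdryDirichlet u u + bdryIntegral Ω (M.bdryInterp fun y => G.W (u y))

/-- `(φ^n)_{n ≤ N}`, `(μ^n)_{1 ≤ n ≤ N}`, `(μ_Γ^n)_{1 ≤ n ≤ N}` solve the finite element scheme with
time increment `τ`. The equations are those of the step from `t_n` to `t_{n+1}`, `n < N`. -/
structure IsDiscreteSolution (M : Mesh Ω) (c : Coefficients) (F G : SplitPotential)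
    (τ : ℝ) (N : ℕ) (φ μ μΓ : ℕ → Space d → ℝ) : Prop where
  φ_mem : ∀ n ≤ N, φ n ∈ M.feSpace
  μ_mem : ∀ n < N, μ (n + 1) ∈ M.feSpace
  μΓ_mem : ∀ n < N, μΓ (n + 1) ∈ M.bdryFeSpace
  bulk : ∀ n < N, ∀ θ ∈ M.feSpace,
    (∫ x in Ω, M.interp (fun y => φ (n + 1) y * θ y) x) + τ * c.m * dirichlet Ω (μ (n + 1)) θ =
      ∫ x in Ω, M.interp (fun y => φ n y * θ y) x
  surface : ∀ n < N, ∀ θ ∈ M.feSpace,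
    bdryIntegral Ω (M.bdryInterp fun y => φ (n + 1) y * θ y) +
        τ * c.mΓ * M.bdryDirichlet (μΓ (n + 1)) θ =
      bdryIntegral Ω (M.bdryInterp fun y => φ n y * θ y)
  potential : ∀ n < N, ∀ θ ∈ M.feSpace,
    (∫ x in Ω, M.interp (fun y => μ (n + 1) y * θ y) x) +
        bdryIntegral Ω (M.bdryInterp fun y => μΓ (n + 1) y * θ y) =
      c.δ * c.σ * dirichlet Ω (φ (n + 1)) θ +
      c.δ⁻¹ * c.σ * (∫ x in Ω, M.interp
        (fun y => (deriv F.cvx (φ (n + 1) y) + deriv F.ccv (φ n y)) * θ y) x) +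
      c.κ * c.δΓ * M.bdryDirichlet (φ (n + 1)) θ +
      c.δΓ⁻¹ * bdryIntegral Ω (M.bdryInterp fun y =>
        (deriv G.cvx (φ (n + 1) y) + deriv G.ccv (φ n y)) * θ y)

end Mesh

/-- The maximum of `a 0, …, a N`. -/
def maxUpTo (N : ℕ) (a : ℕ → ℝ) : ℝ :=
  (Finset.range (N + 1)).sup' Finset.nonempty_range_add_one a

/-! ### Barycentric coordinates determine the nodal basis -/

/-- Barycentric coordinates with respect to an affinely independent set are unique. -/
theorem IsBarycentric.unique {d : ℕ} {s : Finset (Space d)}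
    (hs : AffineIndependent ℝ ((↑) : s → Space d)) {x : Space d} {w w' : Space d → ℝ}
    (hw : IsBarycentric s x w) (hw' : IsBarycentric s x w') : w = w' := by
  obtain ⟨-, h0, h1, hx⟩ := hw
  obtain ⟨-, h0', h1', hx'⟩ := hw'
  have e1 : ∑ i ∈ s.attach, (w i - w' i) = 0 := by
    rw [Finset.sum_attach s (fun v => w v - w' v), Finset.sum_sub_distrib, h1, h1', sub_self]
  have e2 : ∑ i ∈ s.attach, (w i - w' i) • (i : Space d) = 0 := by
    rw [Finset.sum_attach s (fun v => (w v - w' v) • v)]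
    simp only [sub_smul, Finset.sum_sub_distrib, hx, hx', sub_self]
  have key := affineIndependent_iff.1 hs s.attach (fun i => w i - w' i) e1 e2
  funext v
  by_cases hv : v ∈ s
  · exact sub_eq_zero.1 (key ⟨v, hv⟩ (Finset.mem_attach _ _))
  · rw [h0 v hv, h0' v hv]

/-- Every point of a closed simplex has barycentric coordinates. -/
theorem exists_isBarycentric {d : ℕ} {s : Finset (Space d)} {x : Space d}
    (hx : x ∈ convexHull ℝ (s : Set (Space d))) : ∃ w, IsBarycentric s x w := by
  classical
  obtain ⟨w, h0, h1, h2⟩ := Finset.mem_convexHull'.1 hx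
  refine ⟨fun v => if v ∈ s then w v else 0, fun v hv => by simp [hv, h0 v hv],
    fun v hv => by simp [hv], ?_, ?_⟩
  · rw [← h1]; exact Finset.sum_congr rfl fun v hv => by simp [hv]
  · rw [← h2]; exact Finset.sum_congr rfl fun v hv => by simp [hv]

theorem IsBarycentric.mono {d : ℕ} {s t : Finset (Space d)} (hst : s ⊆ t) {x : Space d}
    {w : Space d → ℝ} (hw : IsBarycentric s x w) : IsBarycentric t x w := by
  obtain ⟨h0, h1, h2, h3⟩ := hw
  refine ⟨fun v _ => ?_, fun v hv => h1 v fun h => hv (hst h), ?_, ?_⟩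
  · by_cases hv : v ∈ s
    · exact h0 v hv
    · exact (h1 v hv).ge
  · rw [← h2]
    exact (Finset.sum_subset hst fun v _ hv => h1 v hv).symm
  · rw [← h3]
    exact (Finset.sum_subset hst fun v _ hv => by rw [h1 v hv, zero_smul]).symm

theorem IsBarycentric.mem_convexHull {d : ℕ} {s : Finset (Space d)} {x : Space d}
    {w : Space d → ℝ} (hw : IsBarycentric s x w) : x ∈ convexHull ℝ (s : Set (Space d)) :=
  Finset.mem_convexHull'.2 ⟨w, hw.1, hw.2.2.1, hw.2.2.2⟩

/-- The value of a nodal basis function is the barycentric coordinate, in any simplex of the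
complex that contains the point. -/
theorem Mesh.hat_eq {d : ℕ} {Ω : Set (Space d)} (M : Mesh Ω) {s : Finset (Space d)}
    (hs : s ∈ M.complex.faces) {x : Space d} {w : Space d → ℝ} (hw : IsBarycentric s x w)
    (p : Space d) : M.hat p x = w p := by
  classical
  have hx : ∃ w : Space d → ℝ, ∃ s ∈ M.complex.faces, IsBarycentric s x w := ⟨w, s, hs, hw⟩
  obtain ⟨t, ht, hw'⟩ := hx.choose_spec
  have hmem := M.complex.inter_subset_convexHull hs ht ⟨hw.mem_convexHull, hw'.mem_convexHull⟩
  rw [← Finset.coe_inter] at hmem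
  obtain ⟨v, hv⟩ := exists_isBarycentric hmem
  have a1 := IsBarycentric.unique (M.complex.indep hs) hw (hv.mono Finset.inter_subset_left)
  have a2 := IsBarycentric.unique (M.complex.indep ht) hw' (hv.mono Finset.inter_subset_right)
  rw [Mesh.hat, dif_pos hx, a2, a1]

end

end CahnHilliardFEM

open CahnHilliardFEM

open MeasureTheory Set Topology

namespace CahnHilliardFEM

/-! The free energy decays along the scheme. The chemical potentials are used as test functions in
the two evolution equations and the increment of the phase field in the third equation. The convex
part is implicit and the concave part explicit, so the nonlinear terms dominate the increment of the
potentials node by node. Nodewise inequalities survive lumping, because a lumped integral is a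
quadrature rule with nonnegative weights (`energy_step`). Since the potentials are bounded below,
summation over the steps bounds everything in the claim except the L² norms
(`exists_energy_bounds`).

For the phase field the missing information is the mean, and mass is conserved. A Sobolev-Poincaré
inequality on the convex set `closure Ω` then bounds the L³ norms over `Ω` and over `Γ` by the mean
and the Dirichlet energy (`exists_sobolev_poincare`, `exists_norm_bounds`). It is proved with Riesz
potentials, directly for functions that are Lipschitz on the pieces of a finite cover, so its
constant does not see the mesh. L³ suffices because the derivatives of the potentials grow at most
cubically.

The chemical potentials have no conserved mean. Testing the third equation with the interpolant of a
Lipschitz bump bounds the sum of a bulk moment and a boundary moment (`exists_moment_bound`). The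
interpolant has slopes at most `2 / ρ`; only here does `ρ` enter the constant. A Poincaré inequality
with such a moment in place of the mean (`exists_local_poincare`) gives the L² bounds. A bump
supported in the interior isolates the bulk potential. Once that is controlled, the bulk moments can
be subtracted, which leaves moments of the boundary potential. `Γ` is not convex, but it is a finite
union of flat convex faces, and a small bump at a relative interior point of a face meets no other
part of `Γ`; so the inequality is applied face by face (`exists_bdry_poincare`). The threshold on
`h` only guarantees that the mesh resolves these finitely many bumps. -/

/-! ### Upper gradients of piecewise Lipschitz functions -/

/-- Follow the piece that contains `b` to its last point `e` in `[b, c]`. Up to `e` its Lipschitz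
constant applies. Beyond `e` it does not return, so the other pieces cover `(e, c]`, hence also `[e,
c]` because they are closed; induction on the family finishes. -/
theorem ofReal_abs_sub_le_lintegral {ι : Type*} [DecidableEq ι] (J : ι → Set ℝ) (f : ℝ → ℝ)
    (a : ι → ℝ) (G : ℝ → ENNReal) (S : Finset ι)
    (hJc : ∀ i ∈ S, IsClosed (J i)) (hJo : ∀ i ∈ S, OrdConnected (J i))
    (hf : ∀ i ∈ S, ∀ x ∈ J i, ∀ y ∈ J i, |f x - f y| ≤ a i * |x - y|)
    (hG : ∀ i ∈ S, ∀ x ∈ J i, ENNReal.ofReal (a i) ≤ G x)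
    (b c : ℝ) (hbc : b ≤ c) (hcov : Icc b c ⊆ ⋃ i ∈ S, J i) :
    ENNReal.ofReal |f c - f b| ≤ ∫⁻ t in Ioc b c, G t := by
  induction S using Finset.strongInduction generalizing b with
  | H S ih =>
    obtain ⟨i, hi, hbi⟩ : ∃ i ∈ S, b ∈ J i := by
      simpa using hcov (left_mem_Icc.2 hbc)
    have hcl : IsClosed (J i ∩ Icc b c) := (hJc i hi).inter isClosed_Icc
    have hne : (J i ∩ Icc b c).Nonempty := ⟨b, hbi, left_mem_Icc.2 hbc⟩
    have hbd : BddAbove (J i ∩ Icc b c) := ⟨c, fun x hx => hx.2.2⟩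
    set e := sSup (J i ∩ Icc b c) with he
    have hei : e ∈ J i ∩ Icc b c := hcl.csSup_mem hne hbd
    have hsub : Icc b e ⊆ J i := (hJo i hi).out hbi hei.1
    have h1 : ENNReal.ofReal |f e - f b| ≤ ∫⁻ t in Ioc b e, G t := by
      calc ENNReal.ofReal |f e - f b| ≤ ENNReal.ofReal (a i * |e - b|) :=
            ENNReal.ofReal_le_ofReal (hf i hi _ hei.1 _ hbi)
        _ = ∫⁻ t in Ioc b e, ENNReal.ofReal (a i) := by
            rw [setLIntegral_const, Real.volume_Ioc, abs_of_nonneg (sub_nonneg.2 hei.2.1),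
              ← ENNReal.ofReal_mul' (sub_nonneg.2 hei.2.1)]
        _ ≤ _ := setLIntegral_mono' measurableSet_Ioc
            fun t ht => hG i hi t (hsub (Ioc_subset_Icc_self ht))
    have h2 : ENNReal.ofReal |f c - f e| ≤ ∫⁻ t in Ioc e c, G t := by
      rcases hei.2.2.eq_or_lt with h | h
      · simp [h]
      · refine ih (S.erase i) (Finset.erase_ssubset hi)
          (fun j hj => hJc j (Finset.mem_of_mem_erase hj))
          (fun j hj => hJo j (Finset.mem_of_mem_erase hj))
          (fun j hj => hf j (Finset.mem_of_mem_erase hj))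
          (fun j hj => hG j (Finset.mem_of_mem_erase hj)) e hei.2.2 ?_
        have hcl' : IsClosed (⋃ j ∈ S.erase i, J j) :=
          (S.erase i).finite_toSet.isClosed_biUnion
            fun j hj => hJc j (Finset.mem_of_mem_erase hj)
        rw [← closure_Ioc h.ne]
        refine closure_minimal (fun t ht => ?_) hcl'
        obtain ⟨j, hj, htj⟩ : ∃ j ∈ S, t ∈ J j := by
          simpa using hcov ⟨hei.2.1.trans ht.1.le, ht.2⟩
        have hji : j ≠ i := by
          rintro rfl
          exact absurd (le_csSup hbd ⟨htj, hei.2.1.trans ht.1.le, ht.2⟩) (not_le.2 ht.1)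
        exact mem_biUnion (Finset.mem_coe.2 (Finset.mem_erase.2 ⟨hji, hj⟩)) htj
    calc ENNReal.ofReal |f c - f b| ≤ ENNReal.ofReal (|f c - f e| + |f e - f b|) :=
          ENNReal.ofReal_le_ofReal (abs_sub_le _ _ _)
      _ ≤ ENNReal.ofReal |f c - f e| + ENNReal.ofReal |f e - f b| := ENNReal.ofReal_add_le
      _ ≤ (∫⁻ t in Ioc e c, G t) + ∫⁻ t in Ioc b e, G t := add_le_add h2 h1
      _ = ∫⁻ t in Ioc b c, G t := by
          rw [add_comm, ← lintegral_union measurableSet_Ioc, Ioc_union_Ioc_eq_Ioc hei.2.1 hei.2.2]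
          exact Set.disjoint_left.2 fun t h h' => not_lt.2 h.2 h'.1

section UpperGradient

variable {E : Type*} [NormedAddCommGroup E] [NormedSpace ℝ E]

/-- `g` is an upper gradient of `u` along the segments in `P`. -/
def IsUpperGradientOn (u : E → ℝ) (g : E → ENNReal) (P : Set E) : Prop :=
  ∀ x ∈ P, ∀ y ∈ P, ENNReal.ofReal |u y - u x| ≤
    ENNReal.ofReal ‖y - x‖ * ∫⁻ t in Ioc (0 : ℝ) 1, g (AffineMap.homothety x t y)

theorem homothety_mem_of_convex {P : Set E} (hP : Convex ℝ P) {x y : E} (hx : x ∈ P) (hy : y ∈ P)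
    {t : ℝ} (ht : t ∈ Icc (0 : ℝ) 1) : AffineMap.homothety x t y ∈ P := by
  rw [AffineMap.homothety_eq_lineMap]
  exact hP.lineMap_mem hx hy ht

/-- A segment meets each closed convex piece in a closed interval, so the one-dimensional estimate
applies to the restriction of `u`, with Lipschitz constants scaled by the length of the segment. -/
theorem isUpperGradientOn_of_pieces [MeasurableSpace E] [BorelSpace E] {ι : Type*}
    {u : E → ℝ} {g : E → ENNReal} {P : Set E}
    (hP : Convex ℝ P) (S : Finset ι) (K : ι → Set E) (a : ι → ℝ)
    (hcov : P ⊆ ⋃ i ∈ S, K i) (hcl : ∀ i ∈ S, IsClosed (K i)) (hcv : ∀ i ∈ S, Convex ℝ (K i))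
    (hu : ∀ i ∈ S, ∀ x ∈ K i, ∀ y ∈ K i, |u x - u y| ≤ a i * ‖x - y‖)
    (hg : ∀ i ∈ S, ∀ x ∈ K i, ENNReal.ofReal (a i) ≤ g x) (hgm : Measurable g) :
    IsUpperGradientOn u g P := by
  classical
  intro x hx y hy
  have hc : Continuous fun t : ℝ => AffineMap.homothety x t y := by
    simp only [AffineMap.homothety_eq_lineMap]
    exact AffineMap.lineMap_continuous
  have hsub : ∀ s t : ℝ, ‖AffineMap.homothety x s y - AffineMap.homothety x t y‖
      = ‖y - x‖ * |s - t| := by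
    intro s t
    rw [AffineMap.homothety_apply, AffineMap.homothety_apply]
    simp only [vsub_eq_sub, vadd_eq_add]
    rw [add_sub_add_right_eq_sub, ← sub_smul, norm_smul, Real.norm_eq_abs, mul_comm]
  have h := ofReal_abs_sub_le_lintegral (fun i => (fun t : ℝ => AffineMap.homothety x t y) ⁻¹' K i)
    (fun t => u (AffineMap.homothety x t y)) (fun i => a i * ‖y - x‖)
    (fun t => ENNReal.ofReal ‖y - x‖ * g (AffineMap.homothety x t y)) S
    (fun i hi => (hcl i hi).preimage hc)
    (fun i hi => by
      have : Convex ℝ ((fun t : ℝ => AffineMap.homothety x t y) ⁻¹' K i) := by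
        simp only [AffineMap.homothety_eq_lineMap]
        exact (hcv i hi).affine_preimage _
      exact this.ordConnected)
    (fun i hi s hs t ht => by
      have := hu i hi _ hs _ ht
      rw [hsub] at this
      rw [mul_assoc]; exact this)
    (fun i hi t ht => by
      rw [mul_comm (a i), ENNReal.ofReal_mul (norm_nonneg _)]
      gcongr
      exact hg i hi _ ht) 0 1 zero_le_one
    (fun t ht => by
      have := hcov (homothety_mem_of_convex hP hx hy ht)
      simpa using this)
  simp only [AffineMap.homothety_one, AffineMap.homothety_zero] at h
  rw [← lintegral_const_mul (ENNReal.ofReal ‖y - x‖)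
    (show Measurable fun t : ℝ => g (AffineMap.homothety x t y) from hgm.comp hc.measurable)]
  simpa using h

end UpperGradient

/-! ### Riesz potential estimate on convex sets -/

section Potential

variable {E : Type*} [NormedAddCommGroup E] [NormedSpace ℝ E] [MeasurableSpace E] [BorelSpace E]

/-- A homothety of ratio `t` scales `k`-dimensional measure by `t ^ k`. Its centre lies in the
convex set `P`, so it maps `P` into `P` and the integrand may be cut off outside `P`. -/
theorem lintegral_homothety_le {k : ℕ} {P : Set E} (hPm : MeasurableSet P) (hP : Convex ℝ P)
    {x : E} (hx : x ∈ P) {t : ℝ} (ht : t ∈ Ioc (0 : ℝ) 1) {F : E → ENNReal} (hF : Measurable F) :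
    ∫⁻ y in P, F (AffineMap.homothety x t y) ∂μHE[k] ≤
      ENNReal.ofReal (t⁻¹ ^ k) * ∫⁻ z in P, F z ∂μHE[k] := by
  have hm : Measurable (AffineMap.homothety x t : E →ᵃ[ℝ] E) := by
    have : Continuous (AffineMap.homothety x t : E →ᵃ[ℝ] E) := AffineMap.homothety_continuous x t
    exact this.measurable
  have hmap : (μHE[k] : Measure E).map (AffineMap.homothety x t) =
      ENNReal.ofReal (t⁻¹ ^ k) • μHE[k] := by
    ext s hs
    rw [Measure.map_apply hm hs, euclideanHausdorffMeasure_homothety_preimage k x ht.1.ne',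
      Measure.smul_apply, ENNReal.smul_def, smul_eq_mul, smul_eq_mul, ENNReal.ofReal]
    congr 2
    ext
    simp [abs_of_pos ht.1, ht.1.le]
  calc ∫⁻ y in P, F (AffineMap.homothety x t y) ∂μHE[k]
      ≤ ∫⁻ y in P, (P.indicator F) (AffineMap.homothety x t y) ∂μHE[k] := by
        refine setLIntegral_mono' hPm fun y hy => ?_
        rw [indicator_of_mem (homothety_mem_of_convex hP hx hy ⟨ht.1.le, ht.2⟩)]
    _ ≤ ∫⁻ y, (P.indicator F) (AffineMap.homothety x t y) ∂μHE[k] := setLIntegral_le_lintegral _ _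
    _ = ∫⁻ z, P.indicator F z ∂((μHE[k] : Measure E).map (AffineMap.homothety x t)) :=
        (lintegral_map (hF.indicator hPm) hm).symm
    _ = _ := by rw [hmap, lintegral_smul_measure, lintegral_indicator hPm, smul_eq_mul]

/-- The weight left after the substitution `z = x + t (y - x)`: a point at distance `r` from `x` is
reached only for `t ≥ r / D`, since `y` is at distance at most `D`. Integration in `t` produces the
Riesz kernel. -/
theorem lintegral_rpow_tail_le {k : ℕ} (hk : 0 < k) {r D : ℝ} (hr : 0 < r) (hD : 0 < D) :
    ∫⁻ t in Ioc (0 : ℝ) 1, ENNReal.ofReal (t⁻¹ ^ (k + 1)) *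
        (Ici (r / D)).indicator 1 t ≤ ENNReal.ofReal (D ^ k / k * r ^ (-(k : ℝ))) := by
  have hrD : 0 < r / D := div_pos hr hD
  have hk' : (0 : ℝ) < k := by exact_mod_cast hk
  have hlt : (-(k + 1 : ℝ)) < -1 := by linarith
  calc ∫⁻ t in Ioc (0 : ℝ) 1, ENNReal.ofReal (t⁻¹ ^ (k + 1)) * (Ici (r / D)).indicator 1 t
      ≤ ∫⁻ t, ENNReal.ofReal (t⁻¹ ^ (k + 1)) * (Ici (r / D)).indicator 1 t :=
        setLIntegral_le_lintegral _ _
    _ = ∫⁻ t, (Ici (r / D)).indicator (fun t => ENNReal.ofReal (t⁻¹ ^ (k + 1))) t := by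
        congr 1; ext t; by_cases h : t ∈ Ici (r / D) <;> simp [h]
    _ = ∫⁻ t in Ioi (r / D), ENNReal.ofReal (t⁻¹ ^ (k + 1)) := by
        rw [lintegral_indicator measurableSet_Ici, setLIntegral_congr Ioi_ae_eq_Ici.symm]
    _ = ∫⁻ t in Ioi (r / D), ENNReal.ofReal (t ^ (-(k + 1 : ℝ))) := by
        refine setLIntegral_congr_fun measurableSet_Ioi fun t ht => ?_
        have : 0 < t := hrD.trans ht
        rw [Real.rpow_neg this.le, inv_pow]
        norm_cast
    _ = ENNReal.ofReal (∫ t in Ioi (r / D), t ^ (-(k + 1 : ℝ))) := by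
        rw [ofReal_integral_eq_lintegral_ofReal (integrableOn_Ioi_rpow_of_lt hlt hrD)]
        refine (ae_restrict_iff' measurableSet_Ioi).2 (.of_forall fun t ht => ?_)
        exact Real.rpow_nonneg (hrD.trans ht).le _
    _ ≤ _ := by
        rw [integral_Ioi_rpow_of_lt hlt hrD]
        apply ENNReal.ofReal_le_ofReal
        apply le_of_eq
        have : (-(k + 1 : ℝ)) + 1 = -k := by ring
        rw [this, Real.div_rpow hr.le hD.le, Real.rpow_neg hD.le, Real.rpow_natCast]
        field_simp

/-- The potential estimate on a convex set. -/
theorem lintegral_abs_sub_le [SecondCountableTopology E] {k : ℕ} (hk : 0 < k) {P : Set E} (hPm : MeasurableSet P)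
    (hP : Convex ℝ P) (hfin : (μHE[k] : Measure E) P ≠ ⊤) {D : ℝ} (hD : 0 < D)
    (hdiam : ∀ x ∈ P, ∀ y ∈ P, ‖y - x‖ ≤ D) {u : E → ℝ} {g : E → ENNReal} (hg : Measurable g)
    (hu : IsUpperGradientOn u g P) {x : E} (hx : x ∈ P) :
    ∫⁻ y in P, ENNReal.ofReal |u y - u x| ∂μHE[k] ≤
      ENNReal.ofReal (D ^ k / k) *
        ∫⁻ z in P, ENNReal.ofReal (‖z - x‖ ^ (-((k : ℝ) - 1))) * g z ∂μHE[k] := by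
  have : IsFiniteMeasure ((μHE[k] : Measure E).restrict P) :=
    ⟨by rw [Measure.restrict_apply_univ]; exact hfin.lt_top⟩
  have hhm : Measurable fun p : E × ℝ => AffineMap.homothety x p.2 p.1 := by
    have : Continuous fun p : E × ℝ => AffineMap.homothety x p.2 p.1 := by
      simp only [AffineMap.homothety_apply, vsub_eq_sub, vadd_eq_add]
      fun_prop
    exact this.measurable
  have hmeas1 : Measurable fun p : E × ℝ =>
      ENNReal.ofReal ‖p.1 - x‖ * g (AffineMap.homothety x p.2 p.1) :=
    (by fun_prop : Measurable fun p : E × ℝ => ENNReal.ofReal ‖p.1 - x‖).mul (hg.comp hhm)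
  have hset : MeasurableSet {p : ℝ × E | ‖p.2 - x‖ / D ≤ p.1} :=
    measurableSet_le (by fun_prop) (by fun_prop)
  have hmeas2 : Measurable fun p : ℝ × E =>
      ENNReal.ofReal (p.1⁻¹ ^ (k + 1)) * (Ici (‖p.2 - x‖ / D)).indicator 1 p.1 *
        (ENNReal.ofReal ‖p.2 - x‖ * g p.2) := by
    have h1 : Measurable fun p : ℝ × E =>
        (Ici (‖p.2 - x‖ / D)).indicator (1 : ℝ → ENNReal) p.1 := by
      exact (measurable_const : Measurable fun _ : ℝ × E => (1 : ENNReal)).indicator hset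
    fun_prop
  calc ∫⁻ y in P, ENNReal.ofReal |u y - u x| ∂μHE[k]
      ≤ ∫⁻ y in P, (∫⁻ t in Ioc (0 : ℝ) 1,
          ENNReal.ofReal ‖y - x‖ * g (AffineMap.homothety x t y)) ∂μHE[k] := by
        refine setLIntegral_mono' hPm fun y hy => ?_
        rw [lintegral_const_mul _ (show Measurable fun t : ℝ => g (AffineMap.homothety x t y) from
          hg.comp (hhm.comp measurable_prodMk_left))]
        exact hu x hx y hy
    _ = ∫⁻ t in Ioc (0 : ℝ) 1, (∫⁻ y in P,
          ENNReal.ofReal ‖y - x‖ * g (AffineMap.homothety x t y) ∂μHE[k]) :=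
        lintegral_lintegral_swap hmeas1.aemeasurable
    -- Substitution `z = x + t (y - x)`: the Jacobian contributes `t⁻¹ ^ k`, and `‖y - x‖ = t⁻¹ ‖z -
    -- x‖` contributes one more power. The indicator records `‖z - x‖ ≤ t * D`.
    _ ≤ ∫⁻ t in Ioc (0 : ℝ) 1, (∫⁻ z in P, ENNReal.ofReal (t⁻¹ ^ (k + 1)) *
          (Ici (‖z - x‖ / D)).indicator 1 t * (ENNReal.ofReal ‖z - x‖ * g z) ∂μHE[k]) := by
        refine setLIntegral_mono' measurableSet_Ioc fun t ht => ?_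
        have ht0 := ht.1
        have hFm : Measurable fun z : E => ENNReal.ofReal t⁻¹ *
          ((Ici (‖z - x‖ / D)).indicator 1 t * (ENNReal.ofReal ‖z - x‖ * g z)) := by
          have h1 : Measurable fun z : E => (Ici (‖z - x‖ / D)).indicator (1 : ℝ → ENNReal) t := by
            exact ((measurable_const : Measurable fun _ : ℝ × E => (1 : ENNReal)).indicator
              hset).comp
              (measurable_prodMk_left (x := t))
          fun_prop
        calc ∫⁻ y in P, ENNReal.ofReal ‖y - x‖ * g (AffineMap.homothety x t y) ∂μHE[k]
            ≤ ∫⁻ y in P, (fun z => ENNReal.ofReal t⁻¹ * ((Ici (‖z - x‖ / D)).indicator 1 t *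
                (ENNReal.ofReal ‖z - x‖ * g z))) (AffineMap.homothety x t y) ∂μHE[k] := by
              refine setLIntegral_mono' hPm fun y hy => ?_
              have hn : ‖AffineMap.homothety x t y - x‖ = t * ‖y - x‖ := by
                rw [AffineMap.homothety_apply]
                simp [norm_smul, abs_of_pos ht0]
              have hmem : t ∈ Ici (‖AffineMap.homothety x t y - x‖ / D) := by
                rw [hn, mem_Ici, div_le_iff₀ hD]
                exact mul_le_mul_of_nonneg_left (hdiam x hx y hy) ht0.le
              beta_reduce
              rw [indicator_of_mem hmem, Pi.one_apply, one_mul, ← mul_assoc,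
                ← ENNReal.ofReal_mul (inv_nonneg.2 ht0.le), hn, inv_mul_cancel_left₀ ht0.ne']
          _ ≤ _ := lintegral_homothety_le hPm hP hx ht hFm
          _ = _ := by
              rw [← lintegral_const_mul _ hFm]
              congr 1; ext z
              rw [← mul_assoc, ← mul_assoc, ← ENNReal.ofReal_mul (by positivity), ← pow_succ]
    _ = ∫⁻ z in P, (∫⁻ t in Ioc (0 : ℝ) 1, ENNReal.ofReal (t⁻¹ ^ (k + 1)) *
          (Ici (‖z - x‖ / D)).indicator 1 t * (ENNReal.ofReal ‖z - x‖ * g z)) ∂μHE[k] :=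
        lintegral_lintegral_swap hmeas2.aemeasurable
    _ ≤ ∫⁻ z in P, ENNReal.ofReal (D ^ k / k) *
          (ENNReal.ofReal (‖z - x‖ ^ (-((k : ℝ) - 1))) * g z) ∂μHE[k] := by
        refine setLIntegral_mono' hPm fun z _ => ?_
        rw [lintegral_mul_const _ (by
          have h1 : Measurable ((Ici (‖z - x‖ / D)).indicator (1 : ℝ → ENNReal)) :=
            measurable_const.indicator measurableSet_Ici
          fun_prop)]
        rcases (norm_nonneg (z - x)).eq_or_lt with h0 | h0
        · simp [← h0]
        · calc _ ≤ ENNReal.ofReal (D ^ k / k * ‖z - x‖ ^ (-(k : ℝ))) *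
                (ENNReal.ofReal ‖z - x‖ * g z) := by
                gcongr; exact lintegral_rpow_tail_le hk h0 hD
            _ = _ := by
                rw [← mul_assoc, ← mul_assoc, ← ENNReal.ofReal_mul (by positivity),
                  ← ENNReal.ofReal_mul (by positivity)]
                congr 2
                rw [neg_sub, show (1 : ℝ) - k = 1 + -k by ring, Real.rpow_add h0, Real.rpow_one]
                ring
    _ = _ := by
        rw [lintegral_const_mul]
        fun_prop

end Potential

/-! ### Sobolev-Poincaré inequality -/

section SobolevPoincare

variable {E : Type*} [NormedAddCommGroup E] [MeasurableSpace E] [BorelSpace E]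

/-- Hölder's inequality with three factors, as used for potentials. -/
theorem lintegral_mul_pow_three_le {α : Type*} [MeasurableSpace α] {μ : Measure α}
    {g K : α → ENNReal} (hg : AEMeasurable g μ) (hK : AEMeasurable K μ) :
    (∫⁻ z, K z * g z ∂μ) ^ (3 : ℝ) ≤ (∫⁻ z, g z ^ (2 : ℝ) * K z ^ (7 / 8 : ℝ) ∂μ) *
      (∫⁻ z, g z ^ (2 : ℝ) ∂μ) ^ (1 / 2 : ℝ) * (∫⁻ z, K z ^ (17 / 12 : ℝ) ∂μ) ^ (3 / 2 : ℝ) := by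
  -- The factorization is `K g = (g² K^(7/8))^(1/3) (g²)^(1/6) (K^(17/12))^(1/2)`; the exponents of
  -- `K` add up as `7/24 + 17/24`. For a kernel of order `k - 1`, the factor `7/8 < 1` leaves room
  -- to integrate against a measure of dimension `k - 1` when `k ≥ 2`, while `(k - 1) * 17/12 < k`
  -- holds for `k ≤ 3`.
  have h := ENNReal.lintegral_prod_norm_pow_le (μ := μ) (Finset.univ : Finset (Fin 3))
    (f := ![fun z => g z ^ (2 : ℝ) * K z ^ (7 / 8 : ℝ), fun z => g z ^ (2 : ℝ),
      fun z => K z ^ (17 / 12 : ℝ)]) (p := ![1 / 3, 1 / 6, 1 / 2])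
    (by
      intro i _
      fin_cases i
      · exact (hg.pow_const _).mul (hK.pow_const _)
      · exact hg.pow_const _
      · exact hK.pow_const _)
    (by simp [Fin.sum_univ_three]; norm_num)
    (by intro i _; fin_cases i <;> norm_num)
  have e : ∀ z, K z * g z = ∏ i : Fin 3, (![fun z => g z ^ (2 : ℝ) * K z ^ (7 / 8 : ℝ),
      fun z => g z ^ (2 : ℝ), fun z => K z ^ (17 / 12 : ℝ)] i z) ^
        ((![1 / 3, 1 / 6, 1 / 2] : Fin 3 → ℝ) i) := by
    intro z
    simp only [Fin.prod_univ_three, Matrix.cons_val_zero, Matrix.cons_val_one, Matrix.cons_val]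
    rw [ENNReal.mul_rpow_of_nonneg _ _ (by norm_num), ← ENNReal.rpow_mul, ← ENNReal.rpow_mul,
      ← ENNReal.rpow_mul, ← ENNReal.rpow_mul,
      show ∀ a b c d : ENNReal, a * b * c * d = (a * c) * (b * d) by intros; ring,
      ← ENNReal.rpow_add_of_nonneg _ _ (by norm_num) (by norm_num),
      ← ENNReal.rpow_add_of_nonneg _ _ (by norm_num) (by norm_num)]
    norm_num
    ring
  simp_rw [← e] at h
  refine (ENNReal.rpow_le_rpow h (by norm_num : (0 : ℝ) ≤ 3)).trans (le_of_eq ?_)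
  simp only [Fin.prod_univ_three, Matrix.cons_val_zero, Matrix.cons_val_one, Matrix.cons_val]
  rw [ENNReal.mul_rpow_of_nonneg _ _ (by norm_num), ENNReal.mul_rpow_of_nonneg _ _ (by norm_num),
    ← ENNReal.rpow_mul, ← ENNReal.rpow_mul, ← ENNReal.rpow_mul]
  norm_num

/-- Riesz kernels of small order are uniformly integrable against measures of polynomial growth. -/
theorem exists_lintegral_rpow_norm_le {ν : Measure E} [IsFiniteMeasure ν] {m s : ℝ} (hs : 0 ≤ s)
    (hsm : s < m) {C : ENNReal} (hC : C ≠ ⊤)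
    (hν : ∀ y : E, ∀ r : ℝ, 0 < r → ν (Metric.closedBall y r) ≤ C * ENNReal.ofReal (r ^ m)) :
    ∃ A : ENNReal, A ≠ ⊤ ∧ ∀ z, ∫⁻ x, ENNReal.ofReal (‖z - x‖ ^ (-s)) ∂ν ≤ A := by
  rcases hs.eq_or_lt with rfl | hs0
  · exact ⟨ν univ, measure_ne_top _ _, fun z => by simp⟩
  have hlt : -(m / s) < -1 := by
    rw [neg_lt_neg_iff, lt_div_iff₀ hs0]; linarith
  refine ⟨ν univ + C * ∫⁻ t in Ioi (1 : ℝ), ENNReal.ofReal (t ^ (-(m / s))), ?_, fun z => ?_⟩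
  · refine ENNReal.add_ne_top.2 ⟨measure_ne_top _ _, ENNReal.mul_ne_top hC ?_⟩
    exact (integrableOn_Ioi_rpow_of_lt hlt one_pos).lintegral_lt_top.ne
  -- Layer cake formula, split at height 1. Below, the total mass is used. Above, the superlevel set
  -- at height `t` lies in a ball of radius `t ^ (-1/s)`, of mass at most `C t ^ (-m/s)`, which is
  -- integrable because `s < m`.
  · rw [lintegral_eq_lintegral_meas_lt ν (.of_forall fun x => Real.rpow_nonneg (norm_nonneg _) _)
      (by fun_prop), ← Ioc_union_Ioi_eq_Ioi zero_le_one]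
    refine (lintegral_union_le _ _ _).trans (add_le_add ?_ ?_)
    · calc _ ≤ ∫⁻ t in Ioc (0 : ℝ) 1, ν univ := lintegral_mono fun t => measure_mono (subset_univ _)
        _ = _ := by simp
    · rw [← lintegral_const_mul' _ _ hC]
      refine setLIntegral_mono' measurableSet_Ioi fun t ht => ?_
      have ht0 : 0 < t := one_pos.trans ht
      refine (measure_mono fun x hx => ?_).trans
        ((hν z (t ^ (-s⁻¹)) (Real.rpow_pos_of_pos ht0 _)).trans (le_of_eq ?_))
      · rw [mem_ofPred_eq] at hx
        rw [Metric.mem_closedBall, dist_comm, dist_eq_norm]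
        rcases (norm_nonneg (z - x)).eq_or_lt with h0 | h0
        · rw [← h0]; exact Real.rpow_nonneg ht0.le _
        · have := Real.rpow_le_rpow_of_nonpos ht0 hx.le (z := -s⁻¹)
            (neg_nonpos.2 (inv_nonneg.2 hs))
          rwa [← Real.rpow_mul h0.le, neg_mul_neg, mul_inv_cancel₀ hs0.ne', Real.rpow_one] at this
      · rw [← Real.rpow_mul ht0.le]
        congr 3
        field_simp

variable [NormedSpace ℝ E] [SecondCountableTopology E]

/-- The Sobolev-Poincaré inequality on a compact convex set, with respect to a measure for which the
Riesz kernel is integrable. -/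
theorem lintegral_rpow_three_le {k : ℕ} (hk : 0 < k) {P : Set E} (hPm : MeasurableSet P)
    (hP : Convex ℝ P) (hfin : (μHE[k] : Measure E) P ≠ ⊤) {D : ℝ} (hD : 0 < D)
    (hdiam : ∀ x ∈ P, ∀ y ∈ P, ‖y - x‖ ≤ D) {ν : Measure E} [IsFiniteMeasure ν] (hν : ν Pᶜ = 0)
    {A B : ENNReal}
    (hA : ∀ z, ∫⁻ x, ENNReal.ofReal (‖z - x‖ ^ (-(((k : ℝ) - 1) * (7 / 8)))) ∂ν ≤ A)
    (hB : ∀ z, ∫⁻ x in P, ENNReal.ofReal (‖z - x‖ ^ (-(((k : ℝ) - 1) * (17 / 12)))) ∂μHE[k] ≤ B)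
    {u : E → ℝ} {g : E → ENNReal} (hg : Measurable g) (hu : IsUpperGradientOn u g P) :
    ∫⁻ x, (∫⁻ y in P, ENNReal.ofReal |u y - u x| ∂μHE[k]) ^ (3 : ℝ) ∂ν ≤
      ENNReal.ofReal (D ^ k / k) ^ (3 : ℝ) * A * B ^ (3 / 2 : ℝ) *
        (∫⁻ z in P, g z ^ (2 : ℝ) ∂μHE[k]) ^ (3 / 2 : ℝ) := by
  have : IsFiniteMeasure ((μHE[k] : Measure E).restrict P) :=
    ⟨by rw [Measure.restrict_apply_univ]; exact hfin.lt_top⟩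
  have hk1 : (0 : ℝ) ≤ (k : ℝ) - 1 := by
    have : (1 : ℝ) ≤ k := by exact_mod_cast hk
    linarith
  have hpow : ∀ (x z : E) (p : ℝ), 0 ≤ p → ENNReal.ofReal (‖z - x‖ ^ (-((k : ℝ) - 1))) ^ p =
      ENNReal.ofReal (‖z - x‖ ^ (-(((k : ℝ) - 1) * p))) := by
    intro x z p hp
    rw [ENNReal.ofReal_rpow_of_nonneg (by positivity) hp, ← Real.rpow_mul (norm_nonneg _), neg_mul]
  have hνP : ∀ᵐ x ∂ν, x ∈ P := by rwa [ae_iff]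
  set I := ∫⁻ z in P, g z ^ (2 : ℝ) ∂μHE[k] with hI
  set c := ENNReal.ofReal (D ^ k / k) with hc
  calc ∫⁻ x, (∫⁻ y in P, ENNReal.ofReal |u y - u x| ∂μHE[k]) ^ (3 : ℝ) ∂ν
      ≤ ∫⁻ x, (c ^ (3 : ℝ) * I ^ (1 / 2 : ℝ) * B ^ (3 / 2 : ℝ)) *
          (∫⁻ z in P, g z ^ (2 : ℝ) *
            ENNReal.ofReal (‖z - x‖ ^ (-(((k : ℝ) - 1) * (7 / 8)))) ∂μHE[k]) ∂ν := by
        refine lintegral_mono_ae (hνP.mono fun x hx => ?_)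
        have h1 := ENNReal.rpow_le_rpow
          (lintegral_abs_sub_le hk hPm hP hfin hD hdiam hg hu hx) (by norm_num : (0 : ℝ) ≤ 3)
        refine h1.trans ?_
        rw [ENNReal.mul_rpow_of_nonneg _ _ (by norm_num)]
        have h2 := lintegral_mul_pow_three_le (μ := (μHE[k] : Measure E).restrict P)
          (g := g) (K := fun z => ENNReal.ofReal (‖z - x‖ ^ (-((k : ℝ) - 1))))
          hg.aemeasurable (by fun_prop)
        simp only [hpow x _ (7 / 8) (by norm_num), hpow x _ (17 / 12) (by norm_num)] at h2
        have h3 := hB x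
        simp only [norm_sub_rev x] at h3
        calc _ ≤ c ^ (3 : ℝ) * _ := mul_le_mul_right h2 _
          _ ≤ c ^ (3 : ℝ) * ((∫⁻ z in P, g z ^ (2 : ℝ) *
            ENNReal.ofReal (‖z - x‖ ^ (-(((k : ℝ) - 1) * (7 / 8)))) ∂μHE[k]) *
              I ^ (1 / 2 : ℝ) * B ^ (3 / 2 : ℝ)) := by gcongr
          _ = _ := by ring
    _ = (c ^ (3 : ℝ) * I ^ (1 / 2 : ℝ) * B ^ (3 / 2 : ℝ)) * ∫⁻ x, (∫⁻ z in P, g z ^ (2 : ℝ) *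
            ENNReal.ofReal (‖z - x‖ ^ (-(((k : ℝ) - 1) * (7 / 8)))) ∂μHE[k]) ∂ν := by
        rw [lintegral_const_mul]
        exact Measurable.lintegral_prod_right' (f := fun p : E × E => g p.2 ^ (2 : ℝ) *
          ENNReal.ofReal (‖p.2 - p.1‖ ^ (-(((k : ℝ) - 1) * (7 / 8))))) (by fun_prop)
    -- Only the first Hölder factor depends on `x`. With the order of integration exchanged, the
    -- kernel is integrated against `ν` first, where `A` bounds it uniformly in `z`.
    _ = (c ^ (3 : ℝ) * I ^ (1 / 2 : ℝ) * B ^ (3 / 2 : ℝ)) * ∫⁻ z in P, (∫⁻ x, g z ^ (2 : ℝ) *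
            ENNReal.ofReal (‖z - x‖ ^ (-(((k : ℝ) - 1) * (7 / 8)))) ∂ν) ∂μHE[k] := by
        congr 1
        refine lintegral_lintegral_swap (Measurable.aemeasurable ?_)
        fun_prop
    _ ≤ (c ^ (3 : ℝ) * I ^ (1 / 2 : ℝ) * B ^ (3 / 2 : ℝ)) *
          ∫⁻ z in P, g z ^ (2 : ℝ) * A ∂μHE[k] := by
        gcongr with z
        rw [lintegral_const_mul _ (by fun_prop)]
        gcongr
        exact hA z
    _ = c ^ (3 : ℝ) * A * B ^ (3 / 2 : ℝ) * (I ^ (1 / 2 : ℝ) * I) := by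
        rw [lintegral_mul_const _ (by fun_prop)]; ring
    _ = _ := by
        congr 1
        conv_lhs => rw [← ENNReal.rpow_one I, ← ENNReal.rpow_mul]
        rw [← ENNReal.rpow_add_of_nonneg _ _ (by norm_num) (by norm_num)]
        norm_num

/-- The Sobolev-Poincaré inequality for functions that are Lipschitz continuous on the pieces of a
finite partition. The constant does not depend on the partition. -/
theorem exists_sobolev_poincare {k : ℕ} (hk : 0 < k) (hk3 : k ≤ 3) {P : Set E} (hPc : IsCompact P)
    (hP : Convex ℝ P) (hfin : (μHE[k] : Measure E) P ≠ ⊤) (hpos : (μHE[k] : Measure E) P ≠ 0)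
    {C : ENNReal} (hC : C ≠ ⊤) (hgrowth : ∀ y : E, ∀ r : ℝ, 0 < r →
      (μHE[k] : Measure E).restrict P (Metric.closedBall y r) ≤ C * ENNReal.ofReal (r ^ (k : ℝ)))
    {ν : Measure E} [IsFiniteMeasure ν] (hν : ν Pᶜ = 0) {m : ℝ} (hm : ((k : ℝ) - 1) * (7 / 8) < m)
    {C' : ENNReal} (hC' : C' ≠ ⊤) (hgrowth' : ∀ y : E, ∀ r : ℝ, 0 < r →
      ν (Metric.closedBall y r) ≤ C' * ENNReal.ofReal (r ^ m)) :
    ∃ c : ℝ, 0 ≤ c ∧ ∀ (u : E → ℝ), ContinuousOn u P → ∀ {ι : Type} (S : Finset ι) (K : ι → Set E)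
      (a : ι → ℝ), (∀ i ∈ S, 0 ≤ a i) → P ⊆ ⋃ i ∈ S, K i → (∀ i ∈ S, IsClosed (K i)) →
      (∀ i ∈ S, Convex ℝ (K i)) → (∀ i ∈ S, K i ⊆ P) →
      (∀ i ∈ S, ∀ x ∈ K i, ∀ y ∈ K i, |u x - u y| ≤ a i * ‖x - y‖) →
      ∫ x, |u x - ⨍ y in P, u y ∂μHE[k]| ^ 3 ∂ν ≤
        c * (∑ i ∈ S, (μHE[k] : Measure E).real (K i) * a i ^ 2) ^ (3 / 2 : ℝ) := by
  have hPm : MeasurableSet P := hPc.measurableSet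
  have : IsFiniteMeasure ((μHE[k] : Measure E).restrict P) :=
    ⟨by rw [Measure.restrict_apply_univ]; exact hfin.lt_top⟩
  have hk0 : (1 : ℝ) ≤ k := by exact_mod_cast hk
  have hk3' : (k : ℝ) ≤ 3 := by exact_mod_cast hk3
  obtain ⟨A, hAt, hA⟩ := exists_lintegral_rpow_norm_le (ν := ν)
    (s := ((k : ℝ) - 1) * (7 / 8)) (by nlinarith) hm hC' hgrowth'
  obtain ⟨B, hBt, hB⟩ := exists_lintegral_rpow_norm_le (ν := (μHE[k] : Measure E).restrict P)
    (m := k) (s := ((k : ℝ) - 1) * (17 / 12)) (by nlinarith) (by linarith) hC hgrowth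
  set D := Metric.diam P + 1 with hDdef
  have hD : 0 < D := by have := Metric.diam_nonneg (s := P); linarith
  have hdiam : ∀ x ∈ P, ∀ y ∈ P, ‖y - x‖ ≤ D := fun x hx y hy => by
    rw [← dist_eq_norm]
    have := Metric.dist_le_diam_of_mem hPc.isBounded hy hx
    linarith
  set M := (μHE[k] : Measure E).real P with hMdef
  have hM : 0 < M := ENNReal.toReal_pos hpos hfin
  set Q := ENNReal.ofReal (D ^ k / k) ^ (3 : ℝ) * A * B ^ (3 / 2 : ℝ) with hQdef
  have hQ : Q ≠ ⊤ := ENNReal.mul_ne_top (ENNReal.mul_ne_top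
    (ENNReal.rpow_ne_top_of_nonneg (by norm_num) ENNReal.ofReal_ne_top) hAt)
    (ENNReal.rpow_ne_top_of_nonneg (by norm_num) hBt)
  refine ⟨Q.toReal / M ^ 3, by positivity, ?_⟩
  intro u huc ι S K a ha hcov hcl hcv hKP hlip
  -- The pieces may overlap. The root of the sum of squares dominates each `a i` on its piece, and
  -- the integral of its square is exactly the weighted sum on the right-hand side.
  set g : E → ENNReal := fun z =>
    (∑ i ∈ S, (K i).indicator (fun _ => ENNReal.ofReal (a i) ^ (2 : ℝ)) z) ^ (1 / 2 : ℝ) with hgdef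
  have hind : ∀ i ∈ S, Measurable ((K i).indicator fun _ => ENNReal.ofReal (a i) ^ (2 : ℝ)) :=
    fun i hi => measurable_const.indicator (hcl i hi).measurableSet
  have hgm : Measurable g := by
    refine Measurable.pow_const ?_ _
    exact Finset.measurable_fun_sum S hind
  have hug : IsUpperGradientOn u g P := by
    refine isUpperGradientOn_of_pieces hP S K a hcov hcl hcv hlip (fun i hi x hx => ?_) hgm
    calc ENNReal.ofReal (a i) = (ENNReal.ofReal (a i) ^ (2 : ℝ)) ^ (1 / 2 : ℝ) := by
          rw [← ENNReal.rpow_mul]; norm_num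
      _ ≤ g x := by
          refine ENNReal.rpow_le_rpow ?_ (by norm_num)
          have := Finset.single_le_sum (f := fun i => (K i).indicator
            (fun _ => ENNReal.ofReal (a i) ^ (2 : ℝ)) x) (fun _ _ => zero_le) hi
          simpa [hx] using this
  have hmain := lintegral_rpow_three_le hk hPm hP hfin hD hdiam hν hA hB hgm hug
  have hg2 : ∫⁻ z in P, g z ^ (2 : ℝ) ∂μHE[k] =
      ENNReal.ofReal (∑ i ∈ S, (μHE[k] : Measure E).real (K i) * a i ^ 2) := by
    have e : ∀ z, g z ^ (2 : ℝ) =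
        ∑ i ∈ S, (K i).indicator (fun _ => ENNReal.ofReal (a i) ^ (2 : ℝ)) z := by
      intro z
      rw [hgdef, ← ENNReal.rpow_mul]; norm_num
    simp_rw [e]
    rw [lintegral_finsetSum S hind, ENNReal.ofReal_sum_of_nonneg
      (fun i _ => by positivity)]
    refine Finset.sum_congr rfl fun i hi => ?_
    rw [lintegral_indicator (hcl i hi).measurableSet, setLIntegral_const,
      Measure.restrict_apply (hcl i hi).measurableSet, inter_eq_left.2 (hKP i hi),
      ENNReal.ofReal_mul measureReal_nonneg, ofReal_measureReal
        (measure_ne_top_of_subset (hKP i hi) hfin), mul_comm,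
      ENNReal.ofReal_rpow_of_nonneg (ha i hi) (by norm_num)]
    norm_num
  set W := ∑ i ∈ S, (μHE[k] : Measure E).real (K i) * a i ^ 2 with hW
  have hW0 : 0 ≤ W := Finset.sum_nonneg fun i _ => by positivity
  rw [hg2, ENNReal.ofReal_rpow_of_nonneg hW0 (by norm_num)] at hmain
  have huint : IntegrableOn u P μHE[k] := by
    refine ⟨huc.aestronglyMeasurable hPm, ?_⟩
    obtain ⟨b, hb⟩ := hPc.exists_bound_of_continuousOn huc
    exact HasFiniteIntegral.restrict_of_bounded b hfin.lt_top
      ((ae_restrict_iff' hPm).2 (.of_forall hb))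
  have hνP : ∀ᵐ x ∂ν, x ∈ P := by rwa [ae_iff]
  have hum : AEStronglyMeasurable u ν := by
    rw [← Measure.restrict_eq_self_of_ae_mem hνP]
    exact huc.aestronglyMeasurable hPm
  set av := ⨍ y in P, u y ∂μHE[k] with hav
  have hpt : ∀ x, ENNReal.ofReal (|u x - av| ^ 3) ≤ ENNReal.ofReal ((M ^ 3)⁻¹) *
      (∫⁻ y in P, ENNReal.ofReal |u y - u x| ∂μHE[k]) ^ (3 : ℝ) := by
    intro x
    have hi : IntegrableOn (fun y => u y - u x) P μHE[k] := huint.sub (integrable_const _)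
    have h1 : M * (u x - av) = -∫ y in P, (u y - u x) ∂μHE[k] := by
      rw [integral_sub huint (integrable_const _), hav, setAverage_eq]
      simp only [smul_eq_mul, integral_const, measureReal_restrict_apply_univ, ← hMdef]
      field_simp
      ring
    have h2 : M * |u x - av| ≤ ∫ y in P, |u y - u x| ∂μHE[k] := by
      rw [← abs_of_pos hM, ← abs_mul, h1, abs_neg]
      exact abs_integral_le_integral_abs
    rw [← ofReal_integral_eq_lintegral_ofReal hi.abs (.of_forall fun _ => abs_nonneg _),
      ENNReal.ofReal_rpow_of_nonneg (integral_nonneg fun _ => abs_nonneg _) (by norm_num),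
      ← ENNReal.ofReal_mul (by positivity)]
    apply ENNReal.ofReal_le_ofReal
    rw [inv_mul_eq_div, le_div_iff₀ (by positivity)]
    norm_cast
    calc _ = (M * |u x - av|) ^ 3 := by ring
      _ ≤ _ := by gcongr
  have hm3 : AEStronglyMeasurable (fun x => |u x - av| ^ 3) ν :=
    (hum.sub aestronglyMeasurable_const).norm.pow 3
  rw [integral_eq_lintegral_of_nonneg_ae (.of_forall fun x => by positivity) hm3]
  have hfinal : ∫⁻ x, ENNReal.ofReal (|u x - av| ^ 3) ∂ν ≤
      ENNReal.ofReal ((M ^ 3)⁻¹) * (Q * ENNReal.ofReal (W ^ (3 / 2 : ℝ))) :=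
    calc _ ≤ ∫⁻ x, ENNReal.ofReal ((M ^ 3)⁻¹) *
          (∫⁻ y in P, ENNReal.ofReal |u y - u x| ∂μHE[k]) ^ (3 : ℝ) ∂ν := lintegral_mono hpt
      _ = _ := lintegral_const_mul' _ _ ENNReal.ofReal_ne_top
      _ ≤ _ := by gcongr
  refine (ENNReal.toReal_mono (ENNReal.mul_ne_top ENNReal.ofReal_ne_top
    (ENNReal.mul_ne_top hQ ENNReal.ofReal_ne_top)) hfinal).trans (le_of_eq ?_)
  have hM3 : 0 ≤ (M ^ 3)⁻¹ := by positivity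
  rw [ENNReal.toReal_mul, ENNReal.toReal_mul, ENNReal.toReal_ofReal hM3,
    ENNReal.toReal_ofReal (Real.rpow_nonneg hW0 _), div_eq_inv_mul Q.toReal, mul_assoc]

end SobolevPoincare

/-! ### Flat pieces and their Hausdorff measure -/

variable {d : ℕ}

/-- The affine subspace `p + W` as a set. -/
def flat (W : Submodule ℝ (Space d)) (p : Space d) : Set (Space d) := {x | x - p ∈ W}

theorem mem_flat {W : Submodule ℝ (Space d)} {p x : Space d} : x ∈ flat W p ↔ x - p ∈ W := Iff.rfl

/-- The chart is an isometry, so it turns `μHE[k]` on a `k`-dimensional flat into Lebesgue measure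
on `ℝ^k`. Growth, null sets and positivity on flats are all read off in this chart. -/
theorem exists_chart (W : Submodule ℝ (Space d)) (p : Space d) :
    ∃ ι : EuclideanSpace ℝ (Fin (Module.finrank ℝ W)) →ᵃⁱ[ℝ] Space d, range ι = flat W p := by
  let L := (W.subtypeₗᵢ.comp (stdOrthonormalBasis ℝ W).repr.symm.toLinearIsometry)
  refine ⟨(AffineIsometryEquiv.constVAdd ℝ (Space d) p).toAffineIsometry.comp
    L.toAffineIsometry, ?_⟩
  ext x
  simp only [mem_range, AffineIsometry.coe_comp, Function.comp_apply, mem_flat]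
  constructor
  · rintro ⟨y, rfl⟩
    simp [L]
  · intro h
    refine ⟨(stdOrthonormalBasis ℝ W).repr ⟨x - p, h⟩, ?_⟩
    simp [L]

/-- The surface measure of a flat piece has Euclidean volume growth. -/
theorem exists_flat_growth (k : ℕ) : ∃ C : ENNReal, C ≠ ⊤ ∧ ∀ (W : Submodule ℝ (Space d))
    (p : Space d), Module.finrank ℝ W = k → ∀ (y : Space d) (r : ℝ), 0 < r →
      (μHE[k] : Measure (Space d)) (flat W p ∩ Metric.closedBall y r) ≤
        C * ENNReal.ofReal (r ^ (k : ℝ)) := by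
  refine ⟨ENNReal.ofReal (2 ^ k) * volume (Metric.ball (0 : EuclideanSpace ℝ (Fin k)) 1),
    ENNReal.mul_ne_top ENNReal.ofReal_ne_top measure_ball_lt_top.ne, ?_⟩
  rintro W p rfl y r hr
  obtain ⟨ι, hι⟩ := exists_chart W p
  rw [← hι, inter_comm, ← ι.isometry.euclideanHausdorffMeasure_preimage,
    EuclideanSpace.euclideanHausdorffMeasure_eq_volume]
  rcases (ι ⁻¹' Metric.closedBall y r).eq_empty_or_nonempty with h | ⟨z, hz⟩
  · simp [h]
  -- The centre `y` need not lie on the flat. The ball is therefore enlarged to radius `2 r` around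
  -- a point of the flat, which explains the factor `2 ^ k`.
  have hsub : ι ⁻¹' Metric.closedBall y r ⊆ Metric.closedBall z (2 * r) := by
    intro x hx
    rw [Metric.mem_closedBall, ← ι.isometry.dist_eq]
    have h1 : dist (ι x) y ≤ r := hx
    have h2 : dist (ι z) y ≤ r := hz
    linarith [dist_triangle_right (ι x) (ι z) y]
  refine (measure_mono hsub).trans ?_
  rw [Measure.addHaar_closedBall _ _ (by positivity), finrank_euclideanSpace_fin, mul_pow,
    ENNReal.ofReal_mul (by positivity), Real.rpow_natCast]
  exact le_of_eq (by ring)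

theorem measure_flat_eq_zero {k : ℕ} {W : Submodule ℝ (Space d)} (p : Space d)
    (h : Module.finrank ℝ W < k) : (μHE[k] : Measure (Space d)) (flat W p) = 0 := by
  obtain ⟨ι, hι⟩ := exists_chart W p
  rw [← hι, ← image_univ, ι.isometry.euclideanHausdorffMeasure_image,
    Measure.euclideanHausdorffMeasure_def, Measure.smul_apply]
  have : (μH[(k : ℝ)] : Measure (EuclideanSpace ℝ (Fin (Module.finrank ℝ W)))) univ = 0 := by
    have := hausdorffMeasure_of_dimH_lt
      (s := (univ : Set (EuclideanSpace ℝ (Fin (Module.finrank ℝ W))))) (d := (k : NNReal)) (by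
        rw [Real.dimH_univ_eq_finrank, finrank_euclideanSpace_fin]
        exact_mod_cast h)
    simpa using this
  rw [this]; simp

/-- The points of `K` that are interior to `K` relative to translates of `W`. -/
def relInt (W : Submodule ℝ (Space d)) (K : Set (Space d)) : Set (Space d) :=
  {x | x ∈ K ∧ ∃ ε > 0, ∀ w ∈ W, ‖w‖ < ε → x + w ∈ K}

/-- In the chart the exceptional points lie on the frontier of a convex set, which is a Lebesgue
null set. -/
theorem measure_diff_relInt {k : ℕ} {W : Submodule ℝ (Space d)} {p : Space d}
    (hW : Module.finrank ℝ W = k) {K : Set (Space d)} (hK : Convex ℝ K) (hKp : K ⊆ flat W p) :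
    (μHE[k] : Measure (Space d)) (K \ relInt W K) = 0 := by
  subst hW
  obtain ⟨ι, hι⟩ := exists_chart W p
  have hcv : Convex ℝ (ι ⁻¹' K) := hK.affine_preimage ι.toAffineMap
  refine measure_mono_null (t := ι '' frontier (ι ⁻¹' K)) ?_ ?_
  · rintro x ⟨hxK, hx⟩
    obtain ⟨y, rfl⟩ : x ∈ range ι := hι ▸ hKp hxK
    refine ⟨y, ⟨subset_closure hxK, fun hy => hx ⟨hxK, ?_⟩⟩, rfl⟩
    obtain ⟨ε, hε, hb⟩ := Metric.mem_nhds_iff.1 (mem_interior_iff_mem_nhds.1 hy)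
    refine ⟨ε, hε, fun w hw hwε => ?_⟩
    obtain ⟨z, hz⟩ : ι y + w ∈ range ι := by
      rw [hι, mem_flat, add_sub_right_comm]
      exact W.add_mem (hKp hxK) hw
    have : z ∈ Metric.ball y ε := by
      rw [Metric.mem_ball, ← ι.isometry.dist_eq, hz, dist_eq_norm]
      simpa using hwε
    rw [← hz]
    exact hb this
  · rw [ι.isometry.euclideanHausdorffMeasure_image,
      EuclideanSpace.euclideanHausdorffMeasure_eq_volume]
    exact hcv.addHaar_frontier _

theorem measure_pos_of_relInt {k : ℕ} {W : Submodule ℝ (Space d)}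
    (hW : Module.finrank ℝ W = k) {K : Set (Space d)} {x : Space d} (hx : x ∈ relInt W K)
    {ε : ℝ} (hε : 0 < ε) :
    0 < (μHE[k] : Measure (Space d)) (K ∩ Metric.ball x ε) := by
  subst hW
  obtain ⟨hxK, δ, hδ, hb⟩ := hx
  obtain ⟨ι, hι⟩ := exists_chart W x
  obtain ⟨y, hy⟩ : x ∈ range ι := by rw [hι, mem_flat]; simp
  have hsub : ι '' Metric.ball y (min δ ε) ⊆ K ∩ Metric.ball x ε := by
    rintro _ ⟨z, hz, rfl⟩
    rw [Metric.mem_ball, ← ι.isometry.dist_eq, hy] at hz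
    have hzr : ι z ∈ flat W x := hι ▸ mem_range_self z
    refine ⟨?_, hz.trans_le (min_le_right _ _)⟩
    have := hb (ι z - x) hzr (by rw [← dist_eq_norm]; exact hz.trans_le (min_le_left _ _))
    simpa using this
  refine lt_of_lt_of_le ?_ (measure_mono hsub)
  rw [ι.isometry.euclideanHausdorffMeasure_image,
    EuclideanSpace.euclideanHausdorffMeasure_eq_volume]
  exact Metric.measure_ball_pos _ _ (lt_min hδ hε)

/-! ### Simplices and affine functions on them -/

section Simplex

theorem convexHull_subset_flat {s : Finset (Space d)} {p : Space d} (hp : p ∈ s) :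
    convexHull ℝ (s : Set (Space d)) ⊆ flat (vectorSpan ℝ (s : Set (Space d))) p := by
  intro x hx
  have h1 := convexHull_subset_affineSpan (s : Set (Space d)) hx
  have h2 := subset_affineSpan ℝ (s : Set (Space d)) (Finset.mem_coe.2 hp)
  have := AffineSubspace.vsub_mem_direction h1 h2
  rwa [direction_affineSpan] at this

/-- At most `k` points span a flat of dimension less than `k`. Affine independence is not needed, so
this applies to any set of vertices of a face. -/
theorem measure_convexHull_eq_zero {k : ℕ} {s : Finset (Space d)} (hs : s.card ≤ k) :
    (μHE[k] : Measure (Space d)) (convexHull ℝ (s : Set (Space d))) = 0 := by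
  rcases s.eq_empty_or_nonempty with rfl | ⟨p, hp⟩
  · simp
  have hc : 0 < s.card := Finset.card_pos.2 ⟨p, hp⟩
  refine measure_mono_null (convexHull_subset_flat hp) (measure_flat_eq_zero p ?_)
  have := finrank_vectorSpan_range_le ℝ (fun x : s => (x : Space d)) (n := s.card - 1)
    (by rw [Fintype.card_coe]; omega)
  rw [Subtype.range_coe_subtype] at this
  have h2 : {x | x ∈ s} = (s : Set (Space d)) := rfl
  rw [h2] at this
  omega

theorem finrank_vectorSpan_eq {k : ℕ} {s : Finset (Space d)}
    (hs : AffineIndependent ℝ ((↑) : s → Space d)) (hc : s.card = k + 1) :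
    Module.finrank ℝ (vectorSpan ℝ (s : Set (Space d))) = k := by
  have := hs.finrank_vectorSpan (n := k) (by rw [Fintype.card_coe]; exact hc)
  rwa [Subtype.range_coe_subtype] at this

theorem isCompact_convexHull_finset (s : Finset (Space d)) :
    IsCompact (convexHull ℝ (s : Set (Space d))) :=
  s.finite_toSet.isCompact_convexHull ℝ

theorem measure_convexHull_ne_top {k : ℕ} {s : Finset (Space d)}
    (hs : AffineIndependent ℝ ((↑) : s → Space d)) (hc : s.card = k + 1) :
    (μHE[k] : Measure (Space d)) (convexHull ℝ (s : Set (Space d))) ≠ ⊤ := by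
  obtain ⟨C, hC, h⟩ := exists_flat_growth (d := d) k
  obtain ⟨p, hp⟩ : s.Nonempty := Finset.card_pos.1 (by omega)
  obtain ⟨R, hR, hb⟩ := (isCompact_convexHull_finset s).isBounded.subset_closedBall_lt 0 p
  refine ne_top_of_le_ne_top (ENNReal.mul_ne_top hC ENNReal.ofReal_ne_top)
    ((measure_mono ?_).trans (h (vectorSpan ℝ (s : Set (Space d))) p (finrank_vectorSpan_eq hs hc)
      p R hR))
  exact subset_inter (convexHull_subset_flat hp) hb

/-- Affine functions with prescribed values at the vertices of a simplex. -/
theorem exists_affineMap_eq {s : Finset (Space d)}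
    (hs : AffineIndependent ℝ ((↑) : s → Space d)) (a : Space d → ℝ) :
    ∃ A : Space d →ᵃ[ℝ] ℝ, ∀ v ∈ s, A v = a v := by
  classical
  have hs' : AffineIndependent ℝ (fun p : (s : Set (Space d)) => (p : Space d)) := hs
  -- The vertices are completed to an affine basis of the whole space; its coordinate functions
  -- interpolate the prescribed values.
  obtain ⟨t, hst, hti, htop⟩ := exists_subset_affineIndependent_affineSpan_eq_top hs'
  have : Finite t := finite_of_fin_dim_affineIndependent ℝ hti
  have := Fintype.ofFinite t
  let b : AffineBasis t ℝ (Space d) := ⟨fun p => p, hti, by simpa using htop⟩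
  refine ⟨∑ v : t, a v • b.coord v, fun v hv => ?_⟩
  have hvt : v ∈ t := hst hv
  have hcoord : ∀ w : t, b.coord w v = if w = ⟨v, hvt⟩ then 1 else 0 := fun w =>
    b.coord_apply w ⟨v, hvt⟩
  have key : ∀ F : Finset t, (∑ w ∈ F, a w • b.coord w : Space d →ᵃ[ℝ] ℝ) v =
      ∑ w ∈ F, a w * b.coord w v := by
    intro F
    induction F using Finset.induction_on with
    | empty => simp
    | insert i F hi ih => simp [Finset.sum_insert hi, ih]
  rw [key]
  simp [hcoord]

theorem IsBarycentric.map_affine {s : Finset (Space d)} {x : Space d} {w : Space d → ℝ}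
    (hw : IsBarycentric s x w) (A : Space d →ᵃ[ℝ] ℝ) : A x = ∑ v ∈ s, w v * A v := by
  obtain ⟨-, -, h1, hx⟩ := hw
  have : ∑ v ∈ s, w v • v = s.affineCombination ℝ id w := by
    rw [s.affineCombination_eq_linear_combination _ _ h1]; rfl
  rw [← hx, this, Finset.map_affineCombination _ _ _ h1,
    s.affineCombination_eq_linear_combination _ _ h1]
  simp

end Simplex

/-! ### Constant gradients of affine functions on a simplex -/

section Slope

/-- `u` is affine on the closed simplex with vertex set `s`. -/
def IsAffOn (s : Finset (Space d)) (u : Space d → ℝ) : Prop :=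
  ∃ A : Space d →ᵃ[ℝ] ℝ, EqOn u A (convexHull ℝ (s : Set (Space d)))

open Classical in
/-- The constant tangential gradient of a function that is affine on a simplex. -/
noncomputable def slope (s : Finset (Space d)) (u : Space d → ℝ) :
    vectorSpan ℝ (s : Set (Space d)) :=
  if h : IsAffOn s u then
    (InnerProductSpace.toDual ℝ _).symm (LinearMap.toContinuousLinearMap
      (h.choose.linear.domRestrict (vectorSpan ℝ (s : Set (Space d)))))
  else 0

variable {s : Finset (Space d)} {u v : Space d → ℝ}

/-- This makes `slope` independent of the chosen affine extension: differences of vertices span the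
tangent space of the simplex. -/
theorem linear_eq_of_eqOn {A B : Space d →ᵃ[ℝ] ℝ}
    (h : EqOn A B (convexHull ℝ (s : Set (Space d)))) {w : Space d}
    (hw : w ∈ vectorSpan ℝ (s : Set (Space d))) : A.linear w = B.linear w := by
  have : EqOn A.linear B.linear ((s : Set (Space d)) -ᵥ (s : Set (Space d))) := by
    rintro _ ⟨p, hp, q, hq, rfl⟩
    simp only [AffineMap.linearMap_vsub]
    rw [h (subset_convexHull ℝ _ hp), h (subset_convexHull ℝ _ hq)]
  exact LinearMap.eqOn_span this hw

theorem inner_slope {A : Space d →ᵃ[ℝ] ℝ} (h : EqOn u A (convexHull ℝ (s : Set (Space d))))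
    (w : vectorSpan ℝ (s : Set (Space d))) : inner ℝ (slope s u) w = A.linear w := by
  have hu : IsAffOn s u := ⟨A, h⟩
  rw [slope, dif_pos hu, InnerProductSpace.toDual_symm_apply]
  exact linear_eq_of_eqOn (fun x hx => (hu.choose_spec hx).symm.trans (h hx)) w.2

theorem IsAffOn.sub (hu : IsAffOn s u) (hv : IsAffOn s v) : IsAffOn s fun x => u x - v x := by
  obtain ⟨A, hA⟩ := hu
  obtain ⟨B, hB⟩ := hv
  exact ⟨A - B, fun x hx => by simp [hA hx, hB hx]⟩

theorem isAffOn_const (c : ℝ) : IsAffOn s fun _ => c :=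
  ⟨AffineMap.const ℝ _ c, fun x _ => by simp⟩

theorem slope_sub (hu : IsAffOn s u) (hv : IsAffOn s v) :
    slope s (fun x => u x - v x) = slope s u - slope s v := by
  obtain ⟨A, hA⟩ := hu
  obtain ⟨B, hB⟩ := hv
  refine ext_inner_right ℝ fun w => ?_
  rw [inner_sub_left, inner_slope hA, inner_slope hB,
    inner_slope (A := A - B) (fun x hx => by simp [hA hx, hB hx])]
  simp

theorem slope_const (c : ℝ) : slope s (fun _ => c) = 0 := by
  refine ext_inner_right ℝ fun w => ?_
  rw [inner_slope (A := AffineMap.const ℝ _ c) (fun x _ => by simp)]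
  simp

theorem slope_congr (hu : IsAffOn s u) (h : EqOn v u (convexHull ℝ (s : Set (Space d)))) :
    slope s v = slope s u := by
  obtain ⟨A, hA⟩ := hu
  refine ext_inner_right ℝ fun w => ?_
  rw [inner_slope hA, inner_slope fun x hx => (h hx).trans (hA hx)]

theorem sub_eq_inner_slope (hu : IsAffOn s u) {x y : Space d}
    (hx : x ∈ convexHull ℝ (s : Set (Space d))) (hy : y ∈ convexHull ℝ (s : Set (Space d)))
    (hxy : x - y ∈ vectorSpan ℝ (s : Set (Space d))) :
    u x - u y = inner ℝ (slope s u) ⟨x - y, hxy⟩ := by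
  obtain ⟨A, hA⟩ := hu
  rw [inner_slope hA, hA hx, hA hy]
  exact (A.linearMap_vsub x y).symm

theorem sub_mem_vectorSpan {x y : Space d} (hx : x ∈ affineSpan ℝ (s : Set (Space d)))
    (hy : y ∈ affineSpan ℝ (s : Set (Space d))) : x - y ∈ vectorSpan ℝ (s : Set (Space d)) := by
  have := AffineSubspace.vsub_mem_direction hx hy
  rwa [direction_affineSpan] at this

theorem abs_sub_le_slope (hu : IsAffOn s u) {x y : Space d}
    (hx : x ∈ convexHull ℝ (s : Set (Space d))) (hy : y ∈ convexHull ℝ (s : Set (Space d))) :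
    |u x - u y| ≤ ‖slope s u‖ * ‖x - y‖ := by
  have hxy := sub_mem_vectorSpan (convexHull_subset_affineSpan _ hx)
    (convexHull_subset_affineSpan _ hy)
  rw [sub_eq_inner_slope hu hx hy hxy]
  exact abs_real_inner_le_norm _ _

theorem IsAffOn.apply_eq (hu : IsAffOn s u) {x : Space d} {w : Space d → ℝ}
    (hw : IsBarycentric s x w) : u x = ∑ v ∈ s, w v * u v := by
  obtain ⟨A, hA⟩ := hu
  rw [hA hw.mem_convexHull, hw.map_affine A]
  exact Finset.sum_congr rfl fun v hv => by rw [hA (subset_convexHull ℝ _ hv)]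

/-- The oscillation of an affine function over the simplex is attained at the vertices, as two
barycentric representations show. Moving from the centre of the inscribed ball by `r / 2` in the
direction of the slope changes the function by `r / 2` times the norm of the slope; staying inside
the open ball costs the factor 2. -/
theorem norm_slope_le (hu : IsAffOn s u) {r M : ℝ} (hr : 0 < r) (hball : ContainsBall s r)
    (hM : ∀ v ∈ s, ∀ w ∈ s, |u v - u w| ≤ M) : ‖slope s u‖ ≤ 2 * M / r := by
  obtain ⟨c, hc, hb⟩ := hball
  have hcK : c ∈ convexHull ℝ (s : Set (Space d)) := hb ⟨Metric.mem_ball_self hr, hc⟩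
  have hosc : ∀ x ∈ convexHull ℝ (s : Set (Space d)), ∀ y ∈ convexHull ℝ (s : Set (Space d)),
      u x - u y ≤ M := by
    intro x hx y hy
    obtain ⟨w, hw⟩ := exists_isBarycentric hx
    obtain ⟨w', hw'⟩ := exists_isBarycentric hy
    have e : u x - u y = ∑ v ∈ s, ∑ v' ∈ s, w v * w' v' * (u v - u v') := by
      have h1 : ∀ v, ∑ v' ∈ s, w v * w' v' * (u v - u v') = w v * u v - w v * u y := by
        intro v
        rw [hu.apply_eq hw']
        simp only [mul_sub, Finset.sum_sub_distrib, Finset.mul_sum]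
        congr 1
        · rw [← Finset.sum_mul, ← Finset.mul_sum, hw'.2.2.1, mul_one]
        · exact Finset.sum_congr rfl fun _ _ => by ring
      simp only [h1, Finset.sum_sub_distrib, ← Finset.sum_mul, hw.2.2.1, one_mul]
      rw [hu.apply_eq hw]
    rw [e]
    calc _ ≤ ∑ v ∈ s, ∑ v' ∈ s, w v * w' v' * M :=
          Finset.sum_le_sum fun v hv => Finset.sum_le_sum fun v' hv' =>
            mul_le_mul_of_nonneg_left ((le_abs_self _).trans (hM v hv v' hv'))
              (mul_nonneg (hw.1 v hv) (hw'.1 v' hv'))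
      _ = M := by
          simp only [← Finset.sum_mul, ← Finset.mul_sum, hw'.2.2.1, mul_one, hw.2.2.1, one_mul]
  rcases (norm_nonneg (slope s u)).eq_or_lt with h0 | h0
  · rw [← h0]
    have := hosc c hcK c hcK
    rw [sub_self] at this
    positivity
  · set t := r / 2 / ‖slope s u‖ with ht
    have ht0 : 0 < t := by positivity
    set x : Space d := c + t • (slope s u : Space d) with hx
    have hxc : x - c = ((t • slope s u : vectorSpan ℝ (s : Set (Space d))) : Space d) := by
      simp [hx]
    have hxspan : x ∈ affineSpan ℝ (s : Set (Space d)) := by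
      have h1 : t • (slope s u : Space d) ∈ (affineSpan ℝ (s : Set (Space d))).direction := by
        rw [direction_affineSpan]
        exact Submodule.smul_mem _ _ (slope s u).2
      have := AffineSubspace.vadd_mem_of_mem_direction h1 hc
      rwa [vadd_eq_add, add_comm] at this
    have hxb : x ∈ Metric.ball c r := by
      rw [Metric.mem_ball, dist_eq_norm, hx, add_sub_cancel_left, norm_smul, Real.norm_eq_abs,
        abs_of_pos ht0]
      change t * ‖slope s u‖ < r
      rw [ht, div_mul_cancel₀ _ h0.ne']
      linarith
    have hxK := hb ⟨hxb, hxspan⟩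
    have h2 := hosc x hxK c hcK
    rw [sub_eq_inner_slope hu hxK hcK (sub_mem_vectorSpan hxspan hc)] at h2
    have h3 : (⟨x - c, sub_mem_vectorSpan hxspan hc⟩ : vectorSpan ℝ (s : Set (Space d))) =
        t • slope s u := Subtype.ext hxc
    have h4 : inner ℝ (slope s u) (t • slope s u) = t * ‖slope s u‖ ^ 2 :=
      (real_inner_smul_right (slope s u) (slope s u) t).trans (by rw [real_inner_self_eq_norm_sq])
    rw [h3, h4, ht, div_mul_eq_mul_div, sq,
      ← mul_assoc, mul_div_assoc, div_self h0.ne', mul_one] at h2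
    rw [le_div_iff₀ hr]
    linarith

theorem tangentialGradient_eq (hu : IsAffOn s u) {x : Space d}
    (hx : x ∈ relInt (vectorSpan ℝ (s : Set (Space d))) (convexHull ℝ (s : Set (Space d)))) :
    tangentialGradient s u x = slope s u := by
  obtain ⟨hxK, ε, hε, hb⟩ := hx
  obtain ⟨A, hA⟩ := hu
  refine HasGradientAt.gradient ?_
  rw [hasGradientAt_iff_hasFDerivAt]
  have h1 := ((InnerProductSpace.toDual ℝ _ (slope s u)).hasFDerivAt
    (x := (0 : vectorSpan ℝ (s : Set (Space d))))).const_add (A x)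
  refine h1.congr_of_eventuallyEq ?_
  filter_upwards [Metric.ball_mem_nhds 0 hε] with w hw
  rw [InnerProductSpace.toDual_apply_apply, inner_slope hA, hA (hb w w.2 (by simpa using hw))]
  have := A.map_vadd x (w : Space d)
  rw [vadd_eq_add, vadd_eq_add] at this
  rw [add_comm x, this, add_comm]

theorem gradient_eq (hu : IsAffOn s u) (htop : vectorSpan ℝ (s : Set (Space d)) = ⊤) {x : Space d}
    (hx : x ∈ relInt (vectorSpan ℝ (s : Set (Space d))) (convexHull ℝ (s : Set (Space d)))) :
    gradient u x = slope s u := by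
  obtain ⟨hxK, ε, hε, hb⟩ := hx
  obtain ⟨A, hA⟩ := hu
  refine HasGradientAt.gradient ?_
  rw [hasGradientAt_iff_hasFDerivAt]
  have h1 := ((InnerProductSpace.toDual ℝ _ (slope s u : Space d)).hasFDerivAt
    (x := x)).const_add (A 0)
  refine h1.congr_of_eventuallyEq ?_
  filter_upwards [Metric.ball_mem_nhds x hε] with y hy
  have hyx : ∀ z : Space d, z ∈ vectorSpan ℝ (s : Set (Space d)) :=
    fun z => htop ▸ Submodule.mem_top
  have hyK : y ∈ convexHull ℝ (s : Set (Space d)) := by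
    have := hb (y - x) (hyx _) (by rw [← dist_eq_norm]; exact hy)
    simpa using this
  rw [InnerProductSpace.toDual_apply_apply, hA hyK]
  have h2 := inner_slope hA ⟨y, hyx y⟩
  rw [Submodule.coe_inner] at h2
  rw [h2]
  have := A.map_vadd 0 y
  simp only [vadd_eq_add, add_zero] at this
  rw [this, add_comm]

end Slope

variable {Ω : Set (Space d)}

/-! ### Nodal basis and interpolation -/

section Hat

variable (M : Mesh Ω) {s : Finset (Space d)}

theorem Mesh.hat_nonneg (p x : Space d) : 0 ≤ M.hat p x := by
  classical
  rw [Mesh.hat]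
  split_ifs with hx
  · obtain ⟨s, -, hs⟩ := hx.choose_spec
    by_cases hp : p ∈ s
    · exact hs.1 p hp
    · exact (hs.2.1 p hp).ge
  · exact le_rfl

theorem Mesh.isAffOn_hat (hs : s ∈ M.complex.faces) (p : Space d) : IsAffOn s (M.hat p) := by
  classical
  obtain ⟨A, hA⟩ := exists_affineMap_eq (M.complex.indep hs) (fun v => if v = p then 1 else 0)
  refine ⟨A, fun x hx => ?_⟩
  obtain ⟨w, hw⟩ := exists_isBarycentric hx
  rw [M.hat_eq hs hw, hw.map_affine A]
  rw [Finset.sum_congr rfl fun v hv => by rw [hA v hv]]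
  simp only [mul_ite, mul_one, mul_zero, Finset.sum_ite_eq']
  split_ifs with h
  · rfl
  · exact hw.2.1 p h

open Classical in
theorem isBarycentric_vertex {v : Space d} (hv : v ∈ s) :
    IsBarycentric s v (fun p => if p = v then 1 else 0) := by
  refine ⟨fun p _ => by dsimp only; split_ifs <;> norm_num, fun p hp => if_neg ?_, ?_, ?_⟩
  · rintro rfl; exact hp hv
  · simp [hv]
  · simp [hv]

/-- The nodal interpolant with respect to a finite set of vertices. -/
noncomputable def Mesh.nodal (V : Finset (Space d)) (a : Space d → ℝ) (x : Space d) : ℝ :=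
  ∑ p ∈ V, a p * M.hat p x

theorem Mesh.isAffOn_nodal (hs : s ∈ M.complex.faces) (V : Finset (Space d)) (a : Space d → ℝ) :
    IsAffOn s (M.nodal V a) := by
  classical
  induction V using Finset.induction_on with
  | empty => exact ⟨0, fun x _ => by simp [Mesh.nodal]⟩
  | insert p V hp ih =>
    obtain ⟨A, hA⟩ := ih
    obtain ⟨B, hB⟩ := M.isAffOn_hat hs p
    refine ⟨a p • B + A, fun x hx => ?_⟩
    simp only [Mesh.nodal, Finset.sum_insert hp, AffineMap.coe_add, AffineMap.coe_smul,
      Pi.add_apply, Pi.smul_apply, smul_eq_mul]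
    rw [← hB hx, ← hA hx]
    rfl

theorem Mesh.nodal_eq_sum (hs : s ∈ M.complex.faces) {V : Finset (Space d)} (hV : s ⊆ V)
    (a : Space d → ℝ) {x : Space d} {w : Space d → ℝ} (hw : IsBarycentric s x w) :
    M.nodal V a x = ∑ v ∈ s, w v * a v := by
  rw [Mesh.nodal, ← Finset.sum_subset hV]
  · exact Finset.sum_congr rfl fun v _ => by rw [M.hat_eq hs hw, mul_comm]
  · intro v _ hv
    rw [M.hat_eq hs hw, hw.2.1 v hv, mul_zero]

theorem Mesh.nodal_vertex (hs : s ∈ M.complex.faces) {V : Finset (Space d)}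
    (a : Space d → ℝ) {v : Space d} (hv : v ∈ s) (hvV : v ∈ V) : M.nodal V a v = a v := by
  classical
  rw [Mesh.nodal]
  simp only [M.hat_eq hs (isBarycentric_vertex hv)]
  simp [hvV]

theorem Mesh.nodal_eq_self (hs : s ∈ M.complex.faces) {V : Finset (Space d)} (hV : s ⊆ V)
    {u : Space d → ℝ} (hu : IsAffOn s u) {x : Space d}
    (hx : x ∈ convexHull ℝ (s : Set (Space d))) : M.nodal V u x = u x := by
  obtain ⟨w, hw⟩ := exists_isBarycentric hx
  rw [M.nodal_eq_sum hs hV u hw, hu.apply_eq hw]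

end Hat

/-! ### Families of simplices of equal dimension -/

/-- The union of the closed simplices of a family. -/
def polyhedron (S : Finset (Finset (Space d))) : Set (Space d) :=
  ⋃ s ∈ S, convexHull ℝ (s : Set (Space d))

open Classical in
/-- The vertices of a family of simplices. -/
noncomputable def verts (S : Finset (Finset (Space d))) : Finset (Space d) := S.biUnion id

/-- `S` is a family of `k`-dimensional simplices of the mesh. -/
structure IsFamily (M : Mesh Ω) (k : ℕ) (S : Finset (Finset (Space d))) : Prop where
  mem_faces : ∀ s ∈ S, s ∈ M.complex.faces
  card_eq : ∀ s ∈ S, s.card = k + 1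

/-- `u` is affine on every simplex of the family. -/
def IsPL (S : Finset (Finset (Space d))) (u : Space d → ℝ) : Prop := ∀ s ∈ S, IsAffOn s u

theorem IsPL.sub {S : Finset (Finset (Space d))} {u v : Space d → ℝ} (hu : IsPL S u)
    (hv : IsPL S v) : IsPL S fun x => u x - v x := fun s hs => (hu s hs).sub (hv s hs)

theorem isPL_const {S : Finset (Finset (Space d))} (c : ℝ) : IsPL S fun _ => c :=
  fun _ _ => isAffOn_const c

theorem subset_verts {S : Finset (Finset (Space d))} {s : Finset (Space d)} (hs : s ∈ S) :
    s ⊆ verts S := fun _ hv => Finset.mem_biUnion.2 ⟨s, hs, hv⟩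

theorem convexHull_subset_polyhedron {S : Finset (Finset (Space d))} {s : Finset (Space d)}
    (hs : s ∈ S) : convexHull ℝ (s : Set (Space d)) ⊆ polyhedron S :=
  subset_biUnion_of_mem (u := fun s : Finset (Space d) => convexHull ℝ (s : Set (Space d))) hs

theorem isCompact_polyhedron (S : Finset (Finset (Space d))) : IsCompact (polyhedron S) :=
  S.finite_toSet.isCompact_biUnion fun s _ => isCompact_convexHull_finset s

theorem IsPL.continuousOn {S : Finset (Finset (Space d))} {u : Space d → ℝ} (hu : IsPL S u) :
    ContinuousOn u (polyhedron S) := by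
  have : polyhedron S = ⋃ s : S, convexHull ℝ ((s : Finset (Space d)) : Set (Space d)) := by
    ext x; simp [polyhedron]
  rw [this]
  refine (locallyFinite_of_finite _).continuousOn_iUnion
    (fun s => (isCompact_convexHull_finset _).isClosed) fun s => ?_
  obtain ⟨A, hA⟩ := hu s s.2
  exact (A.continuous_of_finiteDimensional.continuousOn).congr hA

namespace IsFamily

variable {M : Mesh Ω} {k : ℕ} {S : Finset (Finset (Space d))}

theorem indep (hS : IsFamily M k S) {s : Finset (Space d)} (hs : s ∈ S) :
    AffineIndependent ℝ ((↑) : s → Space d) := M.complex.indep (hS.mem_faces s hs)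

theorem finrank_eq (hS : IsFamily M k S) {s : Finset (Space d)} (hs : s ∈ S) :
    Module.finrank ℝ (vectorSpan ℝ (s : Set (Space d))) = k :=
  finrank_vectorSpan_eq (hS.indep hs) (hS.card_eq s hs)

theorem measure_ne_top (hS : IsFamily M k S) {s : Finset (Space d)} (hs : s ∈ S) :
    (μHE[k] : Measure (Space d)) (convexHull ℝ (s : Set (Space d))) ≠ ⊤ :=
  measure_convexHull_ne_top (hS.indep hs) (hS.card_eq s hs)

theorem mono (hS : IsFamily M k S) {S' : Finset (Finset (Space d))} (h : S' ⊆ S) :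
    IsFamily M k S' := ⟨fun s hs => hS.mem_faces s (h hs), fun s hs => hS.card_eq s (h hs)⟩

theorem measure_polyhedron_ne_top (hS : IsFamily M k S) :
    (μHE[k] : Measure (Space d)) (polyhedron S) ≠ ⊤ := by
  refine ne_top_of_le_ne_top ?_ (measure_biUnion_finset_le S _)
  exact ENNReal.sum_ne_top.2 fun s hs => hS.measure_ne_top hs

/-- In a simplicial complex two simplices meet in the hull of their common vertices. Distinct
simplices of equal dimension share fewer than `k + 1` of them. -/
theorem measure_inter_eq_zero (hS : IsFamily M k S) {s t : Finset (Space d)} (hs : s ∈ S)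
    (ht : t ∈ S) (hst : s ≠ t) : (μHE[k] : Measure (Space d))
      (convexHull ℝ (s : Set (Space d)) ∩ convexHull ℝ (t : Set (Space d))) = 0 := by
  classical
  refine measure_mono_null (M.complex.inter_subset_convexHull (hS.mem_faces s hs)
    (hS.mem_faces t ht)) ?_
  rw [← Finset.coe_inter]
  refine measure_convexHull_eq_zero ?_
  have h1 : (s ∩ t).card < s.card := by
    refine Finset.card_lt_card (Finset.inter_subset_left.ssubset_of_ne fun h => hst ?_)
    have h2 : s ⊆ t := Finset.inter_eq_left.1 h
    exact Finset.eq_of_subset_of_card_le h2 (by rw [hS.card_eq s hs, hS.card_eq t ht])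
  have := hS.card_eq s hs
  omega

theorem integrableOn_of_continuousOn (hS : IsFamily M k S) {f : Space d → ℝ}
    (hf : ContinuousOn f (polyhedron S)) : IntegrableOn f (polyhedron S) μHE[k] := by
  have hc := isCompact_polyhedron S
  obtain ⟨b, hb⟩ := hc.exists_bound_of_continuousOn hf
  exact ⟨hf.aestronglyMeasurable hc.measurableSet, HasFiniteIntegral.restrict_of_bounded b
    hS.measure_polyhedron_ne_top.lt_top ((ae_restrict_iff' hc.measurableSet).2 (.of_forall hb))⟩

theorem integral_polyhedron (hS : IsFamily M k S) {f : Space d → ℝ}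
    (hf : ∀ s ∈ S, IntegrableOn f (convexHull ℝ (s : Set (Space d))) μHE[k]) :
    ∫ x in polyhedron S, f x ∂μHE[k] =
      ∑ s ∈ S, ∫ x in convexHull ℝ (s : Set (Space d)), f x ∂μHE[k] := by
  classical
  have key : ∀ S' ⊆ S, ∫ x in polyhedron S', f x ∂μHE[k] =
      ∑ s ∈ S', ∫ x in convexHull ℝ (s : Set (Space d)), f x ∂μHE[k] := by
    intro S' hS'
    induction S' using Finset.induction_on with
    | empty => simp [polyhedron]
    | insert s S' hs ih =>
      have hsS := hS' (Finset.mem_insert_self s S')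
      have hsub : S' ⊆ S := (Finset.subset_insert s S').trans hS'
      have e : polyhedron (insert s S') = convexHull ℝ (s : Set (Space d)) ∪ polyhedron S' := by
        simp [polyhedron]
      rw [e, Finset.sum_insert hs, ← ih hsub]
      refine setIntegral_union₀ ?_ (isCompact_polyhedron S').measurableSet.nullMeasurableSet
        (hf s hsS) (integrableOn_finset_iUnion.2 fun t ht => hf t (hsub ht))
      rw [AEDisjoint, polyhedron, inter_iUnion₂]
      refine (measure_biUnion_null_iff S'.countable_toSet).2 fun t ht => ?_
      exact hS.measure_inter_eq_zero hsS (hsub ht) (by rintro rfl; exact hs ht)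
  exact key S subset_rfl

theorem integral_polyhedron_of_continuousOn (hS : IsFamily M k S) {f : Space d → ℝ}
    (hf : ContinuousOn f (polyhedron S)) : ∫ x in polyhedron S, f x ∂μHE[k] =
      ∑ s ∈ S, ∫ x in convexHull ℝ (s : Set (Space d)), f x ∂μHE[k] :=
  hS.integral_polyhedron fun _ hs =>
    (hS.integrableOn_of_continuousOn hf).mono_set (convexHull_subset_polyhedron hs)

theorem isPL_nodal (hS : IsFamily M k S) (V : Finset (Space d)) (a : Space d → ℝ) :
    IsPL S (M.nodal V a) := fun s hs => M.isAffOn_nodal (hS.mem_faces s hs) V a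

theorem isPL_hat (hS : IsFamily M k S) (p : Space d) :
    IsPL S (M.hat p) := fun s hs => M.isAffOn_hat (hS.mem_faces s hs) p

theorem nodal_eq_self (hS : IsFamily M k S) {u : Space d → ℝ} (hu : IsPL S u) :
    EqOn (M.nodal (verts S) u) u (polyhedron S) := by
  intro x hx
  obtain ⟨s, hs, hx⟩ := mem_iUnion₂.1 hx
  exact M.nodal_eq_self (hS.mem_faces s hs) (subset_verts hs) (hu s hs) hx

end IsFamily

/-- The lumped integral `∫ I_h a` over the polyhedron of a family. -/
noncomputable def lumped (M : Mesh Ω) (k : ℕ) (S : Finset (Finset (Space d)))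
    (a : Space d → ℝ) : ℝ := ∫ x in polyhedron S, M.nodal (verts S) a x ∂μHE[k]

/-- The Dirichlet form of piecewise affine functions on a family. -/
noncomputable def energyForm (k : ℕ) (S : Finset (Finset (Space d))) (u v : Space d → ℝ) : ℝ :=
  ∑ s ∈ S, (μHE[k] : Measure (Space d)).real (convexHull ℝ (s : Set (Space d))) *
    inner ℝ (slope s u) (slope s v)

namespace IsFamily

variable {M : Mesh Ω} {k : ℕ} {S : Finset (Finset (Space d))}

/-- Lumping is a quadrature rule whose weights are the integrals of the nodal basis functions, hence
nonnegative. Linearity, monotonicity and dependence on nodal values alone all come from this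
formula. -/
theorem lumped_eq_sum (hS : IsFamily M k S) (a : Space d → ℝ) :
    lumped M k S a = ∑ p ∈ verts S, a p * ∫ x in polyhedron S, M.hat p x ∂μHE[k] := by
  rw [lumped]
  simp only [Mesh.nodal]
  rw [integral_finsetSum]
  · simp only [integral_const_mul]
  · intro p _
    exact (hS.integrableOn_of_continuousOn (hS.isPL_hat p).continuousOn).const_mul _

theorem lumped_mono (hS : IsFamily M k S) {a b : Space d → ℝ}
    (h : ∀ p ∈ verts S, a p ≤ b p) : lumped M k S a ≤ lumped M k S b := by
  rw [hS.lumped_eq_sum, hS.lumped_eq_sum]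
  exact Finset.sum_le_sum fun p hp =>
    mul_le_mul_of_nonneg_right (h p hp) (integral_nonneg fun x => M.hat_nonneg p x)

theorem lumped_congr (hS : IsFamily M k S) {a b : Space d → ℝ}
    (h : ∀ p ∈ verts S, a p = b p) : lumped M k S a = lumped M k S b :=
  le_antisymm (hS.lumped_mono fun p hp => (h p hp).le) (hS.lumped_mono fun p hp => (h p hp).ge)

theorem lumped_add (hS : IsFamily M k S) (a b : Space d → ℝ) :
    lumped M k S (fun p => a p + b p) = lumped M k S a + lumped M k S b := by
  simp only [hS.lumped_eq_sum, add_mul, Finset.sum_add_distrib]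

theorem lumped_sub (hS : IsFamily M k S) (a b : Space d → ℝ) :
    lumped M k S (fun p => a p - b p) = lumped M k S a - lumped M k S b := by
  simp only [hS.lumped_eq_sum, sub_mul, Finset.sum_sub_distrib]

theorem lumped_const_mul (hS : IsFamily M k S) (c : ℝ) (a : Space d → ℝ) :
    lumped M k S (fun p => c * a p) = c * lumped M k S a := by
  simp only [hS.lumped_eq_sum, mul_assoc, Finset.mul_sum]

theorem lumped_eq_integral (hS : IsFamily M k S) {u : Space d → ℝ} (hu : IsPL S u) :
    lumped M k S u = ∫ x in polyhedron S, u x ∂μHE[k] :=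
  setIntegral_congr_fun (isCompact_polyhedron S).measurableSet (hS.nodal_eq_self hu)

theorem lumped_const (hS : IsFamily M k S) (c : ℝ) :
    lumped M k S (fun _ => c) = c * (μHE[k] : Measure (Space d)).real (polyhedron S) := by
  rw [hS.lumped_eq_integral (isPL_const c), setIntegral_const, smul_eq_mul, mul_comm]

theorem abs_lumped_le (hS : IsFamily M k S) (a : Space d → ℝ) :
    |lumped M k S a| ≤ lumped M k S fun p => |a p| := by
  rw [hS.lumped_eq_sum, hS.lumped_eq_sum]
  refine (Finset.abs_sum_le_sum_abs _ _).trans (le_of_eq (Finset.sum_congr rfl fun p _ => ?_))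
  rw [abs_mul, abs_of_nonneg (integral_nonneg fun x => M.hat_nonneg p x)]

theorem lumped_nonneg (hS : IsFamily M k S) {a : Space d → ℝ} (h : ∀ p ∈ verts S, 0 ≤ a p) :
    0 ≤ lumped M k S a := by
  have := hS.lumped_mono (a := fun _ => 0) h
  rwa [hS.lumped_const, zero_mul] at this

/-- Jensen's inequality in barycentric coordinates: the square of the interpolated value is at most
the interpolated square. -/
theorem integral_sq_le_lumped (hS : IsFamily M k S) {u : Space d → ℝ} (hu : IsPL S u) :
    ∫ x in polyhedron S, u x ^ 2 ∂μHE[k] ≤ lumped M k S fun p => u p ^ 2 := by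
  refine setIntegral_mono_on (hS.integrableOn_of_continuousOn (hu.continuousOn.pow 2))
    (hS.integrableOn_of_continuousOn (hS.isPL_nodal _ _).continuousOn)
    (isCompact_polyhedron S).measurableSet fun x hx => ?_
  obtain ⟨s, hs, hx⟩ := mem_iUnion₂.1 hx
  obtain ⟨w, hw⟩ := exists_isBarycentric hx
  rw [M.nodal_eq_sum (hS.mem_faces s hs) (subset_verts hs) _ hw, (hu s hs).apply_eq hw]
  have := (even_two.convexOn_pow (𝕜 := ℝ)).map_sum_le (t := s) (w := w) (p := fun v => u v)
    hw.1 hw.2.2.1 fun _ _ => mem_univ _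
  simpa [smul_eq_mul] using this

/-- Equivalence of nodal and integral norms of affine functions on a simplex. -/
theorem exists_vertex_pow_le (hS : IsFamily M k S) {s : Finset (Space d)} (hs : s ∈ S)
    {u : Space d → ℝ} (hu : IsAffOn s u) (q : ℕ) : ∃ B : ℝ, 0 ≤ B ∧ (∀ v ∈ s, |u v| ≤ B) ∧
      (μHE[k] : Measure (Space d)).real (convexHull ℝ (s : Set (Space d))) * B ^ q ≤
        4 ^ k * 2 ^ q * ∫ x in convexHull ℝ (s : Set (Space d)), |u x| ^ q ∂μHE[k] := by
  have hne : s.Nonempty := Finset.card_pos.1 (by have := hS.card_eq s hs; omega)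
  obtain ⟨v₀, hv₀, hmax⟩ := s.exists_max_image (fun v => |u v|) hne
  set K := convexHull ℝ (s : Set (Space d)) with hK
  have hKm : MeasurableSet K := (isCompact_convexHull_finset s).measurableSet
  have hv₀K : v₀ ∈ K := subset_convexHull ℝ _ hv₀
  refine ⟨|u v₀|, abs_nonneg _, hmax, ?_⟩
  have hle : ∀ x ∈ K, |u x| ≤ |u v₀| := by
    intro x hx
    obtain ⟨w, hw⟩ := exists_isBarycentric hx
    rw [hu.apply_eq hw]
    calc |∑ v ∈ s, w v * u v| ≤ ∑ v ∈ s, |w v * u v| := Finset.abs_sum_le_sum_abs _ _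
      _ ≤ ∑ v ∈ s, w v * |u v₀| := Finset.sum_le_sum fun v hv => by
          rw [abs_mul, abs_of_nonneg (hw.1 v hv)]
          exact mul_le_mul_of_nonneg_left (hmax v hv) (hw.1 v hv)
      _ = |u v₀| := by rw [← Finset.sum_mul, hw.2.2.1, one_mul]
  -- The simplex is shrunk by `1 / 4` towards the vertex where `|u|` is largest. There `u` is `3/4`
  -- of the maximal value plus `1/4` of another value, so `|u|` stays above half its maximum; the
  -- volume lost is the factor `4 ^ k`.
  set K' := (AffineMap.homothety v₀ (1 / 4 : ℝ)) '' K with hK'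
  have hK'K : K' ⊆ K := by
    rintro _ ⟨x, hx, rfl⟩
    exact homothety_mem_of_convex (convex_convexHull ℝ _) hv₀K hx ⟨by norm_num, by norm_num⟩
  have hK'm : MeasurableSet K' := by
    refine ((isCompact_convexHull_finset s).image ?_).measurableSet
    exact AffineMap.homothety_continuous v₀ _
  have hfin := hS.measure_ne_top hs
  have hmeas : (μHE[k] : Measure (Space d)).real K' = (4 ^ k)⁻¹ *
      (μHE[k] : Measure (Space d)).real K := by
    rw [Measure.real, hK', euclideanHausdorffMeasure_homothety_image k v₀ (by norm_num),
      ENNReal.smul_def, smul_eq_mul, ENNReal.toReal_mul, Measure.real]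
    congr 1
    simp
  have hlow : ∀ x ∈ K', (|u v₀| / 2) ^ q ≤ |u x| ^ q := by
    rintro _ ⟨x, hx, rfl⟩
    refine pow_le_pow_left₀ (by positivity) ?_ q
    obtain ⟨A, hA⟩ := hu
    have h1 : u (AffineMap.homothety v₀ (1 / 4 : ℝ) x) = 3 / 4 * u v₀ + 1 / 4 * u x := by
      rw [hA (homothety_mem_of_convex (convex_convexHull ℝ _) hv₀K hx
        ⟨by norm_num, by norm_num⟩), hA hx, hA hv₀K, AffineMap.homothety_eq_lineMap,
        AffineMap.apply_lineMap, AffineMap.lineMap_apply]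
      simp only [vsub_eq_sub, smul_eq_mul, vadd_eq_add]
      ring
    rw [h1]
    have h2 := hle x hx
    have h3 := abs_sub_abs_le_abs_sub (3 / 4 * u v₀) (-(1 / 4 * u x))
    rw [sub_neg_eq_add, abs_neg, abs_mul, abs_mul] at h3
    norm_num at h3 ⊢
    linarith
  have hint : IntegrableOn (fun x => |u x| ^ q) K μHE[k] := by
    have : IsPL {s} u := fun t ht => by rw [Finset.mem_singleton.1 ht]; exact hu
    have hS' : IsFamily M k {s} := hS.mono (Finset.singleton_subset_iff.2 hs)
    have h := hS'.integrableOn_of_continuousOn (f := fun x => |u x| ^ q)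
      (this.continuousOn.abs.pow q)
    simpa [polyhedron] using h
  have h1 : (μHE[k] : Measure (Space d)).real K' * (|u v₀| / 2) ^ q ≤
      ∫ x in K, |u x| ^ q ∂μHE[k] := by
    calc _ = ∫ _ in K', (|u v₀| / 2) ^ q ∂μHE[k] := by rw [setIntegral_const, smul_eq_mul]
      _ ≤ ∫ x in K', |u x| ^ q ∂μHE[k] := by
          have : IsFiniteMeasure ((μHE[k] : Measure (Space d)).restrict K') :=
            ⟨by rw [Measure.restrict_apply_univ]
                exact (measure_ne_top_of_subset hK'K hfin).lt_top⟩
          exact setIntegral_mono_on (integrable_const _) (hint.mono_set hK'K) hK'm hlow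
      _ ≤ _ := setIntegral_mono_set hint (.of_forall fun x => by positivity)
          (LE.le.eventuallyLE hK'K)
  rw [hmeas, div_pow] at h1
  calc _ = 4 ^ k * 2 ^ q * ((4 ^ k)⁻¹ * (μHE[k] : Measure (Space d)).real K *
        (|u v₀| ^ q / 2 ^ q)) := by field_simp
    _ ≤ _ := by gcongr

/-- Localized equivalence of nodal and integral norms. -/
theorem lumped_pow_mul_le (hS : IsFamily M k S) {u : Space d → ℝ} (hu : IsPL S u) (q : ℕ)
    {η : Space d → ℝ} {R : ℝ} (hη : ∀ p ∈ verts S, 0 ≤ η p) (hηR : ∀ p ∈ verts S, η p ≤ R)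
    {T : Finset (Finset (Space d))} (hT : T ⊆ S)
    (hsupp : ∀ s ∈ S, s ∉ T → ∀ v ∈ s, η v = 0) :
    lumped M k S (fun p => |u p| ^ q * η p) ≤
      R * (4 ^ k * 2 ^ q) * ∫ x in polyhedron T, |u x| ^ q ∂μHE[k] := by
  have hTf := hS.mono hT
  have huT : IsPL T u := fun s hs => hu s (hT hs)
  rw [lumped, hS.integral_polyhedron_of_continuousOn (hS.isPL_nodal _ _).continuousOn,
    hTf.integral_polyhedron_of_continuousOn (f := fun x => |u x| ^ q)
      (huT.continuousOn.abs.pow q),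
    ← Finset.sum_subset hT, Finset.mul_sum]
  · refine Finset.sum_le_sum fun s hs => ?_
    have hsS := hT hs
    obtain ⟨B, hB0, hB, hBint⟩ := hS.exists_vertex_pow_le hsS (hu s hsS) q
    have hR : 0 ≤ R := by
      obtain ⟨v, hv⟩ : s.Nonempty := Finset.card_pos.1 (by have := hS.card_eq s hsS; omega)
      exact (hη v (subset_verts hsS hv)).trans (hηR v (subset_verts hsS hv))
    have hfin := hS.measure_ne_top hsS
    have hf : IsFiniteMeasure ((μHE[k] : Measure (Space d)).restrict
        (convexHull ℝ (s : Set (Space d)))) :=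
      ⟨by rw [Measure.restrict_apply_univ]; exact hfin.lt_top⟩
    calc ∫ x in convexHull ℝ (s : Set (Space d)),
          M.nodal (verts S) (fun p => |u p| ^ q * η p) x ∂μHE[k]
        ≤ ∫ _ in convexHull ℝ (s : Set (Space d)), B ^ q * R ∂μHE[k] := by
          refine setIntegral_mono_on ((hS.integrableOn_of_continuousOn
            (hS.isPL_nodal _ _).continuousOn).mono_set (convexHull_subset_polyhedron hsS))
            (integrable_const _) (isCompact_convexHull_finset s).measurableSet fun x hx => ?_
          obtain ⟨w, hw⟩ := exists_isBarycentric hx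
          rw [M.nodal_eq_sum (hS.mem_faces s hsS) (subset_verts hsS) _ hw]
          calc _ ≤ ∑ v ∈ s, w v * (B ^ q * R) := Finset.sum_le_sum fun v hv => by
                have h1 := hη v (subset_verts hsS hv)
                have h2 := hηR v (subset_verts hsS hv)
                have h3 := hB v hv
                have h4 := hw.1 v hv
                gcongr
            _ = B ^ q * R := by rw [← Finset.sum_mul, hw.2.2.1, one_mul]
      _ = R * ((μHE[k] : Measure (Space d)).real (convexHull ℝ (s : Set (Space d))) * B ^ q) := by
          rw [setIntegral_const, smul_eq_mul]; ring
      _ ≤ R * (4 ^ k * 2 ^ q *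
            ∫ x in convexHull ℝ (s : Set (Space d)), |u x| ^ q ∂μHE[k]) := by gcongr
      _ = _ := by ring
  -- On a simplex outside `T` the weight vanishes at all vertices, hence so does the interpolant.
  -- This localizes the estimate to the patch on which a bump lives.
  · intro s hs hsT
    rw [setIntegral_congr_fun (g := fun _ => (0 : ℝ))
      (isCompact_convexHull_finset s).measurableSet]
    · simp
    · intro x hx
      obtain ⟨w, hw⟩ := exists_isBarycentric hx
      rw [M.nodal_eq_sum (hS.mem_faces s hs) (subset_verts hs) _ hw]
      exact Finset.sum_eq_zero fun v hv => by rw [hsupp s hs hsT v hv]; ring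

theorem lumped_pow_le (hS : IsFamily M k S) {u : Space d → ℝ} (hu : IsPL S u) (q : ℕ) :
    lumped M k S (fun p => |u p| ^ q) ≤
      4 ^ k * 2 ^ q * ∫ x in polyhedron S, |u x| ^ q ∂μHE[k] := by
  have := hS.lumped_pow_mul_le hu q (η := fun _ => 1) (R := 1) (fun _ _ => zero_le_one)
    (fun _ _ => le_rfl) subset_rfl (fun s hs hs' => absurd hs hs')
  simpa using this

end IsFamily

/-! ### The Dirichlet form of piecewise affine functions -/

section EnergyForm

variable {k : ℕ} {S : Finset (Finset (Space d))} {u v w : Space d → ℝ}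

theorem energyForm_self (k : ℕ) (S : Finset (Finset (Space d))) (u : Space d → ℝ) :
    energyForm k S u u = ∑ s ∈ S, (μHE[k] : Measure (Space d)).real
      (convexHull ℝ (s : Set (Space d))) * ‖slope s u‖ ^ 2 :=
  Finset.sum_congr rfl fun s _ => by rw [real_inner_self_eq_norm_sq]

theorem energyForm_self_nonneg : 0 ≤ energyForm k S u u := by
  rw [energyForm_self]
  exact Finset.sum_nonneg fun s _ => by positivity

theorem energyForm_const_right (c : ℝ) : energyForm k S u (fun _ => c) = 0 :=
  Finset.sum_eq_zero fun s _ => by rw [slope_const, inner_zero_right, mul_zero]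

theorem abs_energyForm_le : |energyForm k S u v| ≤ energyForm k S u u + energyForm k S v v := by
  rw [energyForm_self, energyForm_self, ← Finset.sum_add_distrib]
  refine (Finset.abs_sum_le_sum_abs _ _).trans (Finset.sum_le_sum fun s _ => ?_)
  rw [abs_mul, abs_of_nonneg measureReal_nonneg, ← mul_add]
  refine mul_le_mul_of_nonneg_left ((abs_real_inner_le_norm _ _).trans ?_) measureReal_nonneg
  nlinarith [sq_nonneg (‖slope s u‖ - ‖slope s v‖), sq_nonneg ‖slope s u‖, sq_nonneg ‖slope s v‖]

theorem energyForm_congr (hu : IsPL S u) (h : EqOn v u (polyhedron S)) :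
    energyForm k S v w = energyForm k S u w :=
  Finset.sum_congr rfl fun s hs => by
    rw [slope_congr (hu s hs) fun x hx => h (convexHull_subset_polyhedron hs hx)]

theorem energyForm_comm : energyForm k S u v = energyForm k S v u :=
  Finset.sum_congr rfl fun s _ => by rw [real_inner_comm]

/-- The polarization identity used for implicit time steps. -/
theorem two_mul_energyForm_sub (hu : IsPL S u) (hv : IsPL S v) :
    2 * energyForm k S u (fun x => u x - v x) = energyForm k S u u - energyForm k S v v +
      energyForm k S (fun x => u x - v x) (fun x => u x - v x) := by
  simp only [energyForm, Finset.mul_sum, ← Finset.sum_sub_distrib, ← Finset.sum_add_distrib]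
  refine Finset.sum_congr rfl fun s hs => ?_
  rw [slope_sub (hu s hs) (hv s hs)]
  simp only [inner_sub_left, inner_sub_right]
  rw [real_inner_comm (slope s u) (slope s v)]
  ring

end EnergyForm

/-! ### Bulk and boundary partitions as families of simplices -/

theorem Mesh.isFamily_cells (M : Mesh Ω) : IsFamily M d M.cells := by
  classical
  refine ⟨fun s hs => ?_, fun s hs => ?_⟩
  · have := (Finset.mem_filter.1 hs).1
    simpa using this
  · exact (Finset.mem_filter.1 hs).2

theorem Mesh.isFamily_bdryCells (M : Mesh Ω) (hd : 0 < d) : IsFamily M (d - 1) M.bdryCells := by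
  classical
  refine ⟨fun s hs => ?_, fun s hs => ?_⟩
  · have := (Finset.mem_filter.1 hs).1
    simpa using this
  · have := (Finset.mem_filter.1 hs).2.1
    omega

theorem Mesh.bdryCell_subset (M : Mesh Ω) {s : Finset (Space d)} (hs : s ∈ M.bdryCells) :
    convexHull ℝ (s : Set (Space d)) ⊆ frontier Ω := by
  classical exact (Finset.mem_filter.1 hs).2.2

theorem Mesh.mem_faces_of_bdryCells (M : Mesh Ω) {s : Finset (Space d)} (hs : s ∈ M.bdryCells) :
    s ∈ M.complex.faces := by
  classical
  have := (Finset.mem_filter.1 hs).1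
  simpa using this

theorem Mesh.polyhedron_cells (M : Mesh Ω) : polyhedron M.cells = closure Ω := M.covers

theorem Mesh.polyhedron_bdryCells (M : Mesh Ω) : polyhedron M.bdryCells = frontier Ω :=
  M.boundary_covers

theorem Mesh.bdryVertices_subset (M : Mesh Ω) : M.bdryVertices ⊆ M.vertices := by
  classical
  intro v hv
  obtain ⟨s, hs, hvs⟩ := Finset.mem_biUnion.1 hv
  obtain ⟨t, ht, hst⟩ := M.pure s (M.mem_faces_of_bdryCells hs)
  exact Finset.mem_biUnion.2 ⟨t, ht, hst hvs⟩

theorem Mesh.mem_feSpace {M : Mesh Ω} {u : Space d → ℝ} : u ∈ M.feSpace ↔ IsPL M.cells u := by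
  refine ⟨fun h => h.2, fun h => ⟨?_, h⟩⟩
  rw [← M.polyhedron_cells]
  exact h.continuousOn

theorem Mesh.isPL_bdryCells {M : Mesh Ω} {u : Space d → ℝ} (hu : IsPL M.cells u) :
    IsPL M.bdryCells u := by
  intro s hs
  obtain ⟨t, ht, hst⟩ := M.pure s (M.mem_faces_of_bdryCells hs)
  obtain ⟨A, hA⟩ := hu t ht
  exact ⟨A, hA.mono (convexHull_mono (by exact_mod_cast hst))⟩

theorem Mesh.nodal_mem_feSpace (M : Mesh Ω) (V : Finset (Space d)) (a : Space d → ℝ) :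
    M.nodal V a ∈ M.feSpace := Mesh.mem_feSpace.2 (M.isFamily_cells.isPL_nodal V a)

theorem volume_eq : (volume : Measure (Space d)) = μHE[d] :=
  (EuclideanSpace.euclideanHausdorffMeasure_eq_volume d).symm

theorem setIntegral_eq_closure (hΩ : IsConvexPolytopeDomain Ω) (f : Space d → ℝ) :
    ∫ x in Ω, f x = ∫ x in closure Ω, f x ∂μHE[d] := by
  rw [volume_eq]
  refine setIntegral_congr_set ?_
  rw [← volume_eq, ae_eq_set]
  refine ⟨by rw [sdiff_eq_empty.2 subset_closure]; exact measure_empty, ?_⟩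
  have := hΩ.convex.addHaar_frontier volume
  rwa [frontier, hΩ.isOpen.interior_eq] at this

theorem Mesh.integral_interp (M : Mesh Ω) (hΩ : IsConvexPolytopeDomain Ω) (a : Space d → ℝ) :
    ∫ x in Ω, M.interp a x = lumped M d M.cells a := by
  rw [setIntegral_eq_closure hΩ, lumped, M.polyhedron_cells]
  rfl

theorem Mesh.bdryIntegral_bdryInterp (M : Mesh Ω) (a : Space d → ℝ) :
    bdryIntegral Ω (M.bdryInterp a) = lumped M (d - 1) M.bdryCells a := by
  rw [bdryIntegral, lumped, M.polyhedron_bdryCells]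
  rfl

/-- Pointwise gradients of a piecewise affine function are known only in the relative interior of a
simplex. The remaining points form a null set, so the integrals reduce to volume times a constant.
-/
theorem setIntegral_eq_of_relInt {k : ℕ} {M : Mesh Ω} {S : Finset (Finset (Space d))}
    (hS : IsFamily M k S) {s : Finset (Space d)} (hs : s ∈ S) {f : Space d → ℝ} {c : ℝ}
    (h : ∀ x ∈ relInt (vectorSpan ℝ (s : Set (Space d))) (convexHull ℝ (s : Set (Space d))),
      f x = c) :
    IntegrableOn f (convexHull ℝ (s : Set (Space d))) μHE[k] ∧
    ∫ x in convexHull ℝ (s : Set (Space d)), f x ∂μHE[k] =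
      (μHE[k] : Measure (Space d)).real (convexHull ℝ (s : Set (Space d))) * c := by
  obtain ⟨p, hp⟩ : s.Nonempty := Finset.card_pos.1 (by have := hS.card_eq s hs; omega)
  have hnull := measure_diff_relInt (hS.finrank_eq hs) (convex_convexHull ℝ (s : Set (Space d)))
    (convexHull_subset_flat hp)
  have hae : ∀ᵐ x ∂(μHE[k] : Measure (Space d)).restrict (convexHull ℝ (s : Set (Space d))),
      f x = c := by
    rw [ae_restrict_iff' (isCompact_convexHull_finset s).measurableSet, ae_iff]
    refine measure_mono_null (fun x hx => ?_) hnull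
    simp only [Set.mem_ofPred_eq, Classical.not_imp] at hx
    exact ⟨hx.1, fun hx' => hx.2 (h x hx')⟩
  have hfin : IsFiniteMeasure ((μHE[k] : Measure (Space d)).restrict
      (convexHull ℝ (s : Set (Space d)))) :=
    ⟨by rw [Measure.restrict_apply_univ]; exact (hS.measure_ne_top hs).lt_top⟩
  refine ⟨(integrable_const c).congr (hae.mono fun x hx => hx.symm), ?_⟩
  rw [integral_congr_ae hae, integral_const, measureReal_restrict_apply_univ, smul_eq_mul]

theorem Mesh.dirichlet_eq (M : Mesh Ω) (hΩ : IsConvexPolytopeDomain Ω) {u v : Space d → ℝ}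
    (hu : IsPL M.cells u) (hv : IsPL M.cells v) :
    dirichlet Ω u v = energyForm d M.cells u v := by
  have hS := M.isFamily_cells
  have key : ∀ s ∈ M.cells, _ := fun s hs => setIntegral_eq_of_relInt hS hs
    (f := fun x => inner ℝ (gradient u x) (gradient v x)) (c := inner ℝ (slope s u) (slope s v))
    (fun x hx => by
      have htop : vectorSpan ℝ (s : Set (Space d)) = ⊤ :=
        Submodule.eq_top_of_finrank_eq (by rw [hS.finrank_eq hs, finrank_euclideanSpace_fin])
      rw [gradient_eq (hu s hs) htop hx, gradient_eq (hv s hs) htop hx, Submodule.coe_inner])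
  rw [dirichlet, setIntegral_eq_closure hΩ, ← M.polyhedron_cells,
    hS.integral_polyhedron fun s hs => (key s hs).1]
  exact Finset.sum_congr rfl fun s hs => (key s hs).2

theorem Mesh.bdryDirichlet_eq (M : Mesh Ω) (hd : 0 < d) {u v : Space d → ℝ}
    (hu : IsPL M.bdryCells u) (hv : IsPL M.bdryCells v) :
    M.bdryDirichlet u v = energyForm (d - 1) M.bdryCells u v := by
  have hS := M.isFamily_bdryCells hd
  exact Finset.sum_congr rfl fun s hs => (setIntegral_eq_of_relInt hS hs fun x hx => by
    rw [tangentialGradient_eq (hu s hs) hx, tangentialGradient_eq (hv s hs) hx]).2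

/-! ### Poincaré inequality with a bump moment in place of the mean -/

/-- The pointwise inequality `f² ≤ l² + |f|³ / l`, with `l` of the size of `√E`, balances the two
terms and gives the homogeneity of a Poincaré inequality. -/
theorem integral_sq_le_of_cube {α : Type*} [MeasurableSpace α] {ν : Measure α} [IsFiniteMeasure ν]
    {f : α → ℝ} (h2 : Integrable (fun x => f x ^ 2) ν) (h3 : Integrable (fun x => |f x| ^ 3) ν)
    {c E : ℝ} (hc : 0 ≤ c) (hE : 0 ≤ E) (h : ∫ x, |f x| ^ 3 ∂ν ≤ c * E ^ (3 / 2 : ℝ)) :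
    ∫ x, f x ^ 2 ∂ν ≤ (ν.real univ + c) * E := by
  have key : ∀ l : ℝ, 0 < l → E ≤ l ^ 2 → ∫ x, f x ^ 2 ∂ν ≤ (ν.real univ + c) * l ^ 2 := by
    intro l hl hEl
    have h1 : E ^ (3 / 2 : ℝ) ≤ l ^ 3 := by
      calc E ^ (3 / 2 : ℝ) ≤ (l ^ 2) ^ (3 / 2 : ℝ) := by gcongr
        _ = l ^ 3 := by
          rw [← Real.rpow_natCast l 2, ← Real.rpow_mul hl.le, ← Real.rpow_natCast l 3]
          norm_num
    calc ∫ x, f x ^ 2 ∂ν ≤ ∫ x, (l ^ 2 + l⁻¹ * |f x| ^ 3) ∂ν := by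
          refine integral_mono h2 ((integrable_const _).add (h3.const_mul _)) fun x => ?_
          beta_reduce
          rw [← sq_abs (f x)]
          have h0 := abs_nonneg (f x)
          have : l⁻¹ * |f x| ^ 3 = |f x| ^ 3 / l := by field_simp
          rw [this, ← sub_nonneg]
          have e : l ^ 2 + |f x| ^ 3 / l - |f x| ^ 2 =
            (l ^ 3 + |f x| ^ 3 - l * |f x| ^ 2) / l := by field_simp
          rw [e]
          refine div_nonneg ?_ hl.le
          nlinarith [mul_nonneg (add_nonneg hl.le h0) (sq_nonneg (l - |f x|)),
            mul_nonneg (sq_nonneg l) h0]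
      _ = l ^ 2 * ν.real univ + l⁻¹ * ∫ x, |f x| ^ 3 ∂ν := by
          rw [integral_add (integrable_const _) (h3.const_mul _), integral_const_mul,
            integral_const, smul_eq_mul, mul_comm]
      _ ≤ l ^ 2 * ν.real univ + l⁻¹ * (c * l ^ 3) := by
          have := h.trans (mul_le_mul_of_nonneg_left h1 hc)
          gcongr
      _ = _ := by field_simp
  have hν : 0 ≤ ν.real univ + c := add_nonneg measureReal_nonneg hc
  refine le_of_forall_pos_le_add fun ε hε => ?_
  -- Since `E` may vanish, `l² = E + e` is taken with a small positive `e`, whose total contribution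
  -- is at most `ε`.
  set e := ε / (ν.real univ + c + 1) with he
  have he0 : 0 < e := by positivity
  refine (key (Real.sqrt (E + e)) (Real.sqrt_pos.2 (by linarith)) ?_).trans ?_
  · rw [Real.sq_sqrt (by linarith)]; linarith
  · rw [Real.sq_sqrt (by linarith), mul_add]
    have : (ν.real univ + c) * e ≤ (ν.real univ + c + 1) * e :=
      mul_le_mul_of_nonneg_right (by linarith) he0.le
    have h2 : (ν.real univ + c + 1) * e = ε := by rw [he]; field_simp
    linarith

/-- A Lipschitz continuous bump at `p`, supported in the ball of radius `r / 2`. -/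
noncomputable def bump (p : Space d) (r : ℝ) (x : Space d) : ℝ := max 0 (r / 2 - dist x p)

theorem bump_nonneg (p : Space d) (r : ℝ) (x : Space d) : 0 ≤ bump p r x := le_max_left _ _

theorem bump_le (p : Space d) {r : ℝ} (hr : 0 < r) (x : Space d) : bump p r x ≤ r / 2 :=
  max_le (by linarith) (by linarith [dist_nonneg (x := x) (y := p)])

theorem abs_bump_sub_le (p : Space d) (r : ℝ) (x y : Space d) :
    |bump p r x - bump p r y| ≤ dist x y := by
  rw [bump, bump]
  rw [max_comm 0, max_comm 0]
  refine (abs_max_sub_max_le_abs _ _ _).trans ?_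
  rw [sub_sub_sub_cancel_left, abs_sub_comm]
  exact abs_dist_sub_le x y p

theorem bump_eq_zero {p : Space d} {r : ℝ} {x : Space d} (h : r / 2 ≤ dist x p) :
    bump p r x = 0 := max_eq_left (by linarith)

theorem dist_le_of_diam {s : Finset (Space d)} {h : ℝ}
    (hs : Metric.diam (convexHull ℝ (s : Set (Space d))) ≤ h) {x y : Space d}
    (hx : x ∈ convexHull ℝ (s : Set (Space d))) (hy : y ∈ convexHull ℝ (s : Set (Space d))) :
    dist x y ≤ h :=
  (Metric.dist_le_diam_of_mem (isCompact_convexHull_finset s).isBounded hx hy).trans hs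

theorem IsFamily.sum_measure_eq {M : Mesh Ω} {k : ℕ} {S : Finset (Finset (Space d))}
    (hS : IsFamily M k S) : ∑ s ∈ S, (μHE[k] : Measure (Space d)).real
      (convexHull ℝ (s : Set (Space d))) = (μHE[k] : Measure (Space d)).real (polyhedron S) := by
  have := hS.integral_polyhedron_of_continuousOn (f := fun _ => (1 : ℝ)) continuousOn_const
  simpa using this.symm

/-- The Lagrange interpolant of a bump has uniformly bounded Dirichlet energy. -/
theorem IsFamily.energyForm_bump_le {M : Mesh Ω} {k : ℕ} {S : Finset (Finset (Space d))}
    (hS : IsFamily M k S) {h ρ : ℝ} (hh : 0 < h) (hρ : 0 < ρ)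
    (hdiam : ∀ s ∈ S, Metric.diam (convexHull ℝ (s : Set (Space d))) ≤ h)
    (hball : ∀ s ∈ S, ContainsBall s (ρ * h)) {V : Finset (Space d)} (hV : verts S ⊆ V)
    (p : Space d) (r : ℝ) :
    energyForm k S (M.nodal V (bump p r)) (M.nodal V (bump p r)) ≤
      (2 / ρ) ^ 2 * (μHE[k] : Measure (Space d)).real (polyhedron S) := by
  rw [energyForm_self, ← hS.sum_measure_eq, Finset.mul_sum]
  refine Finset.sum_le_sum fun s hs => ?_
  -- The bump is 1-Lipschitz, so its values at the vertices of a simplex differ by at most `h`,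
  -- while the inradius is at least `ρ * h`; the mesh size cancels.
  have hsl : ‖slope s (M.nodal V (bump p r))‖ ≤ 2 / ρ := by
    have := norm_slope_le (hS.isPL_nodal V (bump p r) s hs) (mul_pos hρ hh) (hball s hs) (M := h)
      (fun v hv w hw => by
        rw [M.nodal_vertex (hS.mem_faces s hs) _ hv (hV (subset_verts hs hv)),
          M.nodal_vertex (hS.mem_faces s hs) _ hw (hV (subset_verts hs hw))]
        exact (abs_bump_sub_le p r v w).trans (dist_le_of_diam (hdiam s hs)
          (subset_convexHull ℝ _ hv) (subset_convexHull ℝ _ hw)))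
    refine this.trans (le_of_eq ?_)
    field_simp
  rw [mul_comm]
  gcongr

/-- A Poincaré inequality on a convex patch, with the mean value replaced by a lumped integral
against a bump. The constant does not depend on the mesh. -/
theorem exists_local_poincare {k : ℕ} (hk : 0 < k) (hk3 : k ≤ 3) {P : Set (Space d)}
    (hPc : IsCompact P) (hP : Convex ℝ P) (hfin : (μHE[k] : Measure (Space d)) P ≠ ⊤)
    {C : ENNReal} (hC : C ≠ ⊤) (hgrowth : ∀ y : Space d, ∀ r : ℝ, 0 < r →
      (μHE[k] : Measure (Space d)).restrict P (Metric.closedBall y r) ≤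
        C * ENNReal.ofReal (r ^ (k : ℝ)))
    {p : Space d} {r : ℝ} (hr : 0 < r)
    (hpos : ∀ ε > 0, 0 < (μHE[k] : Measure (Space d)) (P ∩ Metric.ball p ε)) :
    ∃ c : ℝ, 0 ≤ c ∧ ∀ (M : Mesh Ω) (S T : Finset (Finset (Space d))) (h : ℝ), IsFamily M k S →
      h ≤ r / 4 → (∀ s ∈ S, Metric.diam (convexHull ℝ (s : Set (Space d))) ≤ h) →
      T ⊆ S → polyhedron T = P → (∀ s ∈ S, convexHull ℝ (s : Set (Space d)) ⊆ P → s ∈ T) →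
      Metric.ball p r ∩ polyhedron S ⊆ P → ∀ u, IsPL S u → ∀ Q,
      |lumped M k S fun x => u x * bump p r x| ≤ Q →
      ∫ x in P, u x ^ 2 ∂μHE[k] ≤ c * (Q ^ 2 + energyForm k T u u) := by
  have hPm := hPc.measurableSet
  have hfinm : IsFiniteMeasure ((μHE[k] : Measure (Space d)).restrict P) :=
    ⟨by rw [Measure.restrict_apply_univ]; exact hfin.lt_top⟩
  have hP0 : (μHE[k] : Measure (Space d)) P ≠ 0 :=
    ((hpos 1 one_pos).trans_le (measure_mono inter_subset_left)).ne'
  have hk0 : (1 : ℝ) ≤ k := by exact_mod_cast hk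
  obtain ⟨c₁, hc₁, hsob⟩ := exists_sobolev_poincare hk hk3 hPc hP hfin hP0 hC hgrowth
    (ν := (μHE[k] : Measure (Space d)).restrict P) (m := k)
    (by rw [Measure.restrict_apply hPm.compl]; simp) (by nlinarith) hC hgrowth
  set μP := (μHE[k] : Measure (Space d)).real P with hμP
  have hμP0 : 0 ≤ μP := measureReal_nonneg
  -- Lower bound for the lumped mass of the bump. A simplex that meets the ball of radius `r / 8`
  -- has its vertices within `r / 8 + h ≤ 3 r / 8` of `p`, where the bump is at least `r / 8`.
  set b := r / 8 * (μHE[k] : Measure (Space d)).real (P ∩ Metric.ball p (r / 8)) with hb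
  have hb0 : 0 < b := mul_pos (by positivity) (ENNReal.toReal_pos (hpos _ (by positivity)).ne'
    (measure_ne_top_of_subset inter_subset_left hfin))
  set c₂ := μP + c₁ with hc₂
  have hc₂0 : 0 ≤ c₂ := by positivity
  -- The bump is at most `r / 2`, and `4 ^ k * 2` is the constant of the nodal norm equivalence with
  -- exponent 1.
  set A := r / 2 * (4 ^ k * 2) with hA
  refine ⟨2 * c₂ + 2 * μP * (2 / b ^ 2 * (1 + A ^ 2 * (μP * c₂))), by positivity, ?_⟩
  intro M S T h hS hh hdiam hTS hTP hTmax hball u hu Q hQ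
  have hT := hS.mono hTS
  have huT : IsPL T u := fun s hs => hu s (hTS hs)
  have hucont : ContinuousOn u P := by rw [← hTP]; exact huT.continuousOn
  set E := energyForm k T u u with hE
  have hE0 : 0 ≤ E := energyForm_self_nonneg
  set m := ⨍ y in P, u y ∂μHE[k] with hm
  have hcube := hsob u hucont T (fun s => convexHull ℝ (s : Set (Space d)))
    (fun s => ‖slope s u‖) (fun _ _ => norm_nonneg _) hTP.ge
    (fun s _ => (isCompact_convexHull_finset s).isClosed) (fun s _ => convex_convexHull ℝ _)
    (fun s hs => hTP ▸ convexHull_subset_polyhedron hs)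
    (fun s hs x hx y hy => abs_sub_le_slope (huT s hs) hx hy)
  rw [← energyForm_self, ← hE, ← hm] at hcube
  have hint : ∀ f : Space d → ℝ, ContinuousOn f P → IntegrableOn f P μHE[k] := fun f hf => by
    rw [← hTP] at hf ⊢; exact hT.integrableOn_of_continuousOn hf
  have hucm : ContinuousOn (fun x => u x - m) P := hucont.sub continuousOn_const
  have hsq : ∫ x in P, (u x - m) ^ 2 ∂μHE[k] ≤ c₂ * E := by
    have := integral_sq_le_of_cube (hint _ (hucm.pow 2)) (hint _ (hucm.abs.pow 3)) hc₁ hE0 hcube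
    rwa [measureReal_restrict_apply_univ] at this
  set I₁ := ∫ x in P, |u x - m| ∂μHE[k] with hI₁
  have hI₁0 : 0 ≤ I₁ := integral_nonneg fun _ => abs_nonneg _
  -- The Cauchy-Schwarz inequality, read off from the integral of the square of `μP * |u - m| - I₁`.
  have hI₁sq : I₁ ^ 2 ≤ μP * (c₂ * E) := by
    have h1 : 0 ≤ ∫ x in P, (μP * |u x - m| - I₁) ^ 2 ∂μHE[k] :=
      integral_nonneg fun _ => sq_nonneg _
    have h2 : ∫ x in P, (μP * |u x - m| - I₁) ^ 2 ∂μHE[k] =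
        μP ^ 2 * (∫ x in P, (u x - m) ^ 2 ∂μHE[k]) - μP * I₁ ^ 2 := by
      have e : ∀ x, (μP * |u x - m| - I₁) ^ 2 =
          μP ^ 2 * (u x - m) ^ 2 - 2 * μP * I₁ * |u x - m| + I₁ ^ 2 := by
        intro x; rw [← sq_abs (u x - m)]; ring
      simp_rw [e]
      rw [integral_add, integral_sub, integral_const_mul, integral_const_mul, ← hI₁,
        setIntegral_const, ← hμP, smul_eq_mul]
      · ring
      · exact (hint _ (hucm.pow 2)).const_mul _
      · exact (hint _ hucm.abs).const_mul _
      · exact ((hint _ (hucm.pow 2)).const_mul _).sub ((hint _ hucm.abs).const_mul _)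
      · exact integrable_const _
    have hμPpos : 0 < μP := ENNReal.toReal_pos hP0 hfin
    rw [h2] at h1
    have h3 : μP * I₁ ^ 2 ≤ μP * (μP * (c₂ * E)) := by
      nlinarith [mul_le_mul_of_nonneg_left hsq (sq_nonneg μP)]
    exact le_of_mul_le_mul_left h3 hμPpos
  have hlow : b ≤ lumped M k S (bump p r) := by
    have hnn : ∀ x ∈ polyhedron S, 0 ≤ M.nodal (verts S) (bump p r) x := fun x _ =>
      Finset.sum_nonneg fun v _ => mul_nonneg (bump_nonneg p r v) (M.hat_nonneg v x)
    have hi := hS.integrableOn_of_continuousOn (hS.isPL_nodal (verts S) (bump p r)).continuousOn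
    have hsub : P ∩ Metric.ball p (r / 8) ⊆ polyhedron S := fun x hx => by
      have : x ∈ polyhedron T := hTP ▸ hx.1
      obtain ⟨s, hs, hxs⟩ := mem_iUnion₂.1 this
      exact convexHull_subset_polyhedron (hTS hs) hxs
    have hm8 : MeasurableSet (P ∩ Metric.ball p (r / 8)) :=
      hPm.inter Metric.isOpen_ball.measurableSet
    calc b = ∫ _ in P ∩ Metric.ball p (r / 8), r / 8 ∂μHE[k] := by
          rw [setIntegral_const, smul_eq_mul, hb, mul_comm]
      _ ≤ ∫ x in P ∩ Metric.ball p (r / 8), M.nodal (verts S) (bump p r) x ∂μHE[k] := by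
          have : IsFiniteMeasure ((μHE[k] : Measure (Space d)).restrict
              (P ∩ Metric.ball p (r / 8))) :=
            ⟨by rw [Measure.restrict_apply_univ]
                exact (measure_ne_top_of_subset inter_subset_left hfin).lt_top⟩
          refine setIntegral_mono_on (integrable_const _) (hi.mono_set hsub) hm8 fun x hx => ?_
          obtain ⟨s, hs, hxs⟩ := mem_iUnion₂.1 (hsub hx)
          obtain ⟨w, hw⟩ := exists_isBarycentric hxs
          rw [M.nodal_eq_sum (hS.mem_faces s hs) (subset_verts hs) _ hw]
          calc r / 8 = ∑ v ∈ s, w v * (r / 8) := by rw [← Finset.sum_mul, hw.2.2.1, one_mul]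
            _ ≤ _ := Finset.sum_le_sum fun v hv => by
              refine mul_le_mul_of_nonneg_left ?_ (hw.1 v hv)
              have h1 := dist_le_of_diam (hdiam s hs) (subset_convexHull ℝ _ hv) hxs
              have h2 : dist x p < r / 8 := hx.2
              have h3 := dist_triangle v x p
              exact le_max_of_le_right (by linarith)
      _ ≤ lumped M k S (bump p r) := by
          refine setIntegral_mono_set hi ?_ (LE.le.eventuallyLE hsub)
          rw [Filter.EventuallyLE, ae_restrict_iff' (isCompact_polyhedron S).measurableSet]
          exact .of_forall hnn
  -- A simplex with a vertex in the support of the bump lies within `r / 2 + h < r` of `p`, hence in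
  -- `P`. Only the simplices of `T` contribute, and `u - m` is controlled on `P`.
  have hloc : lumped M k S (fun x => |u x - m| * bump p r x) ≤ A * I₁ := by
    have := hS.lumped_pow_mul_le (hu.sub (isPL_const m)) 1 (η := bump p r) (R := r / 2)
      (fun v _ => bump_nonneg p r v) (fun v _ => bump_le p hr v) hTS (fun s hs hsT v hv => by
        refine bump_eq_zero (not_lt.1 fun hlt => hsT (hTmax s hs fun x hx => hball ⟨?_, ?_⟩))
        · have h1 := dist_le_of_diam (hdiam s hs) hx (subset_convexHull ℝ _ hv)
          have h2 := dist_triangle x v p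
          rw [Metric.mem_ball]; linarith
        · exact convexHull_subset_polyhedron hs hx)
    rw [hTP] at this
    simpa only [pow_one] using this
  -- The constant `m` is recovered from the moment: `m` times the mass of the bump equals the moment
  -- of `u` minus the moment of `u - m`.
  have hmb : |m| * b ≤ Q + A * I₁ := by
    have e : m * lumped M k S (bump p r) = lumped M k S (fun x => u x * bump p r x) -
        lumped M k S (fun x => (u x - m) * bump p r x) := by
      rw [← hS.lumped_const_mul, ← hS.lumped_sub]
      exact hS.lumped_congr fun _ _ => by ring
    have h1 : |lumped M k S fun x => (u x - m) * bump p r x| ≤ A * I₁ := by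
      refine (hS.abs_lumped_le _).trans (le_trans (le_of_eq ?_) hloc)
      exact hS.lumped_congr fun v _ => by rw [abs_mul, abs_of_nonneg (bump_nonneg p r v)]
    calc |m| * b ≤ |m| * lumped M k S (bump p r) := by gcongr
      _ = |m * lumped M k S (bump p r)| := by rw [abs_mul, abs_of_nonneg (hb0.le.trans hlow)]
      _ ≤ Q + A * I₁ := by rw [e]; exact (abs_sub _ _).trans (add_le_add hQ h1)
  have hm2 : m ^ 2 ≤ 2 / b ^ 2 * (Q ^ 2 + A ^ 2 * (μP * c₂) * E) := by
    have h0 : 0 ≤ |m| * b := by positivity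
    have h1 : (|m| * b) ^ 2 ≤ (Q + A * I₁) ^ 2 := by gcongr
    rw [mul_pow, sq_abs] at h1
    rw [div_mul_eq_mul_div, le_div_iff₀ (by positivity)]
    nlinarith [sq_nonneg (Q - A * I₁), mul_le_mul_of_nonneg_left hI₁sq (sq_nonneg A)]
  have hfinal : ∫ x in P, u x ^ 2 ∂μHE[k] ≤
      2 * (∫ x in P, (u x - m) ^ 2 ∂μHE[k]) + 2 * μP * m ^ 2 := by
    calc _ ≤ ∫ x in P, (2 * (u x - m) ^ 2 + 2 * m ^ 2) ∂μHE[k] := by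
          refine integral_mono (hint _ (hucont.pow 2))
            (((hint _ (hucm.pow 2)).const_mul _).add (integrable_const _)) fun x => ?_
          beta_reduce
          nlinarith [sq_nonneg (u x - 2 * m)]
      _ = _ := by
          have hi2 : IntegrableOn (fun x => 2 * (u x - m) ^ 2) P μHE[k] :=
            (hint _ (hucm.pow 2)).const_mul _
          rw [integral_add hi2 (integrable_const _), integral_const_mul, setIntegral_const, ← hμP,
            smul_eq_mul]
          ring
  have hQ2 := sq_nonneg Q
  calc _ ≤ 2 * (c₂ * E) + 2 * μP * (2 / b ^ 2 * (Q ^ 2 + A ^ 2 * (μP * c₂) * E)) := by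
        refine hfinal.trans (add_le_add ?_ ?_) <;> gcongr
    _ ≤ _ := by
        rw [← sub_nonneg]
        have e : (2 * c₂ + 2 * μP * (2 / b ^ 2 * (1 + A ^ 2 * (μP * c₂)))) * (Q ^ 2 + E) -
          (2 * (c₂ * E) + 2 * μP * (2 / b ^ 2 * (Q ^ 2 + A ^ 2 * (μP * c₂) * E))) =
          2 * c₂ * Q ^ 2 + 2 * μP * (2 / b ^ 2 * (E + A ^ 2 * (μP * c₂) * Q ^ 2)) := by ring
        rw [e]; positivity

/-! ### Faces of a convex polytope -/

/-- The intersection of a finitely generated convex hull with a supporting hyperplane. -/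
theorem mem_convexHull_filter {F : Finset (Space d)} {n : Space d} {c : ℝ}
    (hF : ∀ v ∈ F, inner ℝ n v ≤ c) {x : Space d} (hx : x ∈ convexHull ℝ (F : Set (Space d)))
    (hxc : inner ℝ n x = c) :
    x ∈ convexHull ℝ ((F.filter fun v => inner ℝ n v = c : Finset (Space d)) : Set (Space d)) := by
  obtain ⟨w, hw⟩ := exists_isBarycentric hx
  have hsum : ∑ v ∈ F, w v * (c - inner ℝ n v) = 0 := by
    have : inner ℝ n x = ∑ v ∈ F, w v * inner ℝ n v := by
      rw [← hw.2.2.2, inner_sum]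
      exact Finset.sum_congr rfl fun v _ => real_inner_smul_right _ _ _
    simp only [mul_sub, Finset.sum_sub_distrib, ← Finset.sum_mul, hw.2.2.1, ← this, hxc]
    ring
  have hz := (Finset.sum_eq_zero_iff_of_nonneg fun v hv =>
    mul_nonneg (hw.1 v hv) (sub_nonneg.2 (hF v hv))).1 hsum
  have hz' : ∀ v ∈ F, v ∉ F.filter (fun v => inner ℝ n v = c) → w v = 0 := by
    intro v hv hv'
    rcases mul_eq_zero.1 (hz v hv) with h | h
    · exact h
    · exact absurd (Finset.mem_filter.2 ⟨hv, by linarith⟩) hv'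
  refine Finset.mem_convexHull'.2 ⟨w, fun v hv => hw.1 v (Finset.mem_of_mem_filter v hv), ?_, ?_⟩
  · rw [← hw.2.2.1]
    exact Finset.sum_subset (Finset.filter_subset _ _) hz'
  · rw [← hw.2.2.2]
    exact Finset.sum_subset (Finset.filter_subset _ _) fun v hv hv' => by
      rw [hz' v hv hv', zero_smul]

/-- `P` is the face of `closure Ω` with outer normal `n`. -/
structure IsPatch (Ω : Set (Space d)) (n : Space d) (c : ℝ) (P : Set (Space d)) : Prop where
  ne_zero : n ≠ 0
  le : ∀ x ∈ closure Ω, inner ℝ n x ≤ c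
  eq : P = closure Ω ∩ {x | inner ℝ n x = c}

/-- A face is the convex hull of the generating points on its supporting hyperplane, so there are at
most as many faces as subsets of the generating set. -/
theorem finite_patches (hΩ : IsConvexPolytopeDomain Ω) :
    {P : Set (Space d) | ∃ n c, IsPatch Ω n c P}.Finite := by
  classical
  obtain ⟨V, hV⟩ := hΩ.polytope
  refine ((V.powerset.finite_toSet).image
    fun F : Finset (Space d) => convexHull ℝ (F : Set (Space d))).subset ?_
  rintro P ⟨n, c, hP⟩
  refine ⟨V.filter fun v => inner ℝ n v = c,
    Finset.mem_coe.2 (Finset.mem_powerset.2 (Finset.filter_subset _ _)), ?_⟩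
  have hle : ∀ v ∈ V, inner ℝ n v ≤ c := fun v hv =>
    hP.le v (hV ▸ subset_convexHull ℝ _ hv)
  rw [hP.eq, hV]
  refine Subset.antisymm (fun x hx => ⟨?_, ?_⟩) fun x hx => mem_convexHull_filter hle hx.1 hx.2
  · exact convexHull_mono (by exact_mod_cast Finset.filter_subset _ _) hx
  · have hcv : Convex ℝ {x : Space d | inner ℝ n x = c} :=
      convex_hyperplane (f := fun x => inner ℝ n x) ⟨fun x y => inner_add_right _ _ _,
        fun a x => real_inner_smul_right _ _ _⟩ c
    exact convexHull_min (fun v hv => (Finset.mem_filter.1 hv).2) hcv hx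

theorem IsConvexPolytopeDomain.isCompact_closure (hΩ : IsConvexPolytopeDomain Ω) :
    IsCompact (closure Ω) := by
  obtain ⟨V, hV⟩ := hΩ.polytope
  rw [hV]
  exact isCompact_convexHull_finset V

namespace IsPatch

variable {n : Space d} {c : ℝ} {P : Set (Space d)}

theorem lt (hP : IsPatch Ω n c P) (hΩ : IsConvexPolytopeDomain Ω) {x : Space d} (hx : x ∈ Ω) :
    inner ℝ n x < c := by
  obtain ⟨ε, hε, hb⟩ := Metric.isOpen_iff.1 hΩ.isOpen x hx
  have hn : 0 < ‖n‖ := norm_pos_iff.2 hP.ne_zero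
  have hmem : x + (ε / 2 / ‖n‖) • n ∈ Ω := hb (by
    rw [Metric.mem_ball, dist_eq_norm, add_sub_cancel_left, norm_smul, Real.norm_eq_abs,
      abs_of_pos (by positivity), div_mul_cancel₀ _ hn.ne']
    linarith)
  have := hP.le _ (subset_closure hmem)
  rw [inner_add_right, real_inner_smul_right, real_inner_self_eq_norm_sq] at this
  have h2 : 0 < ε / 2 / ‖n‖ * ‖n‖ ^ 2 := by positivity
  linarith

theorem subset_closure (hP : IsPatch Ω n c P) : P ⊆ closure Ω := hP.eq ▸ inter_subset_left

theorem inner_eq (hP : IsPatch Ω n c P) {x : Space d} (hx : x ∈ P) : inner ℝ n x = c := by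
  rw [hP.eq] at hx; exact hx.2

theorem subset_frontier (hP : IsPatch Ω n c P) (hΩ : IsConvexPolytopeDomain Ω) :
    P ⊆ frontier Ω := fun x hx => by
  rw [frontier, hΩ.isOpen.interior_eq]
  exact ⟨hP.subset_closure hx, fun h => (hP.lt hΩ h).ne (hP.inner_eq hx)⟩

theorem convex (hP : IsPatch Ω n c P) (hΩ : IsConvexPolytopeDomain Ω) : Convex ℝ P := by
  rw [hP.eq]
  exact hΩ.convex.closure.inter (convex_hyperplane (f := fun x => inner ℝ n x)
    ⟨fun x y => inner_add_right _ _ _, fun a x => real_inner_smul_right _ _ _⟩ c)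

theorem isCompact (hP : IsPatch Ω n c P) (hΩ : IsConvexPolytopeDomain Ω) : IsCompact P := by
  rw [hP.eq]
  exact hΩ.isCompact_closure.inter_right (isClosed_eq (by fun_prop) continuous_const)

theorem finrank_orthogonal (hP : IsPatch Ω n c P) :
    Module.finrank ℝ (ℝ ∙ n)ᗮ = d - 1 := by
  have h1 := (ℝ ∙ n).finrank_add_finrank_orthogonal
  rw [finrank_span_singleton hP.ne_zero, finrank_euclideanSpace_fin] at h1
  omega

theorem sub_mem (hP : IsPatch Ω n c P) {x y : Space d} (hx : x ∈ P) (hy : y ∈ P) :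
    x - y ∈ (ℝ ∙ n)ᗮ := by
  rw [Submodule.mem_orthogonal_singleton_iff_inner_right, inner_sub_right, hP.inner_eq hx,
    hP.inner_eq hy, sub_self]

end IsPatch

/-- Patches have Euclidean growth, with a constant that depends on the dimension only. -/
theorem exists_patch_growth (d : ℕ) : ∃ C : ENNReal, C ≠ ⊤ ∧
    ∀ {Ω : Set (Space d)} {n : Space d} {c : ℝ} {P : Set (Space d)}, IsPatch Ω n c P →
      ∀ (y : Space d) (r : ℝ), 0 < r →
      (μHE[d - 1] : Measure (Space d)) (P ∩ Metric.closedBall y r) ≤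
        C * ENNReal.ofReal (r ^ ((d - 1 : ℕ) : ℝ)) := by
  obtain ⟨C, hC, h⟩ := exists_flat_growth (d := d) (d - 1)
  refine ⟨C, hC, fun {Ω n c P} hP y r hr => ?_⟩
  rcases P.eq_empty_or_nonempty with rfl | ⟨p, hp⟩
  · simp
  · exact (measure_mono (inter_subset_inter_left _ fun x hx => hP.sub_mem hx hp)).trans
      (h (ℝ ∙ n)ᗮ p hP.finrank_orthogonal y r hr)

theorem IsPatch.measure_ne_top {n : Space d} {c : ℝ} {P : Set (Space d)} (hP : IsPatch Ω n c P)
    (hΩ : IsConvexPolytopeDomain Ω) : (μHE[d - 1] : Measure (Space d)) P ≠ ⊤ := by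
  obtain ⟨C, hC, h⟩ := exists_patch_growth d
  obtain ⟨R, hR, hb⟩ := (hP.isCompact hΩ).isBounded.subset_closedBall_lt 0 0
  refine ne_top_of_le_ne_top (ENNReal.mul_ne_top hC ENNReal.ofReal_ne_top)
    ((measure_mono ?_).trans (h hP 0 R hR))
  exact subset_inter subset_rfl hb

/-- Convex subsets of the boundary lie in a patch. -/
theorem exists_patch_of_convex (hΩ : IsConvexPolytopeDomain Ω) {A : Set (Space d)}
    (hA : Convex ℝ A) (hAn : A.Nonempty) (hAf : A ⊆ frontier Ω) :
    ∃ n c P, IsPatch Ω n c P ∧ A ⊆ P := by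
  obtain ⟨a, ha⟩ := hAn
  have hdisj : Disjoint Ω A := Set.disjoint_left.2 fun x hx hx' => by
    have := hAf hx'
    rw [frontier, hΩ.isOpen.interior_eq] at this
    exact this.2 hx
  -- A hyperplane separating the open set `Ω` from `A` must contain `A`, because `A` lies in the
  -- closure of `Ω`; so it is a supporting hyperplane.
  obtain ⟨f, u, hf1, hf2⟩ := geometric_hahn_banach_open hΩ.convex hΩ.isOpen hA hdisj
  set n := (InnerProductSpace.toDual ℝ (Space d)).symm f with hn
  have hfn : ∀ x, inner ℝ n x = f x := fun x => by
    rw [hn, InnerProductSpace.toDual_symm_apply]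
  have hle : ∀ x ∈ closure Ω, inner ℝ n x ≤ u := by
    refine fun x hx => closure_minimal (t := {x | inner ℝ n x ≤ u}) (fun y hy => ?_)
      (isClosed_le (by fun_prop) continuous_const) hx
    rw [Set.mem_ofPred_eq, hfn]; exact (hf1 y hy).le
  refine ⟨n, u, _, ⟨?_, hle, rfl⟩, fun x hx => ⟨frontier_subset_closure (hAf hx), ?_⟩⟩
  · intro h0
    obtain ⟨x, hx⟩ := hΩ.nonempty
    have h1 := hf1 x hx
    have h2 := hf2 a ha
    rw [← hfn, h0, inner_zero_left] at h1 h2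
    linarith
  · refine le_antisymm (hle x (frontier_subset_closure (hAf hx))) ?_
    rw [hfn]; exact hf2 x hx

theorem frontier_subset_patches (hΩ : IsConvexPolytopeDomain Ω) :
    frontier Ω ⊆ ⋃ P ∈ (finite_patches hΩ).toFinset, P := by
  intro x hx
  obtain ⟨n, c, P, hP, hxP⟩ := exists_patch_of_convex hΩ (convex_singleton x)
    (singleton_nonempty x) (singleton_subset_iff.2 hx)
  exact mem_biUnion ((finite_patches hΩ).mem_toFinset.2 ⟨n, c, hP⟩) (hxP rfl)

theorem exists_frontier_growth (hΩ : IsConvexPolytopeDomain Ω) :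
    (μHE[d - 1] : Measure (Space d)) (frontier Ω) ≠ ⊤ ∧ ∃ C : ENNReal, C ≠ ⊤ ∧
      ∀ (y : Space d) (r : ℝ), 0 < r →
        (μHE[d - 1] : Measure (Space d)).restrict (frontier Ω) (Metric.closedBall y r) ≤
          C * ENNReal.ofReal (r ^ ((d - 1 : ℕ) : ℝ)) := by
  obtain ⟨C, hC, h⟩ := exists_patch_growth d
  set Pf := (finite_patches hΩ).toFinset with hPf
  have hPf' : ∀ P ∈ Pf, ∃ n c, IsPatch Ω n c P := fun P hP => (finite_patches hΩ).mem_toFinset.1 hP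
  constructor
  · refine ne_top_of_le_ne_top ?_ ((measure_mono (frontier_subset_patches hΩ)).trans
      (measure_biUnion_finset_le Pf _))
    refine ENNReal.sum_ne_top.2 fun P hP => ?_
    obtain ⟨n, c, hP⟩ := hPf' P hP
    exact hP.measure_ne_top hΩ
  · refine ⟨Pf.card * C, ENNReal.mul_ne_top (by simp) hC, fun y r hr => ?_⟩
    rw [Measure.restrict_apply Metric.isClosed_closedBall.measurableSet]
    calc _ ≤ (μHE[d - 1] : Measure (Space d)) (⋃ P ∈ Pf, (P ∩ Metric.closedBall y r)) := by
          refine measure_mono fun x hx => ?_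
          obtain ⟨P, hP, hxP⟩ := mem_iUnion₂.1 (frontier_subset_patches hΩ hx.2)
          exact mem_biUnion (Finset.mem_coe.2 hP) ⟨hxP, hx.1⟩
      _ ≤ ∑ P ∈ Pf, (μHE[d - 1] : Measure (Space d)) (P ∩ Metric.closedBall y r) :=
          measure_biUnion_finset_le Pf _
      _ ≤ ∑ P ∈ Pf, C * ENNReal.ofReal (r ^ ((d - 1 : ℕ) : ℝ)) := Finset.sum_le_sum fun P hP => by
          obtain ⟨n, c, hP⟩ := hPf' P hP
          exact h hP y r hr
      _ = _ := by rw [Finset.sum_const, nsmul_eq_mul, mul_assoc]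

namespace IsPatch

variable {n : Space d} {c : ℝ} {P : Set (Space d)}

/-- Near a relative interior point of a patch, the boundary is contained in the patch. -/
theorem exists_ball_subset (hP : IsPatch Ω n c P) (hΩ : IsConvexPolytopeDomain Ω) {p : Space d}
    (hp : p ∈ relInt (ℝ ∙ n)ᗮ P) : ∃ r, 0 < r ∧ r ≤ 1 ∧ Metric.ball p r ∩ frontier Ω ⊆ P := by
  obtain ⟨hpP, δ, hδ, hb⟩ := hp
  obtain ⟨x₀, hx₀⟩ := hΩ.nonempty
  have hx₀c := hP.lt hΩ hx₀
  have hpc := hP.inner_eq hpP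
  -- Central projection from the interior point `x₀` onto the supporting hyperplane. It fixes `p`
  -- and is continuous there, so points near `p` are projected into `P`. A nearby boundary point off
  -- the hyperplane would lie strictly between `x₀` and its projection, hence in the interior of
  -- `Ω`.
  set σ : Space d → ℝ := fun x => (c - inner ℝ n x) / (inner ℝ n x - inner ℝ n x₀) with hσ
  have hcont : ContinuousAt (fun x : Space d => x + σ x • (x - x₀)) p := by
    have h1 : ContinuousAt σ p := by
      refine ContinuousAt.div (by fun_prop) (by fun_prop) ?_
      rw [hpc]; linarith
    exact continuousAt_id.add (h1.smul (continuousAt_id.sub continuousAt_const))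
  have hp0 : p + σ p • (p - x₀) = p := by simp [hσ, hpc]
  have hin : ContinuousAt (fun x : Space d => (inner ℝ n x : ℝ)) p := by fun_prop
  have e1 := hcont.eventually_mem (Metric.ball_mem_nhds _ hδ)
  rw [hp0] at e1
  have e2 : ∀ᶠ x in 𝓝 p, inner ℝ n x₀ < inner ℝ n x :=
    hin.eventually_const_lt (by simpa only [hpc] using hx₀c)
  obtain ⟨r, hr, hball⟩ := Metric.eventually_nhds_iff_ball.1 (e1.and e2)
  refine ⟨min r 1, lt_min hr one_pos, min_le_right _ _, fun x hx => ?_⟩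
  obtain ⟨h1, h2⟩ := hball x (Metric.ball_subset_ball (min_le_left _ _) hx.1)
  have hxc := hP.le x (frontier_subset_closure hx.2)
  rcases hxc.eq_or_lt with h | h
  · rw [hP.eq]; exact ⟨frontier_subset_closure hx.2, h⟩
  exfalso
  have hσ0 : 0 < σ x := div_pos (by linarith) (by linarith)
  set q := x + σ x • (x - x₀) with hq
  have hqc : inner ℝ n q = c := by
    rw [hq, inner_add_right, real_inner_smul_right, inner_sub_right, hσ]
    have : inner ℝ n x - inner ℝ n x₀ ≠ 0 := by linarith
    field_simp
    ring
  have hqP : q ∈ P := by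
    have := hb (q - p) (by
      rw [Submodule.mem_orthogonal_singleton_iff_inner_right, inner_sub_right, hqc, hpc, sub_self])
      (by rw [← dist_eq_norm]; exact h1)
    simpa using this
  have hxo : x ∈ openSegment ℝ x₀ q := by
    refine ⟨σ x / (1 + σ x), 1 / (1 + σ x), by positivity, by positivity, by field_simp; ring, ?_⟩
    rw [hq]
    have : (1 : ℝ) + σ x ≠ 0 := by positivity
    have e : x = (1 / (1 + σ x)) • ((1 + σ x) • x) := by
      rw [smul_smul, one_div_mul_cancel this, one_smul]
    conv_rhs => rw [e]
    rw [add_smul, one_smul]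
    simp only [smul_add, smul_sub, smul_smul]
    rw [show σ x / (1 + σ x) = 1 / (1 + σ x) * σ x by ring]
    abel
  have := hΩ.convex.openSegment_interior_closure_subset_interior
    (hΩ.isOpen.interior_eq.symm ▸ hx₀) (hP.subset_closure hqP) hxo
  exact hx.2.2 this

/-- The patch that contains a nondegenerate boundary simplex is full-dimensional. -/
theorem relInt_nonempty (hd : 0 < d) (hP : IsPatch Ω n c P) {M : Mesh Ω} {s : Finset (Space d)}
    (hs : s ∈ M.bdryCells) {r : ℝ} (hr : 0 < r) (hball : ContainsBall s r)
    (hsP : convexHull ℝ (s : Set (Space d)) ⊆ P) : (relInt (ℝ ∙ n)ᗮ P).Nonempty := by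
  have hle : vectorSpan ℝ (s : Set (Space d)) ≤ (ℝ ∙ n)ᗮ := by
    refine Submodule.span_le.2 ?_
    rintro _ ⟨x, hx, y, hy, rfl⟩
    exact hP.sub_mem (hsP (subset_convexHull ℝ _ hx)) (hsP (subset_convexHull ℝ _ hy))
  -- Both spaces have dimension `d - 1`, so the ball inscribed in the simplex is a relative ball of
  -- the patch.
  have heq := Submodule.eq_of_le_of_finrank_eq hle (by
    rw [(M.isFamily_bdryCells hd).finrank_eq hs, hP.finrank_orthogonal])
  obtain ⟨p, hp, hb⟩ := hball
  refine ⟨p, hsP (hb ⟨Metric.mem_ball_self hr, hp⟩), r, hr, fun w hw hwr => hsP (hb ⟨?_, ?_⟩)⟩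
  · simpa using hwr
  · rw [← heq, ← direction_affineSpan] at hw
    have := AffineSubspace.vadd_mem_of_mem_direction hw hp
    rwa [vadd_eq_add, add_comm] at this

open Classical in
/-- A full-dimensional patch is covered by the boundary simplices that it contains. -/
theorem polyhedron_filter_eq (hd : 0 < d) (hΩ : IsConvexPolytopeDomain Ω) (hP : IsPatch Ω n c P)
    (hrel : (relInt (ℝ ∙ n)ᗮ P).Nonempty) (M : Mesh Ω) :
    polyhedron (M.bdryCells.filter
      fun s : Finset (Space d) => convexHull ℝ (s : Set (Space d)) ⊆ P) = P := by
  set T := M.bdryCells.filter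
    fun s : Finset (Space d) => convexHull ℝ (s : Set (Space d)) ⊆ P with hT
  refine Subset.antisymm (iUnion₂_subset fun s hs => (Finset.mem_filter.1 hs).2) fun x hx => ?_
  by_contra hxT
  obtain ⟨y, hyP, δ, hδ, hb⟩ := hrel
  have hopen : IsOpen (polyhedron T)ᶜ := (isCompact_polyhedron T).isClosed.isOpen_compl
  have hcont : Continuous fun t : ℝ => x + t • (y - x) := by fun_prop
  -- An uncovered point `x` is moved slightly towards a relative interior point `y`. The new point
  -- is still uncovered and is itself a relative interior point, so `P` has positive measure in each
  -- of its neighbourhoods.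
  have hev : ∀ᶠ t in 𝓝[>] (0 : ℝ), x + t • (y - x) ∈ (polyhedron T)ᶜ ∧ t ∈ Ioo (0 : ℝ) 1 := by
    refine Filter.Eventually.and ?_ (Ioo_mem_nhdsGT one_pos)
    exact nhdsWithin_le_nhds ((hcont.tendsto 0).eventually_mem
      (hopen.mem_nhds (by simpa using hxT)))
  obtain ⟨t, hzT, ht0, ht1⟩ := hev.exists
  set z := x + t • (y - x) with hz
  have hzrel : z ∈ relInt (ℝ ∙ n)ᗮ P := by
    have key : ∀ w ∈ (ℝ ∙ n)ᗮ, ‖w‖ < t * δ → z + w ∈ P := by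
      intro w hw hwt
      have h1 := hb (t⁻¹ • w) (Submodule.smul_mem _ _ hw) (by
        rw [norm_smul, Real.norm_eq_abs, abs_of_pos (by positivity), inv_mul_lt_iff₀ ht0]
        exact hwt)
      have h2 := hP.convex hΩ hx h1 (by linarith : 0 ≤ 1 - t) ht0.le (by ring)
      have e : (1 - t) • x + t • (y + t⁻¹ • w) = z + w := by
        rw [hz, smul_add, smul_inv_smul₀ ht0.ne', sub_smul, one_smul, smul_sub]
        abel
      rwa [e] at h2
    refine ⟨?_, t * δ, by positivity, key⟩
    simpa using key 0 (Submodule.zero_mem _) (by simpa using mul_pos ht0 hδ)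
  obtain ⟨ε, hε, hbε⟩ := Metric.isOpen_iff.1 hopen z hzT
  have hpos := measure_pos_of_relInt hP.finrank_orthogonal hzrel hε
  -- This neighbourhood would be covered by boundary simplices not contained in `P`. Each of them
  -- meets `P` only in the hull of its vertices on the supporting hyperplane; these are at most `d -
  -- 1` points, so the intersection is a null set.
  refine hpos.ne' (measure_mono_null (t := ⋃ s ∈ M.bdryCells.filter
    (fun s : Finset (Space d) => ¬ convexHull ℝ (s : Set (Space d)) ⊆ P), convexHull ℝ
      ((s.filter fun v => inner ℝ n v = c : Finset (Space d)) : Set (Space d))) ?_ ?_)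
  · rintro q ⟨hqP, hqε⟩
    have hqf : q ∈ polyhedron M.bdryCells := by
      rw [M.polyhedron_bdryCells]; exact hP.subset_frontier hΩ hqP
    obtain ⟨s, hs, hqs⟩ := mem_iUnion₂.1 hqf
    have hsP : ¬ convexHull ℝ (s : Set (Space d)) ⊆ P := fun h =>
      hbε hqε (convexHull_subset_polyhedron (Finset.mem_filter.2 ⟨hs, h⟩) hqs)
    refine mem_biUnion (Finset.mem_coe.2 (Finset.mem_filter.2 ⟨hs, hsP⟩)) ?_
    exact mem_convexHull_filter (fun v hv => hP.le v (frontier_subset_closure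
      (M.bdryCell_subset hs (subset_convexHull ℝ _ hv)))) hqs (hP.inner_eq hqP)
  · refine (measure_biUnion_null_iff (Finset.countable_toSet _)).2 fun s hs => ?_
    obtain ⟨hs, hsP⟩ := Finset.mem_filter.1 (Finset.mem_coe.1 hs)
    refine measure_convexHull_eq_zero ?_
    have hcard := (M.isFamily_bdryCells hd).card_eq s hs
    have hlt : (s.filter fun v => inner ℝ n v = c).card < s.card := by
      refine Finset.card_lt_card ((Finset.filter_subset _ _).ssubset_of_ne fun h => hsP ?_)
      refine (hP.convex hΩ).convexHull_subset_iff.2 fun v hv => ?_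
      rw [hP.eq]
      exact ⟨frontier_subset_closure (M.bdryCell_subset hs (subset_convexHull ℝ _ hv)),
        Finset.filter_eq_self.1 h v hv⟩
    omega

end IsPatch

/-- A Poincaré-type inequality on `Γ`, in which finitely many lumped moments replace the mean. -/
theorem exists_bdry_poincare (hd : d = 2 ∨ d = 3) (hΩ : IsConvexPolytopeDomain Ω) :
    ∃ c h₀ : ℝ, 0 ≤ c ∧ 0 < h₀ ∧ ∀ (M : Mesh Ω) (h ρ : ℝ), 0 < h → h ≤ h₀ → 0 < ρ →
      M.IsAdmissible h ρ → ∀ u, IsPL M.bdryCells u → ∀ Q,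
      (∀ p r, 0 < r → r ≤ 1 → |lumped M (d - 1) M.bdryCells fun x => u x * bump p r x| ≤ Q) →
      ∫ x in frontier Ω, u x ^ 2 ∂μHE[d - 1] ≤
        c * (Q ^ 2 + energyForm (d - 1) M.bdryCells u u) := by
  classical
  have hd0 : 0 < d := by omega
  obtain ⟨C, hC, hgrowth⟩ := exists_patch_growth d
  -- Only full-dimensional faces have a relative interior point at which to place a bump. They
  -- suffice: the inscribed ball of a boundary simplex forces the face containing it to be
  -- full-dimensional.
  set Pf := (finite_patches hΩ).toFinset.filter
    (fun P => ∃ n c, IsPatch Ω n c P ∧ (relInt (ℝ ∙ n)ᗮ P).Nonempty) with hPf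
  have hloc : ∀ P ∈ Pf, ∃ c h₀ : ℝ, 0 ≤ c ∧ 0 < h₀ ∧ ∀ (M : Mesh Ω) (h ρ : ℝ), 0 < h → h ≤ h₀ →
      0 < ρ → M.IsAdmissible h ρ → ∀ u, IsPL M.bdryCells u → ∀ Q,
      (∀ p r, 0 < r → r ≤ 1 → |lumped M (d - 1) M.bdryCells fun x => u x * bump p r x| ≤ Q) →
      ∫ x in P, u x ^ 2 ∂μHE[d - 1] ≤ c * (Q ^ 2 + energyForm (d - 1) M.bdryCells u u) := by
    intro P hP
    obtain ⟨n, c, hP, hrel⟩ := (Finset.mem_filter.1 hP).2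
    obtain ⟨p, hp⟩ := hrel
    obtain ⟨r, hr, hr1, hball⟩ := hP.exists_ball_subset hΩ hp
    obtain ⟨b, hb, hmain⟩ := exists_local_poincare (Ω := Ω) (k := d - 1) (by omega) (by omega)
      (hP.isCompact hΩ) (hP.convex hΩ) (hP.measure_ne_top hΩ) hC (fun y r hr => by
        rw [Measure.restrict_apply Metric.isClosed_closedBall.measurableSet, inter_comm]
        exact hgrowth hP y r hr) hr
      (fun ε hε => measure_pos_of_relInt hP.finrank_orthogonal hp hε)
    refine ⟨b, r / 4, hb, by positivity, fun M h ρ hh hhr hρ hM u hu Q hQ => ?_⟩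
    have hT := hP.polyhedron_filter_eq hd0 hΩ ⟨p, hp⟩ M
    refine (hmain M M.bdryCells _ h (M.isFamily_bdryCells hd0) hhr hM.bdry_diam_le
      (Finset.filter_subset _ _) hT (fun s hs hsP => Finset.mem_filter.2 ⟨hs, hsP⟩)
      (by rw [M.polyhedron_bdryCells]; exact hball) u hu Q (hQ p r hr hr1)).trans ?_
    gcongr
    rw [energyForm_self, energyForm_self]
    exact Finset.sum_le_sum_of_subset_of_nonneg (Finset.filter_subset _ _)
      fun s _ _ => by positivity
  choose! b h₀ hb hh₀ hmain using hloc
  obtain ⟨h₁, hh₁, hh₁0⟩ : ∃ h₁ : ℝ, (∀ P ∈ Pf, h₁ ≤ h₀ P) ∧ 0 < h₁ := by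
    have h1 : ∀ᶠ t in 𝓝[>] (0 : ℝ), ∀ P ∈ Pf, t ≤ h₀ P :=
      (Filter.eventually_all_finset Pf).2 fun P hP =>
        nhdsWithin_le_nhds (eventually_le_nhds (hh₀ P hP))
    exact (h1.and self_mem_nhdsWithin).exists
  refine ⟨∑ P ∈ Pf, b P, h₁, Finset.sum_nonneg hb, hh₁0, fun M h ρ hh hhr hρ hM u hu Q hQ => ?_⟩
  have hS := M.isFamily_bdryCells hd0
  have hcell : ∀ s ∈ M.bdryCells, ∃ P ∈ Pf, convexHull ℝ (s : Set (Space d)) ⊆ P := by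
    intro s hs
    have hne : (convexHull ℝ (s : Set (Space d))).Nonempty := by
      rw [convexHull_nonempty_iff]
      exact Finset.coe_nonempty.2 (Finset.card_pos.1 (by have := hS.card_eq s hs; omega))
    obtain ⟨n, c, P, hP, hsP⟩ := exists_patch_of_convex hΩ (convex_convexHull ℝ _) hne
      (M.bdryCell_subset hs)
    refine ⟨P, Finset.mem_filter.2 ⟨(finite_patches hΩ).mem_toFinset.2 ⟨n, c, hP⟩, n, c, hP,
      hP.relInt_nonempty hd0 hs (mul_pos hρ hh) (hM.bdry_ball s hs) hsP⟩, hsP⟩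
  have hu2 : ContinuousOn (fun x => u x ^ 2) (polyhedron M.bdryCells) := hu.continuousOn.pow 2
  calc ∫ x in frontier Ω, u x ^ 2 ∂μHE[d - 1]
      = ∑ s ∈ M.bdryCells, ∫ x in convexHull ℝ (s : Set (Space d)), u x ^ 2 ∂μHE[d - 1] := by
        rw [← M.polyhedron_bdryCells, hS.integral_polyhedron_of_continuousOn hu2]
    -- Every boundary simplex is contained in at least one face of `Pf`; multiple counting does no
    -- harm to an upper bound.
    _ ≤ ∑ s ∈ M.bdryCells, ∑ P ∈ Pf, if convexHull ℝ (s : Set (Space d)) ⊆ P then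
          ∫ x in convexHull ℝ (s : Set (Space d)), u x ^ 2 ∂μHE[d - 1] else 0 := by
        refine Finset.sum_le_sum fun s hs => ?_
        obtain ⟨P, hP, hsP⟩ := hcell s hs
        have := Finset.single_le_sum (f := fun P => if convexHull ℝ (s : Set (Space d)) ⊆ P then
          ∫ x in convexHull ℝ (s : Set (Space d)), u x ^ 2 ∂μHE[d - 1] else 0)
          (fun P _ => by
            split_ifs
            · exact integral_nonneg fun x => sq_nonneg _
            · exact le_rfl) hP
        simpa only [if_pos hsP] using this
    _ = ∑ P ∈ Pf, ∫ x in P, u x ^ 2 ∂μHE[d - 1] := by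
        rw [Finset.sum_comm]
        refine Finset.sum_congr rfl fun P hP => ?_
        obtain ⟨n, c, hP, hrel⟩ := (Finset.mem_filter.1 hP).2
        have hT := hP.polyhedron_filter_eq hd0 hΩ hrel M
        rw [← Finset.sum_filter]
        conv_rhs => rw [← hT]
        rw [(hS.mono (Finset.filter_subset _ _)).integral_polyhedron_of_continuousOn]
        exact hu2.mono (biUnion_subset_biUnion_left (Finset.filter_subset _ _))
    _ ≤ ∑ P ∈ Pf, b P * (Q ^ 2 + energyForm (d - 1) M.bdryCells u u) :=
        Finset.sum_le_sum fun P hP =>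
          hmain P hP M h ρ hh (hhr.trans (hh₁ P hP)) hρ hM u hu Q hQ
    _ = _ := by rw [Finset.sum_mul]

/-! ### Uniform L² and L³ bounds in the bulk and on the boundary -/

namespace IsConvexPolytopeDomain

theorem measure_closure_ne_top (hΩ : IsConvexPolytopeDomain Ω) :
    (μHE[d] : Measure (Space d)) (closure Ω) ≠ ⊤ := by
  rw [← volume_eq]; exact hΩ.isCompact_closure.measure_ne_top

theorem measure_closure_ne_zero (hΩ : IsConvexPolytopeDomain Ω) :
    (μHE[d] : Measure (Space d)) (closure Ω) ≠ 0 := by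
  rw [← volume_eq]
  exact ((hΩ.isOpen.measure_pos volume hΩ.nonempty).trans_le (measure_mono subset_closure)).ne'

end IsConvexPolytopeDomain

theorem exists_closure_growth (Ω : Set (Space d)) : ∃ C : ENNReal, C ≠ ⊤ ∧
    ∀ (y : Space d) (r : ℝ), 0 < r →
      (μHE[d] : Measure (Space d)).restrict (closure Ω) (Metric.closedBall y r) ≤
        C * ENNReal.ofReal (r ^ (d : ℝ)) := by
  refine ⟨volume (Metric.ball (0 : Space d) 1), measure_ball_lt_top.ne, fun y r hr => ?_⟩
  refine (Measure.restrict_apply_le _ _).trans ?_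
  rw [← volume_eq, Measure.addHaar_closedBall _ _ hr.le, finrank_euclideanSpace_fin,
    Real.rpow_natCast, mul_comm]

/-- A piecewise linear function is controlled in `L³(ν)` by its mean and its Dirichlet energy. -/
theorem exists_cube_bound (hd : d = 2 ∨ d = 3) (hΩ : IsConvexPolytopeDomain Ω)
    {ν : Measure (Space d)} [IsFiniteMeasure ν] (hν : ν (closure Ω)ᶜ = 0) {m : ℝ}
    (hm : ((d : ℝ) - 1) * (7 / 8) < m) {C' : ENNReal} (hC' : C' ≠ ⊤)
    (hgrowth : ∀ (y : Space d) (r : ℝ), 0 < r →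
      ν (Metric.closedBall y r) ≤ C' * ENNReal.ofReal (r ^ m)) (A : ℝ) :
    ∃ B : ℝ, ∀ (M : Mesh Ω) (u : Space d → ℝ), IsPL M.cells u →
      |∫ x in Ω, u x| ≤ A → energyForm d M.cells u u ≤ A → ∫ x, |u x| ^ 3 ∂ν ≤ B := by
  obtain ⟨C, hC, hg⟩ := exists_closure_growth Ω
  obtain ⟨c, hc, hsob⟩ := exists_sobolev_poincare (by omega) (by omega) hΩ.isCompact_closure
    hΩ.convex.closure hΩ.measure_closure_ne_top hΩ.measure_closure_ne_zero hC hg hν hm hC' hgrowth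
  set V := (μHE[d] : Measure (Space d)).real (closure Ω) with hV
  refine ⟨4 * (c * A ^ (3 / 2 : ℝ)) + 4 * (V⁻¹ * A) ^ 3 * ν.real univ, fun M u hu huA hEA => ?_⟩
  have hucont : ContinuousOn u (closure Ω) := by rw [← M.polyhedron_cells]; exact hu.continuousOn
  set a := ⨍ y in closure Ω, u y ∂μHE[d] with ha
  have hcube := hsob u hucont M.cells (fun s => convexHull ℝ (s : Set (Space d)))
    (fun s => ‖slope s u‖) (fun _ _ => norm_nonneg _) M.polyhedron_cells.ge
    (fun s _ => (isCompact_convexHull_finset s).isClosed) (fun s _ => convex_convexHull ℝ _)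
    (fun s hs => M.polyhedron_cells ▸ convexHull_subset_polyhedron hs)
    (fun s hs x hx y hy => abs_sub_le_slope (hu s hs) hx hy)
  rw [← energyForm_self, ← ha] at hcube
  have hA0 : 0 ≤ A := (abs_nonneg _).trans huA
  have hE : energyForm d M.cells u u ^ (3 / 2 : ℝ) ≤ A ^ (3 / 2 : ℝ) :=
    Real.rpow_le_rpow energyForm_self_nonneg hEA (by norm_num)
  have haA : |a| ≤ V⁻¹ * A := by
    rw [ha, setAverage_eq, smul_eq_mul, abs_mul, ← setIntegral_eq_closure hΩ, ← hV,
      abs_of_nonneg (inv_nonneg.2 measureReal_nonneg)]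
    exact mul_le_mul_of_nonneg_left huA (inv_nonneg.2 measureReal_nonneg)
  have hint : ∀ f : Space d → ℝ, ContinuousOn f (closure Ω) → Integrable f ν := fun f hf => by
    have hr : ν.restrict (closure Ω) = ν :=
      Measure.restrict_eq_self_of_ae_mem (by rwa [ae_iff])
    have := hf.integrableOn_compact (μ := ν) hΩ.isCompact_closure
    rwa [IntegrableOn, hr] at this
  have hi : Integrable (fun x => |u x - a| ^ 3) ν :=
    hint _ ((hucont.sub (continuousOn_const (c := a))).abs.pow 3)
  calc ∫ x, |u x| ^ 3 ∂ν ≤ ∫ x, (4 * |u x - a| ^ 3 + 4 * |a| ^ 3) ∂ν := by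
        refine integral_mono (hint _ (hucont.abs.pow 3))
          ((hi.const_mul 4).add (integrable_const _)) fun x => ?_
        have h1 : |u x| ≤ |u x - a| + |a| := by
          simpa using abs_add_le (u x - a) a
        have h2 : |u x| ^ 3 ≤ (|u x - a| + |a|) ^ 3 := by gcongr
        have h3 := abs_nonneg (u x - a)
        have h4 := abs_nonneg a
        show |u x| ^ 3 ≤ 4 * |u x - a| ^ 3 + 4 * |a| ^ 3
        nlinarith [mul_nonneg (add_nonneg h3 h4) (sq_nonneg (|u x - a| - |a|))]
    _ = 4 * ∫ x, |u x - a| ^ 3 ∂ν + 4 * |a| ^ 3 * ν.real univ := by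
        rw [integral_add (hi.const_mul 4) (integrable_const _), integral_const_mul, integral_const,
          smul_eq_mul, mul_comm (ν.real univ)]
    _ ≤ _ := by
        have h5 := hcube.trans (mul_le_mul_of_nonneg_left hE hc)
        gcongr

/-- Bulk and boundary norms of a piecewise linear function with bounded mean and energy. -/
theorem exists_norm_bounds (hd : d = 2 ∨ d = 3) (hΩ : IsConvexPolytopeDomain Ω) (A : ℝ) :
    ∃ B : ℝ, ∀ (M : Mesh Ω) (u : Space d → ℝ), IsPL M.cells u →
      |∫ x in Ω, u x| ≤ A → energyForm d M.cells u u ≤ A →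
      ∫ x in Ω, u x ^ 2 ≤ B ∧ bdryIntegral Ω (fun x => u x ^ 2) ≤ B ∧
      lumped M d M.cells (fun x => |u x| ^ 3) ≤ B ∧
      lumped M (d - 1) M.bdryCells (fun x => |u x| ^ 3) ≤ B := by
  have hd0 : 0 < d := by omega
  obtain ⟨C, hC, hg⟩ := exists_closure_growth Ω
  obtain ⟨hft, C', hC', hg'⟩ := exists_frontier_growth hΩ
  have h1 : IsFiniteMeasure ((μHE[d] : Measure (Space d)).restrict (closure Ω)) :=
    ⟨by rw [Measure.restrict_apply_univ]; exact hΩ.measure_closure_ne_top.lt_top⟩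
  have h2 : IsFiniteMeasure ((μHE[d - 1] : Measure (Space d)).restrict (frontier Ω)) :=
    ⟨by rw [Measure.restrict_apply_univ]; exact hft.lt_top⟩
  have hd1 : ((d - 1 : ℕ) : ℝ) = (d : ℝ) - 1 := by rw [Nat.cast_sub hd0, Nat.cast_one]
  have hd2 : (2 : ℝ) ≤ d := by exact_mod_cast (by omega : 2 ≤ d)
  obtain ⟨B₁, hB₁⟩ := exists_cube_bound hd hΩ
    (ν := (μHE[d] : Measure (Space d)).restrict (closure Ω))
    (by rw [Measure.restrict_apply isClosed_closure.measurableSet.compl]; simp)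
    (m := d) (by linarith) hC hg A
  -- The same inequality with surface measure as `ν` serves as a trace estimate: its growth exponent
  -- `d - 1` exceeds `(d - 1) * 7 / 8`. Bulk energy thus controls the boundary values even when `κ =
  -- 0`.
  obtain ⟨B₂, hB₂⟩ := exists_cube_bound hd hΩ
    (ν := (μHE[d - 1] : Measure (Space d)).restrict (frontier Ω))
    (by
      rw [Measure.restrict_apply isClosed_closure.measurableSet.compl,
        (disjoint_compl_left_iff_subset.2 frontier_subset_closure).inter_eq, measure_empty])
    (m := (d - 1 : ℕ)) (by rw [hd1]; linarith) hC' hg' A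
  set V := (μHE[d] : Measure (Space d)).real (closure Ω) with hV
  set V' := (μHE[d - 1] : Measure (Space d)).real (frontier Ω) with hV'
  refine ⟨max (max (V + B₁) (V' + B₂)) (max (4 ^ d * 2 ^ 3 * B₁) (4 ^ (d - 1) * 2 ^ 3 * B₂)),
    fun M u hu huA hEA => ?_⟩
  have hS := M.isFamily_cells
  have hS' := M.isFamily_bdryCells hd0
  have hu' := Mesh.isPL_bdryCells hu
  have b₁ := hB₁ M u hu huA hEA
  have b₂ := hB₂ M u hu huA hEA
  have key : ∀ {k : ℕ} {S : Finset (Finset (Space d))}, IsFamily M k S → IsPL S u → ∀ {b : ℝ},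
      ∫ x in polyhedron S, |u x| ^ 3 ∂μHE[k] ≤ b →
      ∫ x in polyhedron S, u x ^ 2 ∂μHE[k] ≤
        (μHE[k] : Measure (Space d)).real (polyhedron S) + b := by
    intro k S hS hu b hb
    have hf : IsFiniteMeasure ((μHE[k] : Measure (Space d)).restrict (polyhedron S)) :=
      ⟨by rw [Measure.restrict_apply_univ]; exact hS.measure_polyhedron_ne_top.lt_top⟩
    have h3 := hS.integrableOn_of_continuousOn (f := fun x => |u x| ^ 3) (hu.continuousOn.abs.pow 3)
    have h2 := hS.integrableOn_of_continuousOn (f := fun x => u x ^ 2) (hu.continuousOn.pow 2)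
    calc _ ≤ ∫ x in polyhedron S, (1 + |u x| ^ 3) ∂μHE[k] := by
          refine integral_mono h2 ((integrable_const _).add h3) fun x => ?_
          beta_reduce
          have h0 := abs_nonneg (u x)
          rw [← sq_abs]
          rcases le_total |u x| 1 with h | h
          · nlinarith [pow_nonneg h0 3]
          · nlinarith [mul_nonneg (sq_nonneg |u x|) (sub_nonneg.2 h)]
      _ = (μHE[k] : Measure (Space d)).real (polyhedron S) +
            ∫ x in polyhedron S, |u x| ^ 3 ∂μHE[k] := by
          rw [integral_add (integrable_const _) h3, setIntegral_const, smul_eq_mul, mul_one]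
      _ ≤ _ := by gcongr
  refine ⟨?_, ?_, ?_, ?_⟩
  · rw [setIntegral_eq_closure hΩ]
    have := key hS hu (b := B₁) (by rwa [M.polyhedron_cells])
    rw [M.polyhedron_cells] at this
    exact this.trans ((le_max_left _ _).trans (le_max_left _ _))
  · have := key hS' hu' (b := B₂) (by rwa [M.polyhedron_bdryCells])
    rw [M.polyhedron_bdryCells] at this
    exact this.trans ((le_max_right _ _).trans (le_max_left _ _))
  · have := hS.lumped_pow_le hu 3
    rw [M.polyhedron_cells] at this
    exact this.trans ((mul_le_mul_of_nonneg_left b₁ (by positivity)).trans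
      ((le_max_left _ _).trans (le_max_right _ _)))
  · have := hS'.lumped_pow_le hu' 3
    rw [M.polyhedron_bdryCells] at this
    exact this.trans ((mul_le_mul_of_nonneg_left b₂ (by positivity)).trans
      ((le_max_right _ _).trans (le_max_right _ _)))

/-- A Poincaré inequality in `Ω`, with the mean value replaced by a lumped integral against an
interior bump. -/
theorem exists_bulk_poincare (hd : d = 2 ∨ d = 3) (hΩ : IsConvexPolytopeDomain Ω) :
    ∃ c h₀ : ℝ, 0 ≤ c ∧ 0 < h₀ ∧ ∃ (p : Space d) (r : ℝ), 0 < r ∧ r ≤ 1 ∧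
      (∀ x ∈ frontier Ω, bump p r x = 0) ∧ ∀ (M : Mesh Ω) (h : ℝ), h ≤ h₀ →
      (∀ s ∈ M.cells, Metric.diam (convexHull ℝ (s : Set (Space d))) ≤ h) →
      ∀ u, IsPL M.cells u → ∀ Q, |lumped M d M.cells fun x => u x * bump p r x| ≤ Q →
      ∫ x in Ω, u x ^ 2 ≤ c * (Q ^ 2 + energyForm d M.cells u u) := by
  obtain ⟨p, hp⟩ := hΩ.nonempty
  obtain ⟨r₀, hr₀, hball₀⟩ := Metric.isOpen_iff.1 hΩ.isOpen p hp
  set r := min r₀ 1 with hr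
  have hr0 : 0 < r := lt_min hr₀ one_pos
  have hball : Metric.ball p r ⊆ Ω := (Metric.ball_subset_ball (min_le_left _ _)).trans hball₀
  obtain ⟨C, hC, hg⟩ := exists_closure_growth Ω
  obtain ⟨c, hc, hloc⟩ := exists_local_poincare (Ω := Ω) (k := d) (by omega) (by omega)
    hΩ.isCompact_closure hΩ.convex.closure hΩ.measure_closure_ne_top hC hg hr0
    (p := p) (fun ε hε => by
      rw [← volume_eq]
      exact ((hΩ.isOpen.inter Metric.isOpen_ball).measure_pos volume
        ⟨p, hp, Metric.mem_ball_self hε⟩).trans_le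
        (measure_mono (inter_subset_inter_left _ subset_closure)))
  refine ⟨c, r / 4, hc, by positivity, p, r, hr0, min_le_right _ _, fun x hx => bump_eq_zero ?_,
    fun M h hh hdiam u hu Q hQ => ?_⟩
  · by_contra! hlt
    have : x ∈ Ω := hball (by rw [Metric.mem_ball]; linarith)
    rw [frontier, hΩ.isOpen.interior_eq] at hx
    exact hx.2 this
  · rw [setIntegral_eq_closure hΩ]
    exact hloc M M.cells M.cells h M.isFamily_cells hh hdiam subset_rfl M.polyhedron_cells
      (fun s hs _ => hs) (by rw [M.polyhedron_cells]; exact inter_subset_right) u hu Q hQ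

/-! ### Growth and convex-concave splitting of the potentials -/

theorem Polynomial.exists_abs_eval_le (q : Polynomial ℝ) {n : ℕ} (hq : q.natDegree ≤ n) :
    ∃ C : ℝ, 0 ≤ C ∧ ∀ s : ℝ, |q.eval s| ≤ C * (1 + |s| ^ n) := by
  refine ⟨∑ i ∈ Finset.range (q.natDegree + 1), |q.coeff i|,
    Finset.sum_nonneg fun _ _ => abs_nonneg _, fun s => ?_⟩
  rw [Polynomial.eval_eq_sum_range, Finset.sum_mul]
  refine (Finset.abs_sum_le_sum_abs _ _).trans (Finset.sum_le_sum fun i hi => ?_)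
  rw [abs_mul, abs_pow]
  refine mul_le_mul_of_nonneg_left ?_ (abs_nonneg _)
  have hin : i ≤ n := (Nat.lt_succ_iff.1 (Finset.mem_range.1 hi)).trans hq
  have h0 := abs_nonneg s
  rcases le_total |s| 1 with h | h
  · exact (pow_le_one₀ h0 h).trans (le_add_of_nonneg_right (by positivity))
  · exact (pow_le_pow_right₀ h hin).trans (le_add_of_nonneg_left zero_le_one)

/-- Cubic growth matches the L³ bounds on the phase field: it is what bounds the nonlinear terms
when they are tested with a bounded function. -/
theorem IsQuarticPlusLipschitz.exists_abs_deriv_le {f : ℝ → ℝ} (hf : IsQuarticPlusLipschitz f) :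
    ∃ C : ℝ, 0 ≤ C ∧ ∀ s, |deriv f s| ≤ C * (1 + |s| ^ 3) := by
  obtain ⟨p, g, hp, hg, ⟨L, hL⟩, hfe⟩ := hf
  obtain ⟨C, hC, hpC⟩ := Polynomial.exists_abs_eval_le p.derivative (n := 3)
    ((Polynomial.natDegree_derivative_le p).trans (by omega))
  refine ⟨C + (|deriv g 0| + 2 * L), by positivity, fun s => ?_⟩
  have hfe' : f = fun s => p.eval s + g s := funext hfe
  have hd : deriv f s = p.derivative.eval s + deriv g s := by
    rw [hfe', deriv_fun_add p.differentiable.differentiableAt (hg s), Polynomial.deriv]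
  have hgs : |deriv g s| ≤ |deriv g 0| + L * |s| := by
    have h1 := hL.dist_le_mul s 0
    rw [Real.dist_eq, Real.dist_eq, sub_zero] at h1
    have h2 := abs_add_le (deriv g s - deriv g 0) (deriv g 0)
    rw [sub_add_cancel] at h2
    linarith
  have hs : |s| ≤ 2 * (1 + |s| ^ 3) := by
    have h0 := abs_nonneg s
    rcases le_total |s| 1 with h | h
    · nlinarith [pow_nonneg h0 3]
    · nlinarith [mul_nonneg h0 (sub_nonneg.2 (one_le_pow₀ h : 1 ≤ |s| ^ 2))]
  rw [hd]
  refine (abs_add_le _ _).trans ?_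
  have h3 : (1 : ℝ) ≤ 1 + |s| ^ 3 := le_add_of_nonneg_right (by positivity)
  have h4 : |deriv g 0| ≤ |deriv g 0| * (1 + |s| ^ 3) := le_mul_of_one_le_right (abs_nonneg _) h3
  have h5 : (L : ℝ) * |s| ≤ L * (2 * (1 + |s| ^ 3)) := mul_le_mul_of_nonneg_left hs L.2
  linarith [hpC s]

theorem convex_deriv_mul_sub_ge {f : ℝ → ℝ} (hf : ConvexOn ℝ univ f) (hd : Differentiable ℝ f)
    (a b : ℝ) : f a - f b ≤ deriv f a * (a - b) := by
  rcases lt_trichotomy a b with h | h | h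
  · have := hf.deriv_le_slope (mem_univ a) (mem_univ b) h (hd a)
    rw [slope_def_field, le_div_iff₀ (by linarith)] at this
    linarith
  · simp [h]
  · have := hf.slope_le_deriv (mem_univ b) (mem_univ a) h (hd a)
    rw [slope_def_field, div_le_iff₀ (by linarith)] at this
    linarith

namespace SplitPotential

variable (W : SplitPotential)

theorem exists_abs_deriv_le : ∃ C : ℝ, 0 ≤ C ∧ ∀ a b,
    |deriv W.cvx a + deriv W.ccv b| ≤ C * (1 + |a| ^ 3 + |b| ^ 3) := by
  obtain ⟨C₁, h₁, hC₁⟩ := W.cvx_growth.exists_abs_deriv_le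
  obtain ⟨C₂, h₂, hC₂⟩ := W.ccv_growth.exists_abs_deriv_le
  refine ⟨C₁ + C₂, by positivity, fun a b => (abs_add_le _ _).trans ?_⟩
  have ha : 0 ≤ |a| ^ 3 := by positivity
  have hb : 0 ≤ |b| ^ 3 := by positivity
  nlinarith [hC₁ a, hC₂ b, mul_nonneg h₁ hb, mul_nonneg h₂ ha]

/-- The tangent inequality of the convex part at the new value is added to the assumed inequality
for the concave part at the old value. This makes the energy decay without a restriction on the time
step. -/
theorem sub_le_of_ccv {β : ℝ} (h : ∀ s₁ s₂ : ℝ,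
    deriv W.ccv s₂ * (s₁ - s₂) ≥ W.ccv s₁ - W.ccv s₂ + β * |s₁ - s₂| ^ 2) (a b : ℝ) :
    W.W a - W.W b + β * |a - b| ^ 2 ≤ (deriv W.cvx a + deriv W.ccv b) * (a - b) := by
  have h1 := convex_deriv_mul_sub_ge W.cvx_convex (W.cvx_contDiff.differentiable one_ne_zero) a b
  have h2 := h a b
  rw [W.split, W.split]
  linarith

theorem sub_le (a b : ℝ) :
    W.W a - W.W b ≤ (deriv W.cvx a + deriv W.ccv b) * (a - b) := by
  have := W.sub_le_of_ccv (β := 0) (fun s₁ s₂ => by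
    have := convex_deriv_mul_sub_ge W.ccv_concave.neg
      (W.ccv_contDiff.differentiable one_ne_zero).neg s₂ s₁
    rw [deriv.neg] at this
    simp only [Pi.neg_apply] at this
    linarith) a b
  linarith

end SplitPotential

theorem mem_polyhedron_of_mem_verts {S : Finset (Finset (Space d))} {p : Space d}
    (hp : p ∈ verts S) : p ∈ polyhedron S := by
  classical
  obtain ⟨s, hs, hps⟩ := Finset.mem_biUnion.1 hp
  exact convexHull_subset_polyhedron hs (subset_convexHull ℝ _ hps)

/-! ### Mass conservation and energy decay -/

namespace Mesh.IsDiscreteSolution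

variable {M : Mesh Ω} {c : Coefficients} {F G : SplitPotential} {τ : ℝ} {N : ℕ}
  {φ μ μΓ : ℕ → Space d → ℝ}

theorem isPL_φ (h : M.IsDiscreteSolution c F G τ N φ μ μΓ) {n : ℕ} (hn : n ≤ N) :
    IsPL M.cells (φ n) := Mesh.mem_feSpace.1 (h.φ_mem n hn)

theorem isPL_μ (h : M.IsDiscreteSolution c F G τ N φ μ μΓ) {n : ℕ} (hn : n < N) :
    IsPL M.cells (μ (n + 1)) := Mesh.mem_feSpace.1 (h.μ_mem n hn)

theorem isPL_μΓ (h : M.IsDiscreteSolution c F G τ N φ μ μΓ) {n : ℕ} (hn : n < N) :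
    IsPL M.bdryCells (μΓ (n + 1)) := (h.μΓ_mem n hn).2

theorem lumped_bulk (hΩ : IsConvexPolytopeDomain Ω) (h : M.IsDiscreteSolution c F G τ N φ μ μΓ)
    {n : ℕ} (hn : n < N) {θ : Space d → ℝ} (hθ : IsPL M.cells θ) :
    lumped M d M.cells (fun y => (φ (n + 1) y - φ n y) * θ y) =
      -(τ * c.m * energyForm d M.cells (μ (n + 1)) θ) := by
  have := h.bulk n hn θ (Mesh.mem_feSpace.2 hθ)
  rw [M.integral_interp hΩ, M.integral_interp hΩ, M.dirichlet_eq hΩ (h.isPL_μ hn) hθ] at this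
  simp only [sub_mul]
  rw [M.isFamily_cells.lumped_sub]
  linarith

/-- The scheme is stated for test functions on `Ω`, but here `θ` is given on `Γ` only. The nodal
interpolant over the boundary vertices extends it to `Ω`, and both sides depend only on its trace.
-/
theorem lumped_surface (hd : 0 < d) (h : M.IsDiscreteSolution c F G τ N φ μ μΓ)
    {n : ℕ} (hn : n < N) {θ : Space d → ℝ} (hθ : IsPL M.bdryCells θ) :
    lumped M (d - 1) M.bdryCells (fun y => (φ (n + 1) y - φ n y) * θ y) =
      -(τ * c.mΓ * energyForm (d - 1) M.bdryCells (μΓ (n + 1)) θ) := by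
  have hS := M.isFamily_bdryCells hd
  have hE := hS.nodal_eq_self hθ
  set θ' := M.nodal (verts M.bdryCells) θ with hθ'
  have hmem : θ' ∈ M.feSpace := M.nodal_mem_feSpace _ θ
  have hPL := Mesh.isPL_bdryCells (Mesh.mem_feSpace.1 hmem)
  have := h.surface n hn θ' hmem
  rw [M.bdryIntegral_bdryInterp, M.bdryIntegral_bdryInterp,
    M.bdryDirichlet_eq hd (h.isPL_μΓ hn) hPL, energyForm_comm, energyForm_congr hθ hE,
    energyForm_comm] at this
  have e : ∀ a : Space d → ℝ, lumped M (d - 1) M.bdryCells (fun y => a y * θ' y) =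
      lumped M (d - 1) M.bdryCells (fun y => a y * θ y) := fun a =>
    hS.lumped_congr fun p hp => by rw [hE (mem_polyhedron_of_mem_verts hp)]
  rw [e, e] at this
  simp only [sub_mul]
  rw [hS.lumped_sub]
  linarith

theorem lumped_potential (hd : 0 < d) (hΩ : IsConvexPolytopeDomain Ω)
    (h : M.IsDiscreteSolution c F G τ N φ μ μΓ) {n : ℕ} (hn : n < N) {θ : Space d → ℝ}
    (hθ : IsPL M.cells θ) :
    lumped M d M.cells (fun y => μ (n + 1) y * θ y) +
        lumped M (d - 1) M.bdryCells (fun y => μΓ (n + 1) y * θ y) =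
      c.δ * c.σ * energyForm d M.cells (φ (n + 1)) θ +
      c.δ⁻¹ * c.σ * lumped M d M.cells
        (fun y => (deriv F.cvx (φ (n + 1) y) + deriv F.ccv (φ n y)) * θ y) +
      c.κ * c.δΓ * energyForm (d - 1) M.bdryCells (φ (n + 1)) θ +
      c.δΓ⁻¹ * lumped M (d - 1) M.bdryCells
        (fun y => (deriv G.cvx (φ (n + 1) y) + deriv G.ccv (φ n y)) * θ y) := by
  have hφ := h.isPL_φ (n := n + 1) hn
  have := h.potential n hn θ (Mesh.mem_feSpace.2 hθ)
  rwa [M.integral_interp hΩ, M.integral_interp hΩ, M.bdryIntegral_bdryInterp,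
    M.bdryIntegral_bdryInterp, M.dirichlet_eq hΩ hφ hθ,
    M.bdryDirichlet_eq hd (Mesh.isPL_bdryCells hφ) (Mesh.isPL_bdryCells hθ)] at this

/-- Testing with 1 removes the gradient term, and lumping is exact for piecewise linear functions.
The projection preserves the initial mass because constants belong to the discrete space. -/
theorem integral_eq (hΩ : IsConvexPolytopeDomain Ω) (h : M.IsDiscreteSolution c F G τ N φ μ μΓ)
    {φ₀ : Space d → ℝ} (h₀ : M.IsL2Projection φ₀ (φ 0)) {n : ℕ} (hn : n ≤ N) :
    ∫ x in Ω, φ n x = ∫ x in Ω, φ₀ x := by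
  induction n with
  | zero => simpa using h₀.2 (fun _ => 1) (Mesh.mem_feSpace.2 (isPL_const 1))
  | succ n ih =>
    rw [← ih (by omega)]
    have hS := M.isFamily_cells
    have h1 := h.lumped_bulk hΩ hn (isPL_const 1)
    simp only [mul_one] at h1
    rw [energyForm_const_right, mul_zero, neg_zero, hS.lumped_sub,
      hS.lumped_eq_integral (h.isPL_φ hn), hS.lumped_eq_integral (h.isPL_φ (by omega)),
      M.polyhedron_cells, ← setIntegral_eq_closure hΩ, ← setIntegral_eq_closure hΩ] at h1
    linarith

end Mesh.IsDiscreteSolution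

/-- The discrete free energy. -/
noncomputable def Mesh.energy (M : Mesh Ω) (c : Coefficients) (F G : SplitPotential)
    (u : Space d → ℝ) : ℝ :=
  c.δ * c.σ / 2 * energyForm d M.cells u u +
    c.δ⁻¹ * c.σ * lumped M d M.cells (fun y => F.W (u y)) +
    c.κ * c.δΓ / 2 * energyForm (d - 1) M.bdryCells u u +
    c.δΓ⁻¹ * lumped M (d - 1) M.bdryCells (fun y => G.W (u y))

/-- The energy dissipated in a time step, `e` being the increment of the phase field. -/
noncomputable def Mesh.dissipation (M : Mesh Ω) (c : Coefficients) (β τ : ℝ)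
    (e w wΓ : Space d → ℝ) : ℝ :=
  c.δ * c.σ / 2 * energyForm d M.cells e e + c.κ * c.δΓ / 2 * energyForm (d - 1) M.bdryCells e e +
    c.δΓ⁻¹ * (β * bdryIntegral Ω fun x => |e x| ^ 2) +
    c.m * (τ * energyForm d M.cells w w) + c.mΓ * (τ * energyForm (d - 1) M.bdryCells wΓ wΓ)

/-- The bulk and surface equations are tested with the chemical potentials and the third equation
with the increment `e`; the mixed terms then cancel. Polarization of the Dirichlet forms leaves the
energies of the increments, and the nodal splitting inequality handles the potentials. The lumped
square of `e` dominates its integral, which gives the `β` term. -/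
theorem Mesh.IsDiscreteSolution.energy_step {M : Mesh Ω} {c : Coefficients} {F G : SplitPotential}
    {τ : ℝ} {N : ℕ} {φ μ μΓ : ℕ → Space d → ℝ} (hd : 0 < d) (hΩ : IsConvexPolytopeDomain Ω)
    {β : ℝ} (hβ : 0 ≤ β) (hG : ∀ s₁ s₂ : ℝ,
      deriv G.ccv s₂ * (s₁ - s₂) ≥ G.ccv s₁ - G.ccv s₂ + β * |s₁ - s₂| ^ 2)
    (h : M.IsDiscreteSolution c F G τ N φ μ μΓ) {n : ℕ} (hn : n < N) :
    M.energy c F G (φ (n + 1)) + M.dissipation c β τ (fun x => φ (n + 1) x - φ n x) (μ (n + 1))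
      (μΓ (n + 1)) ≤ M.energy c F G (φ n) := by
  have hS := M.isFamily_cells
  have hS' := M.isFamily_bdryCells hd
  have hφ := h.isPL_φ (n := n + 1) hn
  have hφ' := h.isPL_φ hn.le
  set e : Space d → ℝ := fun x => φ (n + 1) x - φ n x with he
  have hePL : IsPL M.cells e := hφ.sub hφ'
  have h1 := h.lumped_bulk hΩ hn (h.isPL_μ hn)
  have h2 := h.lumped_surface hd hn (h.isPL_μΓ hn)
  have h3 := h.lumped_potential hd hΩ hn hePL
  have e1 : lumped M d M.cells (fun y => μ (n + 1) y * e y) = _ :=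
    (hS.lumped_congr fun _ _ => mul_comm _ _).trans h1
  have e2 : lumped M (d - 1) M.bdryCells (fun y => μΓ (n + 1) y * e y) = _ :=
    (hS'.lumped_congr fun _ _ => mul_comm _ _).trans h2
  rw [e1, e2] at h3
  have h4 := two_mul_energyForm_sub (k := d) hφ hφ'
  have h5 := two_mul_energyForm_sub (k := d - 1) (Mesh.isPL_bdryCells hφ) (Mesh.isPL_bdryCells hφ')
  have h6 : lumped M d M.cells (fun y => F.W (φ (n + 1) y)) -
      lumped M d M.cells (fun y => F.W (φ n y)) ≤ lumped M d M.cells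
        (fun y => (deriv F.cvx (φ (n + 1) y) + deriv F.ccv (φ n y)) * e y) := by
    rw [← hS.lumped_sub]
    exact hS.lumped_mono fun p _ => F.sub_le _ _
  have h7 : lumped M (d - 1) M.bdryCells (fun y => G.W (φ (n + 1) y)) -
      lumped M (d - 1) M.bdryCells (fun y => G.W (φ n y)) +
      β * lumped M (d - 1) M.bdryCells (fun y => e y ^ 2) ≤ lumped M (d - 1) M.bdryCells
        (fun y => (deriv G.cvx (φ (n + 1) y) + deriv G.ccv (φ n y)) * e y) := by
    rw [← hS'.lumped_sub, ← hS'.lumped_const_mul, ← hS'.lumped_add]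
    refine hS'.lumped_mono fun p _ => ?_
    have := G.sub_le_of_ccv hG (φ (n + 1) p) (φ n p)
    rwa [sq_abs] at this
  have h8 : bdryIntegral Ω (fun x => |e x| ^ 2) ≤
      lumped M (d - 1) M.bdryCells (fun y => e y ^ 2) := by
    have := hS'.integral_sq_le_lumped (Mesh.isPL_bdryCells hePL)
    rw [M.polyhedron_bdryCells] at this
    simpa only [bdryIntegral, sq_abs] using this
  have h9 := mul_le_mul_of_nonneg_left h8 hβ
  have hδ := c.δ_pos
  have hσ := c.σ_pos
  have hδΓ := c.δΓ_pos
  have k6 := mul_le_mul_of_nonneg_left h6 (by positivity : 0 ≤ c.δ⁻¹ * c.σ)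
  have k7 := mul_le_mul_of_nonneg_left h7 (by positivity : 0 ≤ c.δΓ⁻¹)
  have k9 := mul_le_mul_of_nonneg_left h9 (by positivity : 0 ≤ c.δΓ⁻¹)
  have k4 := congrArg (fun t => c.δ * c.σ / 2 * t) h4
  have k5 := congrArg (fun t => c.κ * c.δΓ / 2 * t) h5
  simp only [← he] at k4 k5
  rw [Mesh.energy, Mesh.energy, Mesh.dissipation]
  linarith

theorem add_sum_le_of_step {a b : ℕ → ℝ} {N : ℕ} (h : ∀ n < N, a (n + 1) + b n ≤ a n) {n : ℕ}
    (hn : n ≤ N) : a n + ∑ i ∈ Finset.range n, b i ≤ a 0 := by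
  induction n with
  | zero => simp
  | succ n ih =>
    rw [Finset.sum_range_succ]
    linarith [h n hn, ih (by omega)]

/-- The a priori bounds that follow from the decay of the energy. -/
theorem exists_energy_bounds (hd : d = 2 ∨ d = 3) (hΩ : IsConvexPolytopeDomain Ω)
    (c : Coefficients) (F G : SplitPotential) {β : ℝ} (hβ : 0 ≤ β) (hG : ∀ s₁ s₂ : ℝ,
      deriv G.ccv s₂ * (s₁ - s₂) ≥ G.ccv s₁ - G.ccv s₂ + β * |s₁ - s₂| ^ 2) (C₀ : ℝ) :
    ∃ A : ℝ, ∀ (M : Mesh Ω) (τ : ℝ) (N : ℕ) (φ μ μΓ : ℕ → Space d → ℝ), 0 < τ →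
      M.initialEnergy c.κ F G (φ 0) ≤ C₀ → M.IsDiscreteSolution c F G τ N φ μ μΓ →
      (∀ n ≤ N, energyForm d M.cells (φ n) (φ n) ≤ A ∧
        lumped M d M.cells (fun y => F.W (φ n y)) ≤ A ∧
        c.κ * energyForm (d - 1) M.bdryCells (φ n) (φ n) ≤ A ∧
        lumped M (d - 1) M.bdryCells (fun y => G.W (φ n y)) ≤ A) ∧
      ∑ n ∈ Finset.range N, energyForm d M.cells (fun x => φ (n + 1) x - φ n x)
        (fun x => φ (n + 1) x - φ n x) ≤ A ∧
      c.κ * ∑ n ∈ Finset.range N, energyForm (d - 1) M.bdryCells (fun x => φ (n + 1) x - φ n x)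
        (fun x => φ (n + 1) x - φ n x) ≤ A ∧
      β * ∑ n ∈ Finset.range N, bdryIntegral Ω (fun x => |φ (n + 1) x - φ n x| ^ 2) ≤ A ∧
      τ * ∑ n ∈ Finset.range N, energyForm d M.cells (μ (n + 1)) (μ (n + 1)) ≤ A ∧
      τ * ∑ n ∈ Finset.range N, energyForm (d - 1) M.bdryCells (μΓ (n + 1)) (μΓ (n + 1)) ≤ A := by
  have hd0 : 0 < d := by omega
  obtain ⟨l, hl, hlF⟩ := F.bddBelow
  obtain ⟨l', hl', hlG⟩ := G.bddBelow
  set V := l * (μHE[d] : Measure (Space d)).real (closure Ω) with hV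
  set V' := l' * (μHE[d - 1] : Measure (Space d)).real (frontier Ω) with hV'
  have hV0 : 0 ≤ V := by positivity
  have hV'0 : 0 ≤ V' := by positivity
  have hδ := c.δ_pos
  have hσ := c.σ_pos
  have hδΓ := c.δΓ_pos
  have hm := c.m_pos
  have hmΓ := c.mΓ_pos
  have hκ := c.κ_nonneg
  -- The initial energy has four terms bounded below by `0`, `-V`, `0` and `-V'`, so each of them is
  -- at most `R`.
  set R := |C₀| + V + V' with hR
  have hR0 : 0 ≤ R := by positivity
  -- The first summand bounds the initial free energy. The other two absorb the possibly negative
  -- potential terms at the later time, so that every single weighted term is at most `K`.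
  set K := (c.δ * c.σ / 2 + c.δ⁻¹ * c.σ + c.δΓ / 2 + c.δΓ⁻¹) * R + c.δ⁻¹ * c.σ * V + c.δΓ⁻¹ * V'
    with hK
  have hK0 : 0 ≤ K := by positivity
  -- The sum dominates the inverse of each coefficient, so the one constant `K * r` serves for all
  -- unweighted quantities.
  set r := (c.δ * c.σ / 2)⁻¹ + (c.δ⁻¹ * c.σ)⁻¹ + (c.δΓ / 2)⁻¹ + c.δΓ⁻¹⁻¹ + c.m⁻¹ + c.mΓ⁻¹ with hr
  have key : ∀ a : ℝ, 0 < a → a⁻¹ ≤ r → ∀ x, a * x ≤ K → x ≤ K * r := by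
    intro a ha har x hx
    calc x = a⁻¹ * (a * x) := by field_simp
      _ ≤ a⁻¹ * K := by gcongr
      _ ≤ K * r := by rw [mul_comm]; gcongr
  have i1 : 0 < (c.δ * c.σ / 2)⁻¹ := by positivity
  have i2 : 0 < (c.δ⁻¹ * c.σ)⁻¹ := by positivity
  have i3 : 0 < (c.δΓ / 2)⁻¹ := by positivity
  have i4 : 0 < c.δΓ⁻¹⁻¹ := by positivity
  have i5 : 0 < c.m⁻¹ := by positivity
  have i6 : 0 < c.mΓ⁻¹ := by positivity
  refine ⟨K * r, fun M τ N φ μ μΓ hτ h0 h => ?_⟩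
  have hS := M.isFamily_cells
  have hS' := M.isFamily_bdryCells hd0
  have low : ∀ u : Space d → ℝ, -V ≤ lumped M d M.cells (fun y => F.W (u y)) := fun u => by
    have := hS.lumped_mono (a := fun _ => -l) (b := fun y => F.W (u y)) fun p _ => (hlF _).le
    rw [hS.lumped_const, M.polyhedron_cells] at this
    linarith
  have low' : ∀ u : Space d → ℝ, -V' ≤ lumped M (d - 1) M.bdryCells (fun y => G.W (u y)) :=
    fun u => by
    have := hS'.lumped_mono (a := fun _ => -l') (b := fun y => G.W (u y)) fun p _ => (hlG _).le
    rw [hS'.lumped_const, M.polyhedron_bdryCells] at this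
    linarith
  have hφ0 := h.isPL_φ (Nat.zero_le N)
  have hφ0' := Mesh.isPL_bdryCells hφ0
  rw [Mesh.initialEnergy, M.integral_interp hΩ, M.bdryIntegral_bdryInterp,
    M.dirichlet_eq hΩ hφ0 hφ0, M.bdryDirichlet_eq hd0 hφ0' hφ0'] at h0
  have hE0 : M.energy c F G (φ 0) ≤ (c.δ * c.σ / 2 + c.δ⁻¹ * c.σ + c.δΓ / 2 + c.δΓ⁻¹) * R := by
    have a1 : 0 ≤ energyForm d M.cells (φ 0) (φ 0) := energyForm_self_nonneg
    have a2 : 0 ≤ c.κ * energyForm (d - 1) M.bdryCells (φ 0) (φ 0) :=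
      mul_nonneg hκ energyForm_self_nonneg
    have a3 := low (φ 0)
    have a4 := low' (φ 0)
    have a5 := le_abs_self C₀
    have b1 : energyForm d M.cells (φ 0) (φ 0) ≤ R := by linarith
    have b2 : lumped M d M.cells (fun y => F.W (φ 0 y)) ≤ R := by linarith
    have b3 : c.κ * energyForm (d - 1) M.bdryCells (φ 0) (φ 0) ≤ R := by linarith
    have b4 : lumped M (d - 1) M.bdryCells (fun y => G.W (φ 0 y)) ≤ R := by linarith
    have c1 := mul_le_mul_of_nonneg_left b1 (by positivity : 0 ≤ c.δ * c.σ / 2)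
    have c2 := mul_le_mul_of_nonneg_left b2 (by positivity : 0 ≤ c.δ⁻¹ * c.σ)
    have c3 := mul_le_mul_of_nonneg_left b3 (by positivity : 0 ≤ c.δΓ / 2)
    have c4 := mul_le_mul_of_nonneg_left b4 (by positivity : 0 ≤ c.δΓ⁻¹)
    rw [Mesh.energy]
    linarith
  have hstep := fun n (hn : n ≤ N) => add_sum_le_of_step (a := fun n => M.energy c F G (φ n))
    (b := fun n => M.dissipation c β τ (fun x => φ (n + 1) x - φ n x) (μ (n + 1)) (μΓ (n + 1)))
    (fun n hn => h.energy_step hd0 hΩ hβ hG hn) hn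
  simp only [Mesh.dissipation, Finset.sum_add_distrib, ← Finset.mul_sum] at hstep
  have s1 : ∀ n, 0 ≤ c.δ * c.σ / 2 * ∑ i ∈ Finset.range n, energyForm d M.cells
      (fun x => φ (i + 1) x - φ i x) (fun x => φ (i + 1) x - φ i x) := fun n =>
    mul_nonneg (by positivity) (Finset.sum_nonneg fun _ _ => energyForm_self_nonneg)
  have s2 : ∀ n, 0 ≤ c.κ * c.δΓ / 2 * ∑ i ∈ Finset.range n, energyForm (d - 1) M.bdryCells
      (fun x => φ (i + 1) x - φ i x) (fun x => φ (i + 1) x - φ i x) := fun n =>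
    mul_nonneg (by positivity) (Finset.sum_nonneg fun _ _ => energyForm_self_nonneg)
  have s3 : ∀ n, 0 ≤ c.δΓ⁻¹ * (β * ∑ i ∈ Finset.range n,
      bdryIntegral Ω fun x => |φ (i + 1) x - φ i x| ^ 2) := fun n =>
    mul_nonneg (by positivity) (mul_nonneg hβ (Finset.sum_nonneg fun _ _ =>
      integral_nonneg fun _ => by positivity))
  have s4 : ∀ n, 0 ≤ c.m * (τ * ∑ i ∈ Finset.range n,
      energyForm d M.cells (μ (i + 1)) (μ (i + 1))) := fun n =>
    mul_nonneg hm.le (mul_nonneg hτ.le (Finset.sum_nonneg fun _ _ => energyForm_self_nonneg))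
  have s5 : ∀ n, 0 ≤ c.mΓ * (τ * ∑ i ∈ Finset.range n,
      energyForm (d - 1) M.bdryCells (μΓ (i + 1)) (μΓ (i + 1))) := fun n =>
    mul_nonneg hmΓ.le (mul_nonneg hτ.le (Finset.sum_nonneg fun _ _ => energyForm_self_nonneg))
  have t1 : ∀ n, 0 ≤ c.δ * c.σ / 2 * energyForm d M.cells (φ n) (φ n) := fun n =>
    mul_nonneg (by positivity) energyForm_self_nonneg
  have t2 : ∀ n, 0 ≤ c.κ * c.δΓ / 2 * energyForm (d - 1) M.bdryCells (φ n) (φ n) := fun n =>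
    mul_nonneg (by positivity) energyForm_self_nonneg
  have t3 : ∀ n, -(c.δ⁻¹ * c.σ * V) ≤
      c.δ⁻¹ * c.σ * lumped M d M.cells (fun y => F.W (φ n y)) := fun n => by
    have := mul_le_mul_of_nonneg_left (low (φ n)) (by positivity : 0 ≤ c.δ⁻¹ * c.σ)
    linarith
  have t4 : ∀ n, -(c.δΓ⁻¹ * V') ≤
      c.δΓ⁻¹ * lumped M (d - 1) M.bdryCells (fun y => G.W (φ n y)) := fun n => by
    have := mul_le_mul_of_nonneg_left (low' (φ n)) (by positivity : 0 ≤ c.δΓ⁻¹)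
    linarith
  have u3 : 0 ≤ c.δ⁻¹ * c.σ * V := by positivity
  have u4 : 0 ≤ c.δΓ⁻¹ * V' := by positivity
  refine ⟨fun n hn => ?_, ?_⟩
  · have hs := hstep n hn
    rw [Mesh.energy] at hs
    refine ⟨key (c.δ * c.σ / 2) (by positivity) (by linarith) _ ?_,
      key (c.δ⁻¹ * c.σ) (by positivity) (by linarith) _ ?_,
      key (c.δΓ / 2) (by positivity) (by linarith) _ ?_,
      key c.δΓ⁻¹ (by positivity) (by linarith) _ ?_⟩ <;>
    linarith [s1 n, s2 n, s3 n, s4 n, s5 n, t1 n, t2 n, t3 n, t4 n]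
  · have hs := hstep N le_rfl
    rw [Mesh.energy] at hs
    refine ⟨key (c.δ * c.σ / 2) (by positivity) (by linarith) _ ?_,
      key (c.δΓ / 2) (by positivity) (by linarith) _ ?_,
      key c.δΓ⁻¹ (by positivity) (by linarith) _ ?_,
      key c.m (by positivity) (by linarith) _ ?_,
      key c.mΓ (by positivity) (by linarith) _ ?_⟩ <;>
    linarith [s1 N, s2 N, s3 N, s4 N, s5 N, t1 N, t2 N, t3 N, t4 N]

/-! ### Moments and L² bounds of the chemical potentials -/

namespace IsFamily

variable {M : Mesh Ω} {k : ℕ} {S : Finset (Finset (Space d))}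

/-- The Cauchy-Schwarz inequality for a nonnegative functional, from the lumped square of `t - a`
with `t` close to the mean of `a`. The extra 1 avoids division by a vanishing volume. -/
theorem sq_lumped_le (hS : IsFamily M k S) (a : Space d → ℝ) :
    lumped M k S a ^ 2 ≤ ((μHE[k] : Measure (Space d)).real (polyhedron S) + 1) *
      lumped M k S (fun p => a p ^ 2) := by
  set V := (μHE[k] : Measure (Space d)).real (polyhedron S) with hV
  have hV0 : 0 ≤ V := measureReal_nonneg
  set l := lumped M k S a
  set t := l / (V + 1) with ht
  have h1 : 0 ≤ lumped M k S (fun p => (t ^ 2 - 2 * t * a p) + a p ^ 2) :=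
    hS.lumped_nonneg fun p _ => by nlinarith [sq_nonneg (t - a p)]
  rw [hS.lumped_add, hS.lumped_sub, hS.lumped_const, hS.lumped_const_mul] at h1
  have h2 : l = t * (V + 1) := by rw [ht]; field_simp
  have h3 : t ^ 2 * (V + 1) ≤ lumped M k S (fun p => a p ^ 2) := by
    have : lumped M k S a = t * (V + 1) := h2
    rw [this] at h1
    nlinarith [sq_nonneg t]
  rw [h2]
  nlinarith

theorem lumped_mul_le (hS : IsFamily M k S) {W : SplitPotential} {C : ℝ} (hC : 0 ≤ C)
    (hW : ∀ a b, |deriv W.cvx a + deriv W.ccv b| ≤ C * (1 + |a| ^ 3 + |b| ^ 3))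
    {u v θ : Space d → ℝ} (hθ : ∀ p ∈ verts S, |θ p| ≤ 1) {B : ℝ}
    (hu : lumped M k S (fun x => |u x| ^ 3) ≤ B) (hv : lumped M k S (fun x => |v x| ^ 3) ≤ B) :
    |lumped M k S fun y => (deriv W.cvx (u y) + deriv W.ccv (v y)) * θ y| ≤
      C * ((μHE[k] : Measure (Space d)).real (polyhedron S) + B + B) := by
  calc _ ≤ lumped M k S fun y => |(deriv W.cvx (u y) + deriv W.ccv (v y)) * θ y| :=
        hS.abs_lumped_le _
    _ ≤ lumped M k S fun y => C * (1 + |u y| ^ 3 + |v y| ^ 3) := hS.lumped_mono fun p hp => by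
        rw [abs_mul]
        exact (mul_le_of_le_one_right (abs_nonneg _) (hθ p hp)).trans (hW _ _)
    _ = C * ((μHE[k] : Measure (Space d)).real (polyhedron S) +
          lumped M k S (fun x => |u x| ^ 3) + lumped M k S (fun x => |v x| ^ 3)) := by
        rw [hS.lumped_const_mul, hS.lumped_add, hS.lumped_add, hS.lumped_const, one_mul]
    _ ≤ _ := by gcongr

end IsFamily

theorem abs_bump_le_one (p : Space d) {r : ℝ} (hr : 0 < r) (hr1 : r ≤ 1) (x : Space d) :
    |bump p r x| ≤ 1 := by
  rw [abs_of_nonneg (bump_nonneg p r x)]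
  linarith [bump_le p hr x]

theorem Mesh.verts_bdryCells_subset (M : Mesh Ω) : verts M.bdryCells ⊆ verts M.cells :=
  M.bdryVertices_subset

/-- The moments of the chemical potentials against bumps are bounded. -/
theorem exists_moment_bound (hd : 0 < d) (hΩ : IsConvexPolytopeDomain Ω) (c : Coefficients)
    (F G : SplitPotential) {ρ : ℝ} (hρ : 0 < ρ) (A B : ℝ) :
    ∃ K : ℝ, ∀ (M : Mesh Ω) (h : ℝ), 0 < h → M.IsAdmissible h ρ →
      ∀ (τ : ℝ) (N : ℕ) (φ μ μΓ : ℕ → Space d → ℝ), M.IsDiscreteSolution c F G τ N φ μ μΓ →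
      (∀ n ≤ N, energyForm d M.cells (φ n) (φ n) ≤ A ∧
        c.κ * energyForm (d - 1) M.bdryCells (φ n) (φ n) ≤ A ∧
        lumped M d M.cells (fun x => |φ n x| ^ 3) ≤ B ∧
        lumped M (d - 1) M.bdryCells (fun x => |φ n x| ^ 3) ≤ B) →
      ∀ n < N, ∀ (p : Space d) (r : ℝ), 0 < r → r ≤ 1 →
      |lumped M d M.cells (fun y => μ (n + 1) y * bump p r y) +
        lumped M (d - 1) M.bdryCells (fun y => μΓ (n + 1) y * bump p r y)| ≤ K := by
  obtain ⟨CF, hCF, hF⟩ := F.exists_abs_deriv_le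
  obtain ⟨CG, hCG, hG⟩ := G.exists_abs_deriv_le
  set V := (μHE[d] : Measure (Space d)).real (closure Ω) with hV
  set V' := (μHE[d - 1] : Measure (Space d)).real (frontier Ω) with hV'
  have hδ := c.δ_pos
  have hσ := c.σ_pos
  have hδΓ := c.δΓ_pos
  have hκ := c.κ_nonneg
  refine ⟨c.δ * c.σ * (A + (2 / ρ) ^ 2 * V) + c.δ⁻¹ * c.σ * (CF * (V + B + B)) +
    c.δΓ * (A + c.κ * ((2 / ρ) ^ 2 * V')) + c.δΓ⁻¹ * (CG * (V' + B + B)),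
    fun M h hh hM τ N φ μ μΓ hsol hbd n hn p r hr hr1 => ?_⟩
  have hS := M.isFamily_cells
  have hS' := M.isFamily_bdryCells hd
  -- Boundary vertices are vertices of the bulk partition, so this one interpolant agrees with the
  -- bump at all bulk and boundary nodes. Lumped terms cannot tell the two apart, while the
  -- Dirichlet terms see the bounded slopes of `θ`.
  set θ := M.nodal (verts M.cells) (bump p r) with hθ
  have hθPL : IsPL M.cells θ := hS.isPL_nodal _ _
  have hθv : ∀ v ∈ verts M.cells, θ v = bump p r v := fun v hv => by
    obtain ⟨s, hs, hvs⟩ := Finset.mem_biUnion.1 hv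
    exact M.nodal_vertex (hS.mem_faces s hs) _ hvs hv
  have hθ1 : ∀ v ∈ verts M.cells, |θ v| ≤ 1 := fun v hv => by
    rw [hθv v hv]; exact abs_bump_le_one p hr hr1 v
  have e1 := hS.energyForm_bump_le hh hρ hM.diam_le hM.ball subset_rfl p r
  have e2 := hS'.energyForm_bump_le hh hρ hM.bdry_diam_le hM.bdry_ball M.verts_bdryCells_subset p r
  rw [M.polyhedron_cells] at e1
  rw [M.polyhedron_bdryCells] at e2
  rw [← hθ] at e1 e2
  obtain ⟨a1, a2, a3, a4⟩ := hbd (n + 1) hn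
  obtain ⟨-, -, b3, b4⟩ := hbd n hn.le
  have f1 := (abs_energyForm_le (k := d) (S := M.cells) (u := φ (n + 1)) (v := θ)).trans
    (add_le_add a1 e1)
  have f2 : c.κ * |energyForm (d - 1) M.bdryCells (φ (n + 1)) θ| ≤
      A + c.κ * ((2 / ρ) ^ 2 * V') := by
    refine (mul_le_mul_of_nonneg_left abs_energyForm_le hκ).trans ?_
    rw [mul_add]
    exact add_le_add a2 (mul_le_mul_of_nonneg_left e2 hκ)
  have f3 := hS.lumped_mul_le hCF hF hθ1 a3 b3
  have f4 := hS'.lumped_mul_le hCG hG (fun v hv => hθ1 v (M.verts_bdryCells_subset hv)) a4 b4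
  rw [M.polyhedron_cells] at f3
  rw [M.polyhedron_bdryCells] at f4
  have hpot := hsol.lumped_potential hd hΩ hn hθPL
  rw [hS.lumped_congr (b := fun y => μ (n + 1) y * bump p r y) fun v hv => by rw [hθv v hv],
    hS'.lumped_congr (b := fun y => μΓ (n + 1) y * bump p r y) fun v hv => by
      rw [hθv v (M.verts_bdryCells_subset hv)]] at hpot
  rw [hpot]
  refine (abs_add_le _ _).trans (add_le_add ((abs_add_le _ _).trans (add_le_add
    ((abs_add_le _ _).trans (add_le_add ?_ ?_)) ?_)) ?_)
  · rw [abs_mul, abs_of_pos (by positivity : 0 < c.δ * c.σ)]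
    gcongr
  · rw [abs_mul, abs_of_pos (by positivity : 0 < c.δ⁻¹ * c.σ)]
    gcongr
  · rw [abs_mul, abs_of_nonneg (by positivity : 0 ≤ c.κ * c.δΓ), mul_comm c.κ, mul_assoc]
    gcongr
  · rw [abs_mul, abs_of_pos (by positivity : 0 < c.δΓ⁻¹)]
    gcongr

/-- The chemical potentials are controlled by their Dirichlet energies. -/
theorem exists_potential_bounds (hd : d = 2 ∨ d = 3) (hΩ : IsConvexPolytopeDomain Ω) {ρ : ℝ}
    (hρ : 0 < ρ) (K : ℝ) : ∃ e h₀ : ℝ, 0 ≤ e ∧ 0 < h₀ ∧ ∀ (M : Mesh Ω) (h : ℝ), 0 < h → h ≤ h₀ →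
      M.IsAdmissible h ρ → ∀ w wΓ : Space d → ℝ, IsPL M.cells w → IsPL M.bdryCells wΓ →
      (∀ (p : Space d) (r : ℝ), 0 < r → r ≤ 1 → |lumped M d M.cells (fun y => w y * bump p r y) +
        lumped M (d - 1) M.bdryCells (fun y => wΓ y * bump p r y)| ≤ K) →
      ∫ x in Ω, w x ^ 2 ≤ e * (1 + energyForm d M.cells w w) ∧
      bdryIntegral Ω (fun x => wΓ x ^ 2) ≤
        e * (1 + energyForm d M.cells w w + energyForm (d - 1) M.bdryCells wΓ wΓ) := by
  have hd0 : 0 < d := by omega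
  obtain ⟨c₁, h₁, hc₁, hh₁, p, r, hr, hr1, hzero, hbulk⟩ := exists_bulk_poincare hd hΩ
  obtain ⟨c₂, h₂, hc₂, hh₂, hbdry⟩ := exists_bdry_poincare hd hΩ
  set V := (μHE[d] : Measure (Space d)).real (closure Ω) with hV
  -- Chosen so that twice the square of the lumped L¹ norm `l` of `w` is at most `P * (K ^ 2 + D)`;
  -- this bounds `(K + l) ^ 2`.
  set P := 2 * ((V + 1) * (4 ^ d * 2 ^ 2 * c₁)) with hP
  have hP0 : 0 ≤ P := by positivity
  refine ⟨c₁ * (K ^ 2 + 1) + c₂ * (2 * K ^ 2 + P * K ^ 2 + P + 1), min h₁ h₂, by positivity,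
    lt_min hh₁ hh₂, fun M h hh hhm hM w wΓ hw hwΓ hK => ?_⟩
  have hS := M.isFamily_cells
  have hS' := M.isFamily_bdryCells hd0
  set D := energyForm d M.cells w w with hD
  have hD0 : 0 ≤ D := energyForm_self_nonneg
  set D' := energyForm (d - 1) M.bdryCells wΓ wΓ with hD'
  have hD'0 : 0 ≤ D' := energyForm_self_nonneg
  -- The bump used in the bulk vanishes on `Γ`, so the boundary moment drops out and the bound on
  -- the sum becomes a bound on the moment of `w` alone.
  have hb : ∫ x in Ω, w x ^ 2 ≤ c₁ * (K ^ 2 + D) := by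
    refine hbulk M h (hhm.trans (min_le_left _ _)) hM.diam_le w hw K ?_
    have := hK p r hr hr1
    rwa [hS'.lumped_congr (b := fun _ => 0) fun v hv => by
      rw [hzero v (M.polyhedron_bdryCells ▸ mem_polyhedron_of_mem_verts hv), mul_zero],
      hS'.lumped_const, zero_mul, add_zero] at this
  have hK2 := sq_nonneg K
  constructor
  · refine hb.trans ?_
    rw [← sub_nonneg]
    have e : (c₁ * (K ^ 2 + 1) + c₂ * (2 * K ^ 2 + P * K ^ 2 + P + 1)) * (1 + D) -
      c₁ * (K ^ 2 + D) = c₁ * (K ^ 2 * D + 1) +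
        c₂ * (2 * K ^ 2 + P * K ^ 2 + P + 1) * (1 + D) := by ring
    rw [e]; positivity
  · set l := lumped M d M.cells (fun y => |w y|) with hl
    have hl2 : l ^ 2 ≤ (V + 1) * (4 ^ d * 2 ^ 2 * (c₁ * (K ^ 2 + D))) := by
      have h1 := hS.sq_lumped_le fun y => |w y|
      have h2 := hS.lumped_pow_le hw 2
      rw [M.polyhedron_cells] at h1 h2
      simp only [sq_abs] at h1 h2
      rw [← setIntegral_eq_closure hΩ] at h2
      refine h1.trans (mul_le_mul_of_nonneg_left (h2.trans ?_) (by positivity))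
      gcongr
    have hQ := hbdry M h ρ hh (hhm.trans (min_le_right _ _)) hρ hM wΓ hwΓ (K + l) ?_
    · refine hQ.trans ?_
      have h3 : (K + l) ^ 2 ≤ 2 * K ^ 2 + P * (K ^ 2 + D) := by
        rw [hP]; nlinarith [sq_nonneg (K - l)]
      refine (mul_le_mul_of_nonneg_left (add_le_add_left h3 D') hc₂).trans ?_
      rw [← sub_nonneg]
      have e : (c₁ * (K ^ 2 + 1) + c₂ * (2 * K ^ 2 + P * K ^ 2 + P + 1)) * (1 + D + D') -
          c₂ * (2 * K ^ 2 + P * (K ^ 2 + D) + D') = c₁ * (K ^ 2 + 1) * (1 + D + D') +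
          c₂ * ((2 * K ^ 2 + P * K ^ 2) * (D + D') + P * (1 + D') + (1 + D)) := by ring
      rw [e]; positivity
    -- For bumps on the boundary the bulk moment does not vanish, but it is at most `l`, which the
    -- bulk estimate already controls.
    · intro q t ht ht1
      have h1 := hK q t ht ht1
      have h2 : |lumped M d M.cells (fun y => w y * bump q t y)| ≤ l := by
        refine (hS.abs_lumped_le _).trans (hS.lumped_mono fun v _ => ?_)
        rw [abs_mul]
        exact mul_le_of_le_one_right (abs_nonneg _) (abs_bump_le_one q ht ht1 v)
      have h3 := abs_sub (lumped M d M.cells (fun y => w y * bump q t y) +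
        lumped M (d - 1) M.bdryCells (fun y => wΓ y * bump q t y))
        (lumped M d M.cells (fun y => w y * bump q t y))
      rw [add_sub_cancel_left] at h3
      linarith

/-! ### Assembly of the estimate -/

theorem exists_maxUpTo_eq (N : ℕ) (a : ℕ → ℝ) : ∃ n ≤ N, maxUpTo N a = a n := by
  obtain ⟨n, hn, h⟩ := Finset.exists_mem_eq_sup' Finset.nonempty_range_add_one a
  exact ⟨n, Nat.lt_succ_iff.1 (Finset.mem_range.1 hn), h⟩

theorem maxUpTo_le {N : ℕ} {a : ℕ → ℝ} {b : ℝ} (h : ∀ n ≤ N, a n ≤ b) : maxUpTo N a ≤ b := by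
  obtain ⟨n, hn, e⟩ := exists_maxUpTo_eq N a
  exact e.trans_le (h n hn)

end CahnHilliardFEM

theorem corollary4p1 (d : ℕ) (hd : d = 2 ∨ d = 3)
    (Ω : Set (Space d)) (hΩ : IsConvexPolytopeDomain Ω)
    (c : Coefficients) (F G : SplitPotential)
    (β : ℝ) (hβ : 0 ≤ β) (hκβ : c.κ = 0 → 0 < β)
    (hG : ∀ s₁ s₂ : ℝ,
      deriv G.ccv s₂ * (s₁ - s₂) ≥ G.ccv s₁ - G.ccv s₂ + β * |s₁ - s₂| ^ 2)
    (T : ℝ) (hT : 0 < T)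
    (ρ : ℝ) (hρ : 0 < ρ)
    (φ₀ : Space d → ℝ) (hφ₀ : MemLp φ₀ 2 (volume.restrict Ω))
    (C₀ : ℝ) :
    ∃ h₀ > 0, ∃ C > 0, ∀ h : ℝ, 0 < h → h < h₀ →
      ∀ M : Mesh Ω, M.IsAdmissible h ρ →
      ∀ N : ℕ, 0 < N → ∀ φ μ μΓ : ℕ → Space d → ℝ,
        M.IsL2Projection φ₀ (φ 0) →
        M.initialEnergy c.κ F G (φ 0) ≤ C₀ →
        M.IsDiscreteSolution c F G (T / N) N φ μ μΓ →
        maxUpTo N (fun n => h1NormSq Ω (φ n)) +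
          maxUpTo N (fun n => ∫ x in Ω, M.interp (fun y => F.W (φ n y)) x) +
          c.κ * maxUpTo N (fun n => M.bdryH1NormSq (φ n)) +
          maxUpTo N (fun n => bdryIntegral Ω (M.bdryInterp fun y => G.W (φ n y))) +
          ∑ n ∈ Finset.range N,
            dirichlet Ω (fun x => φ (n + 1) x - φ n x) (fun x => φ (n + 1) x - φ n x) +
          c.κ * ∑ n ∈ Finset.range N,
            M.bdryDirichlet (fun x => φ (n + 1) x - φ n x) (fun x => φ (n + 1) x - φ n x) +
          β * ∑ n ∈ Finset.range N, bdryIntegral Ω (fun x => |φ (n + 1) x - φ n x| ^ 2) +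
          T / N * c.m * ∑ n ∈ Finset.range N, h1NormSq Ω (μ (n + 1)) +
          T / N * c.mΓ * ∑ n ∈ Finset.range N, M.bdryH1NormSq (μΓ (n + 1)) ≤ C := by
  have hd0 : 0 < d := by omega
  obtain ⟨A, hA⟩ := exists_energy_bounds hd hΩ c F G hβ hG C₀
  -- One number that bounds both the Dirichlet energy and the absolute value of the conserved mass.
  set A' := max A |∫ x in Ω, φ₀ x| with hA'
  obtain ⟨B, hB⟩ := exists_norm_bounds hd hΩ A'
  obtain ⟨K, hK⟩ := exists_moment_bound hd0 hΩ c F G hρ A B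
  obtain ⟨e, h₀, he, hh₀, hpot⟩ := exists_potential_bounds hd hΩ hρ K
  -- The summands follow the order of the terms in the claim; `T` enters only through the two sums
  -- over the chemical potentials.
  set X := (B + A) + A + (c.κ * B + A) + A + A + A + A +
    c.m * (e * T + (e + 1) * A) + c.mΓ * (e * T + (e * A + (e + 1) * A)) with hX
  refine ⟨h₀, hh₀, max X 1, lt_max_of_lt_right one_pos, fun h hh hhh₀ M hM N hN φ μ μΓ hproj hinit
    hsol => le_max_of_le_left ?_⟩
  have hN0 : (0 : ℝ) < N := by exact_mod_cast hN
  have hτ : 0 < T / N := by positivity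
  have hκ := c.κ_nonneg
  have hS := M.isFamily_cells
  have hS' := M.isFamily_bdryCells hd0
  obtain ⟨hφA, s1, s2, s3, s4, s5⟩ := hA M (T / N) N φ μ μΓ hτ hinit hsol
  have hφB := fun n (hn : n ≤ N) => hB M (φ n) (hsol.isPL_φ hn)
    (by rw [hsol.integral_eq hΩ hproj hn]; exact le_max_right _ _)
    ((hφA n hn).1.trans (le_max_left _ _))
  have hmom := hK M h hh hM (T / N) N φ μ μΓ hsol fun n hn =>
    ⟨(hφA n hn).1, (hφA n hn).2.2.1, (hφB n hn).2.2.1, (hφB n hn).2.2.2⟩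
  have hμ := fun n (hn : n < N) => hpot M h hh hhh₀.le hM (μ (n + 1)) (μΓ (n + 1))
    (hsol.isPL_μ hn) (hsol.isPL_μΓ hn) (hmom n hn)
  have hinc : ∀ n < N, IsPL M.cells fun x => φ (n + 1) x - φ n x := fun n hn =>
    (hsol.isPL_φ (n := n + 1) hn).sub (hsol.isPL_φ hn.le)
  have t1 : maxUpTo N (fun n => h1NormSq Ω (φ n)) ≤ B + A := maxUpTo_le fun n hn => by
    have hPL := hsol.isPL_φ hn
    rw [h1NormSq, M.dirichlet_eq hΩ hPL hPL]
    exact add_le_add (hφB n hn).1 (hφA n hn).1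
  have t2 : maxUpTo N (fun n => ∫ x in Ω, M.interp (fun y => F.W (φ n y)) x) ≤ A :=
    maxUpTo_le fun n hn => by rw [M.integral_interp hΩ]; exact (hφA n hn).2.1
  have t3 : c.κ * maxUpTo N (fun n => M.bdryH1NormSq (φ n)) ≤ c.κ * B + A := by
    -- Only `κ` times the surface Dirichlet energy is bounded, so `κ` is distributed at an index
    -- where the maximum is attained.
    obtain ⟨n, hn, hmax⟩ := exists_maxUpTo_eq N fun n => M.bdryH1NormSq (φ n)
    have hPL := Mesh.isPL_bdryCells (hsol.isPL_φ hn)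
    rw [hmax, Mesh.bdryH1NormSq, M.bdryDirichlet_eq hd0 hPL hPL, mul_add]
    exact add_le_add (mul_le_mul_of_nonneg_left (hφB n hn).2.1 hκ) (hφA n hn).2.2.1
  have t4 : maxUpTo N (fun n => bdryIntegral Ω (M.bdryInterp fun y => G.W (φ n y))) ≤ A :=
    maxUpTo_le fun n hn => by rw [M.bdryIntegral_bdryInterp]; exact (hφA n hn).2.2.2
  have t5 : ∑ n ∈ Finset.range N, dirichlet Ω (fun x => φ (n + 1) x - φ n x)
      (fun x => φ (n + 1) x - φ n x) ≤ A := by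
    refine le_trans (le_of_eq (Finset.sum_congr rfl fun n hn => ?_)) s1
    have hPL := hinc n (Finset.mem_range.1 hn)
    exact M.dirichlet_eq hΩ hPL hPL
  have t6 : c.κ * ∑ n ∈ Finset.range N, M.bdryDirichlet (fun x => φ (n + 1) x - φ n x)
      (fun x => φ (n + 1) x - φ n x) ≤ A := by
    refine le_trans (le_of_eq (congrArg (c.κ * ·) (Finset.sum_congr rfl fun n hn => ?_))) s2
    have hPL := Mesh.isPL_bdryCells (hinc n (Finset.mem_range.1 hn))
    exact M.bdryDirichlet_eq hd0 hPL hPL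
  -- The additive constant in the estimate of each time step is summed `N` times with weight `T /
  -- N`, so it contributes `e * T` for every `N`.
  have hsum : ∀ a b : ℕ → ℝ, (∀ n < N, a n ≤ e + b n) →
      T / N * ∑ n ∈ Finset.range N, a n ≤ e * T + T / N * ∑ n ∈ Finset.range N, b n := by
    intro a b hab
    calc T / N * ∑ n ∈ Finset.range N, a n ≤ T / N * ∑ n ∈ Finset.range N, (e + b n) :=
          mul_le_mul_of_nonneg_left
            (Finset.sum_le_sum fun n hn => hab n (Finset.mem_range.1 hn)) hτ.le
      _ = _ := by
          rw [Finset.sum_add_distrib, Finset.sum_const, Finset.card_range, nsmul_eq_mul]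
          field_simp
  have t8 : T / N * ∑ n ∈ Finset.range N, h1NormSq Ω (μ (n + 1)) ≤ e * T + (e + 1) * A := by
    refine (hsum _ (fun n => (e + 1) * energyForm d M.cells (μ (n + 1)) (μ (n + 1)))
      fun n hn => ?_).trans ?_
    · have hPL := hsol.isPL_μ hn
      rw [h1NormSq, M.dirichlet_eq hΩ hPL hPL]
      linarith [(hμ n hn).1]
    · rw [← Finset.mul_sum, mul_left_comm]
      gcongr
  have t9 : T / N * ∑ n ∈ Finset.range N, M.bdryH1NormSq (μΓ (n + 1)) ≤
      e * T + (e * A + (e + 1) * A) := by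
    refine (hsum _ (fun n => e * energyForm d M.cells (μ (n + 1)) (μ (n + 1)) +
      (e + 1) * energyForm (d - 1) M.bdryCells (μΓ (n + 1)) (μΓ (n + 1))) fun n hn => ?_).trans ?_
    · have hPL := hsol.isPL_μΓ hn
      rw [Mesh.bdryH1NormSq, M.bdryDirichlet_eq hd0 hPL hPL]
      linarith [(hμ n hn).2]
    · rw [Finset.sum_add_distrib, ← Finset.mul_sum, ← Finset.mul_sum, mul_add, mul_left_comm,
        mul_left_comm _ (e + 1)]
      gcongr
  have t8' := mul_le_mul_of_nonneg_left t8 c.m_pos.le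
  have t9' := mul_le_mul_of_nonneg_left t9 c.mΓ_pos.le
  rw [mul_comm (T / N) c.m, mul_comm (T / N) c.mΓ, mul_assoc, mul_assoc]
  linarith
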